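/- Let $d\ge 1$, $N\ge 1$. Let $L^2_a(\mathbb R^{dN})$ be the space of antisymmetric functions in $L^2((\mathbb R^d)^N,\mathbb C)$. Let $\mathcal G$ be the set of self-adjoint operators $G$ on $L^2(\mathbb R^d)$ such that $H^1(\mathbb R^d)\subset D(|G|^{1/2})$ and, for every $\varepsilon>0$, there is $c_\varepsilon\ge 0$ with $|G|\le -\varepsilon\Delta+c_\varepsilon$ in the sense of forms on $H^1(\mathbb R^d)$. Let $w:\mathbb R^d\to\mathbb R$ be measurable and such that for every $\varepsilon>0$ there is $c_\varepsilon\ge0$ with $\int |w||u|^2\le \varepsilon\|\nabla u\|^2+c_\varepsilon\|u\|^2$ for all $u\in H^1(\mathbb R^d)$. For $G\in\mathcal G$ let $$H^N(G)=\sum_{i=1}^N-\Delta_i+\sum_{i=1}^N G_i+\sum_{1\le i<j\le N}w(x_i-x_j)$$ be the self-adjoint operator on $L^2_a(\mathbb R^{dN})$ defined by its quadratic form, where $G_i$ is $G$ acting on the $i$-th variable. A ground state is a normalized minimizer of the quadratic form, the ground state energy is the infimum of the form on normalized functions, and uniqueness of a ground state is meant up to a phase. For $\psi\in L^2_a(\mathbb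 R^{dN})$ let $\gamma_\psi(x,y)=N\int_{\mathbb R^{d(N-1)}}\psi(x,z)\overline{\psi(y,z)}\,dz$ be its one-particle reduced density matrix. (1) Let $G_1\in\mathcal G$ be such that $H^N(G_1)$ has a unique ground state $\psi_1$, whose energy $E_1$ is isolated from the rest of the spectrum of $H^N(G_1)$. Let $\phi\in H^1(\mathbb R^d)$ with $\|\phi\|_{L^2}=1$ be such that $\langle \phi\wedge\chi,\psi_1\rangle=0$ for all $\chi\in L^2_a(\mathbb R^{d(N-1)})$. Then, for every $\varepsilon>0$, the operators $|\phi\rangle\langle\phi|$ and $G_2:=G_1+\varepsilon|\phi\rangle\langle\phi|$ are in $\mathcal G$, $G_2-G_1$ is not a constant multiple of the identity, the ground state energy of $H^N(G_2)$ is $E_1$, $H^N(G_2)\psi_1=E_1\psi_1$, and $\psi_1$ is the unique ground state of $H^N(G_2)$. (2) If $w=0$, and $G_1\in\mathcal G$ is such that $H^N(G_1)$ has a unique ground state $\psi_1$ whose energy is isolated from the rest of the spectrum, then $\psi_1$ is a Slater determinant of $N$ orthonormal functions in $L^2(\mathbb R^d)$, and there is $\phi\in H^1(\mathbb R^d)$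 with $\|\phi\|_{L^2}=1$ and $\langle \phi\wedge\chi,\psi_1\rangle=0$ for all $\chi\in L^2_a(\mathbb R^{d(N-1)})$. (3) Consequently the map $G\mapsto\gamma$, from non-local potentials with a unique ground state to the one-particle reduced density matrix of this ground state, is not injective, not even modulo additive constants: for $w=0$ there are $G_1,G_2\in\mathcal G$ such that $G_2-G_1$ is not a constant multiple of the identity, $H^N(G_1)$ and $H^N(G_2)$ have unique ground states $\psi_1$, $\psi_2$, the ground state energy of $H^N(G_1)$ is isolated from the rest of its spectrum, and $\gamma_{\psi_1}=\gamma_{\psi_2}$ almost everywhere. -/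

import Mathlib

open MeasureTheory
open scoped ContDiff ComplexConjugate InnerProductSpace

noncomputable section

namespace MatrixDFT

/-- The one-body space `ℝ^d`. -/
abbrev Space (d : ℕ) : Type := EuclideanSpace ℝ (Fin d)

/-- The configuration space `(ℝ^d)^N`, with Lebesgue measure. -/
abbrev Config (d N : ℕ) : Type := Fin N → Space d

/-- The Hilbert space `L²(X, ℂ)`. -/
abbrev L2 (X : Type) [MeasureSpace X] : Type := Lp ℂ 2 (volume : Measure X)

/-! ### Weak derivatives and the Sobolev space `H¹` -/

section Sobolev

variable {X : Type} [NormedAddCommGroup X] [NormedSpace ℝ X] [MeasureSpace X] [BorelSpace X]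
  [IsLocallyFiniteMeasure (volume : Measure X)]

theorem integrable_test_smul {θ : X → ℝ} (hθ : Continuous θ) (hc : HasCompactSupport θ)
    (f : L2 X) : Integrable (fun x => θ x • f x) :=
  ((Lp.memLp f).locallyIntegrable (by norm_num)).integrable_smul_left_of_hasCompactSupport hθ hc

theorem integrable_fderiv_test_smul {θ : X → ℝ} (hθ : ContDiff ℝ ∞ θ) (hc : HasCompactSupport θ)
    (m : X) (f : L2 X) : Integrable (fun x => fderiv ℝ θ x m • f x) :=
  integrable_test_smul ((hθ.continuous_fderiv (by simp)).clm_apply continuous_const)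
    (hc.fderiv_apply ℝ m) f

/-- The graph of the weak derivative in direction `m`: the pairs `(f, g)` in `L² × L²` with
`∫ (∂_m θ) f = - ∫ θ g` for all test functions `θ ∈ C_c^∞`. -/
def weakDerivGraph (m : X) : Submodule ℂ (L2 X × L2 X) where
  carrier := {p | ∀ θ : X → ℝ, ContDiff ℝ ∞ θ → HasCompactSupport θ →
    ∫ x, fderiv ℝ θ x m • p.1 x = - ∫ x, θ x • p.2 x}
  add_mem' := by
    intro p q hp hq θ hθ hc
    have h1 : ∫ x, fderiv ℝ θ x m • (p + q).1 x
        = ∫ x, fderiv ℝ θ x m • p.1 x + fderiv ℝ θ x m • q.1 x := by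
      refine integral_congr_ae ?_
      filter_upwards [Lp.coeFn_add p.1 q.1] with x hx
      simp only [Prod.fst_add, hx, Pi.add_apply, smul_add]
    have h2 : ∫ x, θ x • (p + q).2 x = ∫ x, θ x • p.2 x + θ x • q.2 x := by
      refine integral_congr_ae ?_
      filter_upwards [Lp.coeFn_add p.2 q.2] with x hx
      simp only [Prod.snd_add, hx, Pi.add_apply, smul_add]
    rw [h1, h2, integral_add (integrable_fderiv_test_smul hθ hc m _)
      (integrable_fderiv_test_smul hθ hc m _),
      integral_add (integrable_test_smul hθ.continuous hc _)
        (integrable_test_smul hθ.continuous hc _), hp θ hθ hc, hq θ hθ hc]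
    ring
  zero_mem' := by
    intro θ _ _
    have h : ∀ᵐ x : X, (0 : L2 X) x = 0 := by
      filter_upwards [Lp.coeFn_zero ℂ 2 (volume : Measure X)] with x hx
      simpa using hx
    rw [integral_eq_zero_of_ae, integral_eq_zero_of_ae, neg_zero]
    · filter_upwards [h] with x hx
      simp only [Prod.snd_zero, hx, smul_zero, Pi.zero_apply]
    · filter_upwards [h] with x hx
      simp only [Prod.fst_zero, hx, smul_zero, Pi.zero_apply]
  smul_mem' := by
    intro c p hp θ hθ hc
    have h1 : ∫ x, fderiv ℝ θ x m • (c • p).1 x = ∫ x, c • (fderiv ℝ θ x m • p.1 x) := by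
      refine integral_congr_ae ?_
      filter_upwards [Lp.coeFn_smul c p.1] with x hx
      simp only [Prod.smul_fst, hx, Pi.smul_apply]
      exact smul_comm _ _ _
    have h2 : ∫ x, θ x • (c • p).2 x = ∫ x, c • (θ x • p.2 x) := by
      refine integral_congr_ae ?_
      filter_upwards [Lp.coeFn_smul c p.2] with x hx
      simp only [Prod.smul_snd, hx, Pi.smul_apply]
      exact smul_comm _ _ _
    rw [h1, h2, integral_smul, integral_smul, hp θ hθ hc, smul_neg]

/-- The weak derivative `∂_m` as an unbounded operator on `L²(X)`, with its maximal domain. -/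
def weakDeriv (m : X) : L2 X →ₗ.[ℂ] L2 X := (weakDerivGraph m).toLinearPMap

/-- The Sobolev space `H¹(X)`: all weak first derivatives are in `L²`. -/
def H1 (X : Type) [NormedAddCommGroup X] [NormedSpace ℝ X] [MeasureSpace X] [BorelSpace X]
    [IsLocallyFiniteMeasure (volume : Measure X)] : Submodule ℂ (L2 X) :=
  ⨅ m : X, (weakDeriv m).domain

/-- The derivative `∂_m f ∈ L²` of a function `f ∈ H¹`. -/
def derivH1 (m : X) (f : H1 X) : L2 X :=
  weakDeriv m ⟨f, (Submodule.mem_iInf _).1 f.2 m⟩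

end Sobolev

/-- `‖∇u‖²` for `u ∈ H¹(ℝ^d)`. -/
def gradSq {d : ℕ} (u : H1 (Space d)) : ℝ :=
  ∑ a : Fin d, ‖derivH1 (EuclideanSpace.single a (1 : ℝ)) u‖ ^ 2

/-! ### Absolute value, square root and quadratic form of a self-adjoint operator -/

section Operators

variable {H : Type} [NormedAddCommGroup H] [InnerProductSpace ℂ H] [CompleteSpace H]

/-- The (graph of the) square `A ∘ A` of an unbounded operator, on its natural domain. -/
def sqGraph (A : H →ₗ.[ℂ] H) : Set (H × H) :=
  {p | ∃ z : H, (p.1, z) ∈ A.graph ∧ (z, p.2) ∈ A.graph}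

/-- `A` is self-adjoint and nonnegative. -/
def IsPositiveOp (A : H →ₗ.[ℂ] H) : Prop :=
  IsSelfAdjoint A ∧ ∀ x : A.domain, 0 ≤ (⟪(x : H), A x⟫_ℂ).re

open Classical in
/-- The absolute value `|A| = (A²)^{1/2}` of a self-adjoint operator: the (unique) nonnegative
self-adjoint operator whose square is `A²`. -/
def absOp (A : H →ₗ.[ℂ] H) : H →ₗ.[ℂ] H :=
  Classical.epsilon fun B => IsPositiveOp B ∧ sqGraph B = sqGraph A

open Classical in
/-- The square root `T^{1/2}` of a nonnegative self-adjoint operator: the (unique) nonnegative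
self-adjoint operator whose square is `T`. -/
def sqrtOp (T : H →ₗ.[ℂ] H) : H →ₗ.[ℂ] H :=
  Classical.epsilon fun S => IsPositiveOp S ∧ sqGraph S = (T.graph : Set (H × H))

/-- `|A|^{1/2}`; its domain is the form domain of the self-adjoint operator `A`. -/
def sqrtAbs (A : H →ₗ.[ℂ] H) : H →ₗ.[ℂ] H := sqrtOp (absOp A)

open Classical in
/-- The sign of a self-adjoint operator `A`: the (unique) bounded operator `U` with `A = U |A|` and
`U = 0` on the kernel of `A`. -/
def signOp (A : H →ₗ.[ℂ] H) : H →L[ℂ] H :=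
  Classical.epsilon fun U => (∀ x y : H, (x, y) ∈ (absOp A).graph → (x, U y) ∈ A.graph) ∧
    ∀ x : H, (x, (0 : H)) ∈ A.graph → U x = 0

/-- The sesquilinear form `⟨x, A y⟩ = ⟨|A|^{1/2} x, sgn(A) |A|^{1/2} y⟩` of a self-adjoint operator
`A`, on the form domain of `A`. -/
def opForm (A : H →ₗ.[ℂ] H) (x y : (sqrtAbs A).domain) : ℂ :=
  ⟪sqrtAbs A x, signOp A (sqrtAbs A y)⟫_ℂ

/-- A bounded operator as an (everywhere defined) unbounded operator. -/
def ofBounded (B : H →L[ℂ] H) : H →ₗ.[ℂ] H := (B : H →ₗ[ℂ] H).toPMap ⊤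

/-- The projector `|φ⟩⟨φ|` onto a normalized vector. -/
def proj (φ : H) : H →L[ℂ] H := InnerProductSpace.rankOne ℂ φ φ

end Operators

/-- The class of non-local potentials: self-adjoint operators `G` on `L²(ℝ^d)` whose form domain
`D(|G|^{1/2})` contains `H¹(ℝ^d)` and such that for all `ε > 0` there is `c ≥ 0` with
`|G| ≤ -ε Δ + c` in the sense of forms. -/
def nonlocalPotentials (d : ℕ) : Set (L2 (Space d) →ₗ.[ℂ] L2 (Space d)) :=
  {G | IsSelfAdjoint G ∧ ∃ hG : H1 (Space d) ≤ (sqrtAbs G).domain,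
    ∀ ε : ℝ, 0 < ε → ∃ c : ℝ, 0 ≤ c ∧ ∀ u : H1 (Space d),
      ‖sqrtAbs G ⟨u, hG u.2⟩‖ ^ 2 ≤ ε * gradSq u + c * ‖(u : L2 (Space d))‖ ^ 2}

/-- The class of pair interactions: real measurable functions `w` on `ℝ^d` with, for all `ε > 0`,
`|w| ≤ -ε Δ + c` for some `c ≥ 0`, in the sense of forms on `H¹(ℝ^d)`. -/
def interactions (d : ℕ) : Set (Space d → ℝ) :=
  {w | AEStronglyMeasurable w ∧ ∀ ε : ℝ, 0 < ε → ∃ c : ℝ, 0 ≤ c ∧ ∀ u : H1 (Space d),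
      Integrable (fun x => |w x| * ‖(u : L2 (Space d)) x‖ ^ 2) ∧
      ∫ x, |w x| * ‖(u : L2 (Space d)) x‖ ^ 2
        ≤ ε * gradSq u + c * ‖(u : L2 (Space d))‖ ^ 2}

/-! ### Many-body wavefunctions -/

theorem measurePreserving_perm {d N : ℕ} (σ : Equiv.Perm (Fin N)) :
    MeasurePreserving (fun x : Config d N => x ∘ σ) volume volume := by
  have h : (fun x : Config d N => x ∘ σ)
      = MeasurableEquiv.piCongrLeft (fun _ : Fin N => Space d) σ.symm := by
    funext x i
    have hi := Equiv.piCongrLeft_apply_apply (fun _ : Fin N => Space d) σ.symm x (σ i)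
    rw [Equiv.symm_apply_apply] at hi
    exact hi.symm
  rw [h]
  exact volume_measurePreserving_piCongrLeft (fun _ : Fin N => Space d) σ.symm

/-- The antisymmetric wavefunctions `L²_a(ℝ^{dN})`. -/
def antisym (d N : ℕ) : Submodule ℂ (L2 (Config d N)) where
  carrier := {ψ | ∀ σ : Equiv.Perm (Fin N),
    ∀ᵐ x : Config d N, ψ (x ∘ σ) = (Equiv.Perm.sign σ : ℤ) * ψ x}
  add_mem' := by
    intro ψ χ hψ hχ σ
    have hσ := measurePreserving_perm (d := d) σ
    filter_upwards [hψ σ, hχ σ, Lp.coeFn_add ψ χ,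
      hσ.quasiMeasurePreserving.ae (Lp.coeFn_add ψ χ)] with x h1 h2 h3 h4
    rw [h3, h4, Pi.add_apply, Pi.add_apply, h1, h2, mul_add]
  zero_mem' := by
    intro σ
    have hσ := measurePreserving_perm (d := d) σ
    filter_upwards [Lp.coeFn_zero ℂ 2 (volume : Measure (Config d N)),
      hσ.quasiMeasurePreserving.ae (Lp.coeFn_zero ℂ 2 (volume : Measure (Config d N)))]
      with x h1 h2
    rw [h1, h2]
    simp
  smul_mem' := by
    intro c ψ hψ σ
    have hσ := measurePreserving_perm (d := d) σ
    filter_upwards [hψ σ, Lp.coeFn_smul c ψ,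
      hσ.quasiMeasurePreserving.ae (Lp.coeFn_smul c ψ)] with x h1 h2 h3
    rw [h2, h3, Pi.smul_apply, Pi.smul_apply, h1, smul_eq_mul, smul_eq_mul]
    ring

theorem memLp_tensor {d n : ℕ} (i : Fin (n + 1)) (u : L2 (Space d)) (v : L2 (Config d n)) :
    MemLp (fun x : Config d (n + 1) => u (x i) * v (i.removeNth x)) 2 volume := by
  have h : MemLp (fun p : Space d × Config d n => u p.1 * v p.2) 2
      ((volume : Measure (Space d)).prod (volume : Measure (Config d n))) := by
    have hm : AEStronglyMeasurable (fun p : Space d × Config d n => u p.1 * v p.2)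
        ((volume : Measure (Space d)).prod (volume : Measure (Config d n))) :=
      (Lp.aestronglyMeasurable u).comp_fst.mul (Lp.aestronglyMeasurable v).comp_snd
    rw [memLp_two_iff_integrable_sq_norm hm]
    have hu := (memLp_two_iff_integrable_sq_norm (Lp.aestronglyMeasurable u)).1 (Lp.memLp u)
    have hv := (memLp_two_iff_integrable_sq_norm (Lp.aestronglyMeasurable v)).1 (Lp.memLp v)
    refine (hu.mul_prod hv).congr (Filter.Eventually.of_forall fun p => ?_)
    simp [mul_pow]
  exact h.comp_measurePreserving (volume_preserving_piFinSuccAbove (fun _ => Space d) i)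

/-- `u ⊗_i v`, the function `x ↦ u(x_i) v(x_1, …, x_{i-1}, x_{i+1}, …)`. -/
def tensorAt {d n : ℕ} (i : Fin (n + 1)) (u : L2 (Space d)) (v : L2 (Config d n)) :
    L2 (Config d (n + 1)) :=
  (memLp_tensor i u v).toLp _

/-- The wedge product `φ ∧ χ` of a one-body function and an `n`-body antisymmetric function:
`(φ ∧ χ)(x) = (n+1)^{-1/2} ∑_i (-1)^i φ(x_i) χ(x_0, …, x_{i-1}, x_{i+1}, …, x_n)`. -/
def wedge {d n : ℕ} (φ : L2 (Space d)) (χ : L2 (Config d n)) : L2 (Config d (n + 1)) :=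
  ((√(n + 1 : ℝ) : ℂ))⁻¹ • ∑ i : Fin (n + 1), (-1 : ℂ) ^ (i : ℕ) • tensorAt i φ χ

/-- The one-body operator `A_i = 1 ⊗ ⋯ ⊗ A ⊗ ⋯ ⊗ 1` acting on the `i`-th body, for a self-adjoint
`A`: the adjoint (equivalently the closure) of `u ⊗_i v ↦ (A u) ⊗_i v`, `u ∈ D(A)`. -/
def liftAt {d n : ℕ} (i : Fin (n + 1)) (A : L2 (Space d) →ₗ.[ℂ] L2 (Space d)) :
    L2 (Config d (n + 1)) →ₗ.[ℂ] L2 (Config d (n + 1)) :=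
  Submodule.toLinearPMap
    { carrier := {p | ∀ (u : A.domain) (v : L2 (Config d n)),
        ⟪tensorAt i (A u) v, p.1⟫_ℂ = ⟪tensorAt i u v, p.2⟫_ℂ}
      add_mem' := by
        intro p q hp hq u v
        simp only [Prod.fst_add, Prod.snd_add, inner_add_right, hp u v, hq u v]
      zero_mem' := by
        intro u v
        simp
      smul_mem' := by
        intro c p hp u v
        simp only [Prod.smul_fst, Prod.smul_snd, inner_smul_right, hp u v] }

/-! ### The Hamiltonian -/

section Hamiltonian

variable {d n : ℕ}

/-- The unit vector of the configuration space along the coordinate `a` of the body `i`. -/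
def dir (i : Fin (n + 1)) (a : Fin d) : Config d (n + 1) :=
  Pi.single i (EuclideanSpace.single a (1 : ℝ))

/-- The form domain of the multiplication operator by `w(x_i - x_j)`. -/
def pairDomain (w : Space d → ℝ) (i j : Fin (n + 1)) : Submodule ℂ (L2 (Config d (n + 1))) where
  carrier := {ψ | MemLp (fun x : Config d (n + 1) => (√|w (x i - x j)| : ℂ) * ψ x) 2 volume}
  add_mem' := by
    intro ψ χ hψ hχ
    refine (hψ.add hχ).ae_eq ?_
    filter_upwards [Lp.coeFn_add ψ χ] with x hx
    simp only [hx, Pi.add_apply, mul_add]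
  zero_mem' := by
    refine (MemLp.zero (ε := ℂ)).ae_eq ?_
    filter_upwards [Lp.coeFn_zero ℂ 2 (volume : Measure (Config d (n + 1)))] with x hx
    rw [hx, Pi.zero_apply, mul_zero]
  smul_mem' := by
    intro c ψ hψ
    refine (hψ.const_mul c).ae_eq ?_
    filter_upwards [Lp.coeFn_smul c ψ] with x hx
    simp only [hx, Pi.smul_apply, smul_eq_mul]
    ring

/-- The form domain, in `L²_a(ℝ^{dN})` with `N = n + 1`, of the Hamiltonian
`∑ -Δ_i + ∑ G_i + ∑_{i<j} w(x_i - x_j)`: the intersection of the form domains of its terms. (When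
`G` is in the class of non-local potentials and `w` in the class of interactions, this is the space
of antisymmetric functions in `H¹(ℝ^{dN})`.) -/
def formDomain (w : Space d → ℝ) (G : L2 (Space d) →ₗ.[ℂ] L2 (Space d)) :
    Submodule ℂ (L2 (Config d (n + 1))) :=
  antisym d (n + 1) ⊓ H1 (Config d (n + 1)) ⊓ (⨅ i, (sqrtAbs (liftAt i G)).domain) ⊓
    ⨅ i, ⨅ j, ⨅ _ : i < j, pairDomain w i j

/-- The sesquilinear form `⟨χ, H^N(G) ψ⟩` of the Hamiltonian
`H^N(G) = ∑ -Δ_i + ∑ G_i + ∑_{i<j} w(x_i - x_j)`, with `N = n + 1`. -/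
def hamForm (w : Space d → ℝ) (G : L2 (Space d) →ₗ.[ℂ] L2 (Space d))
    (χ ψ : formDomain (n := n) w G) : ℂ :=
  (∑ i : Fin (n + 1), ∑ a : Fin d,
    ⟪derivH1 (dir i a) ⟨χ, χ.2.1.1.2⟩, derivH1 (dir i a) ⟨ψ, ψ.2.1.1.2⟩⟫_ℂ)
  + (∑ i : Fin (n + 1), opForm (liftAt i G)
      ⟨χ, (Submodule.mem_iInf _).1 χ.2.1.2 i⟩ ⟨ψ, (Submodule.mem_iInf _).1 ψ.2.1.2 i⟩)
  + ∑ i : Fin (n + 1), ∑ j ∈ Finset.Ioi i, ∫ x : Config d (n + 1),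
      (w (x i - x j) : ℂ) * (conj ((χ : L2 (Config d (n + 1))) x)
        * (ψ : L2 (Config d (n + 1))) x)

/-- The graph of the self-adjoint operator `H^N(G)` on `L²_a(ℝ^{dN})` associated with the form:
`ψ ∈ D(H^N(G))` and `H^N(G) ψ = η` iff `ψ` is in the form domain and `⟨χ, H^N(G) ψ⟩ = ⟨χ, η⟩`
for all `χ` in the form domain. -/
def hamGraph (w : Space d → ℝ) (G : L2 (Space d) →ₗ.[ℂ] L2 (Space d)) :
    Set (antisym d (n + 1) × antisym d (n + 1)) :=
  {p | ∃ h : (p.1 : L2 (Config d (n + 1))) ∈ formDomain (n := n) w G,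
    ∀ χ : formDomain (n := n) w G,
      hamForm w G χ ⟨p.1, h⟩ = ⟪(χ : L2 (Config d (n + 1))), (p.2 : L2 (Config d (n + 1)))⟫_ℂ}

/-- The spectrum of `H^N(G)` on `L²_a(ℝ^{dN})`: the complement of the set of `z` for which
`H^N(G) - z` is a bijection from the domain onto `L²_a(ℝ^{dN})` with bounded inverse `R`. -/
def hamSpectrum (n : ℕ) (w : Space d → ℝ) (G : L2 (Space d) →ₗ.[ℂ] L2 (Space d)) : Set ℂ :=
  {z | ¬ ∃ R : antisym d (n + 1) →L[ℂ] antisym d (n + 1),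
    ∀ ψ η : antisym d (n + 1), (ψ, η + z • ψ) ∈ hamGraph w G ↔ R η = ψ}

/-- The ground state energy: the infimum of `⟨ψ, H^N(G) ψ⟩` over normalized `ψ` in the form
domain. -/
def groundEnergy (n : ℕ) (w : Space d → ℝ) (G : L2 (Space d) →ₗ.[ℂ] L2 (Space d)) : ℝ :=
  sInf {e | ∃ ψ : formDomain (n := n) w G,
    ‖(ψ : L2 (Config d (n + 1)))‖ = 1 ∧ e = (hamForm w G ψ ψ).re}

/-- `ψ` is a ground state of `H^N(G)`: a normalized minimizer of the energy. -/
def IsGroundState (w : Space d → ℝ) (G : L2 (Space d) →ₗ.[ℂ] L2 (Space d))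
    (ψ : L2 (Config d (n + 1))) : Prop :=
  ∃ h : ψ ∈ formDomain (n := n) w G, ‖ψ‖ = 1 ∧
    ∀ χ : formDomain (n := n) w G, ‖(χ : L2 (Config d (n + 1)))‖ = 1 →
      (hamForm w G ⟨ψ, h⟩ ⟨ψ, h⟩).re ≤ (hamForm w G χ χ).re

/-- `ψ` is the unique ground state of `H^N(G)`, up to a phase. -/
def IsUniqueGroundState (w : Space d → ℝ) (G : L2 (Space d) →ₗ.[ℂ] L2 (Space d))
    (ψ : L2 (Config d (n + 1))) : Prop :=
  IsGroundState w G ψ ∧ ∀ χ, IsGroundState w G χ → ∃ c : ℂ, χ = c • ψ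

/-- The ground state energy is isolated from the rest of the spectrum of `H^N(G)`. -/
def GroundEnergyIsolated (n : ℕ) (w : Space d → ℝ)
    (G : L2 (Space d) →ₗ.[ℂ] L2 (Space d)) : Prop :=
  ∃ δ : ℝ, 0 < δ ∧ ∀ z ∈ hamSpectrum n w G,
    z ≠ (groundEnergy n w G : ℂ) → δ ≤ ‖z - (groundEnergy n w G : ℂ)‖

/-- `ψ` is a Slater determinant: `ψ(x) = (N!)^{-1/2} det (φ_i(x_j))` with orthonormal `φ_i`. -/
def IsSlater (ψ : L2 (Config d (n + 1))) : Prop :=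
  ∃ φ : Fin (n + 1) → L2 (Space d), Orthonormal ℂ φ ∧
    ψ =ᵐ[volume] fun x => ((√((n + 1).factorial : ℝ) : ℂ))⁻¹ *
      (Matrix.of fun i j => φ i (x j)).det

/-- The kernel of the one-particle reduced density matrix,
`γ_ψ(x, y) = N ∫ ψ(x, z) conj (ψ(y, z)) dz` with `z ∈ ℝ^{d(N-1)}` and `N = n + 1`. -/
def rdm (ψ : L2 (Config d (n + 1))) (p : Space d × Space d) : ℂ :=
  (n + 1 : ℂ) * ∫ z : Config d n,
    ψ (Fin.cons p.1 z : Config d (n + 1)) * conj (ψ (Fin.cons p.2 z : Config d (n + 1)))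

/-- Condition `(φ ∧ L²_a(ℝ^{d(N-1)})) ⟂ ψ`. -/
def WedgeOrthogonal (φ : L2 (Space d)) (ψ : L2 (Config d (n + 1))) : Prop :=
  ∀ χ ∈ antisym d n, ⟪wedge φ χ, ψ⟫_ℂ = 0

end Hamiltonian

end MatrixDFT

end

open MatrixDFT

/-!
The theorem rests on three facts.

*Adding a projector that annihilates the ground state.* If `φ` is wedge orthogonal to `ψ₁`, then
`ψ₁` is annihilated by `φ` in every variable, so the form of `H^N(G₁ + ε|φ⟩⟨φ|)` agrees with that
of `H^N(G₁)` on `ψ₁`, and is nowhere smaller. Hence `ψ₁` stays the unique ground state, with the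
same energy (`groundEnergy_add_proj`, `IsUniqueGroundState.add_proj`). That the form domain does
not change, and that the form of `G₁ + B` is the form of `G₁` plus that of a bounded `B`, needs the
Heinz inequality (`exists_sqrtAbs_bound`, `opForm_add_ofBounded`), because forms are defined
through `|G|^{1/2}` and the sign of `G`. The functional calculus of an unbounded self-adjoint `A`
is reduced to that of the bounded operators `(1 + A²)⁻¹` and `A (1 + A²)⁻¹`, which determine `A`.

*Noninteracting nondegenerate ground states are Slater determinants.* The one-particle density
matrix of a ground state `ψ` is compact and has an eigenbasis `u`, the natural orbitals. In this
basis the one-body form is diagonal on `ψ` (`hasSum_bodyForm_natural`), so that the energy of `ψ`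
is the average of `∑ i, e (u (α i))` over configurations `α`, with weights `|⟨u_α, ψ⟩|²`
(`hasSum_hamForm_natural`). Some `α` of positive weight has an energy not above the average; it is
injective by antisymmetry, and its Slater determinant is a ground state
(`exists_slater_groundState`). By uniqueness it is `ψ` up to a phase. No compactness of the
resolvent or spectral theorem for `-Δ + G` is needed. An `H¹` function orthogonal to the orbitals
is wedge orthogonal to `ψ`.

*An explicit nondegenerate and isolated ground state.* Let `Π` be the projector onto the span of
`N` normalized test functions `θ_j` with disjoint supports, and `T = -Δ`. With the bounded finite
rank potential `-(ΠT + TΠ) + ΠTΠ - Π`, the one-body operator is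
`(1 - Π) T (1 - Π) - Π` (disjointness of the supports makes `ΠTΠ` diagonal). It is bounded
below by `-Π`, so the many-body energy is at least minus the expected number of particles in the
shell. This number is at most `N - 1` on functions orthogonal to the Slater determinant of the shell
(`sum_annih_le`), which is therefore the unique ground state, of energy `-N`, with a gap of size `1`.
The resolvent in the gap is given by the Lax–Milgram theorem on the orthogonal complement of the
ground state, in the graph norm of the gradient (`IsShell.exists_resolvent`).
-/

open MeasureTheory
open scoped ContDiff ComplexConjugate InnerProductSpace

noncomputable section

namespace MatrixDFT

set_option linter.unusedSectionVars false

/-! ### Resolvent pair of a self-adjoint operator -/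

section Toolkit

open Filter Topology

variable {H : Type} [NormedAddCommGroup H] [InnerProductSpace ℂ H] [CompleteSpace H]

theorem adjoint_graph_mem_iff {A : H →ₗ.[ℂ] H} (hd : Dense (A.domain : Set H)) (y z : H) :
    (y, z) ∈ A.adjoint.graph ↔ ∀ x x', (x, x') ∈ A.graph → ⟪x', y⟫_ℂ = ⟪x, z⟫_ℂ := by
  rw [LinearPMap.adjoint_graph_eq_graph_adjoint hd, Submodule.mem_adjoint_iff]
  simp only [sub_eq_zero]

/-- A self-adjoint operator contains every pair that is compatible with its graph. -/
theorem graph_mem_iff {A : H →ₗ.[ℂ] H} (hA : IsSelfAdjoint A) (y z : H) :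
    (y, z) ∈ A.graph ↔ ∀ x x', (x, x') ∈ A.graph → ⟪x', y⟫_ℂ = ⟪x, z⟫_ℂ := by
  conv_lhs => rw [← LinearPMap.isSelfAdjoint_def.1 hA]
  exact adjoint_graph_mem_iff hA.dense_domain y z

theorem isSelfAdjoint_of_graph_mem_iff {A : H →ₗ.[ℂ] H} (hd : Dense (A.domain : Set H))
    (h : ∀ y z, (y, z) ∈ A.graph ↔ ∀ x x', (x, x') ∈ A.graph → ⟪x', y⟫_ℂ = ⟪x, z⟫_ℂ) :
    IsSelfAdjoint A := by
  rw [LinearPMap.isSelfAdjoint_def]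
  refine LinearPMap.eq_of_eq_graph (Submodule.ext fun p => ?_)
  obtain ⟨y, z⟩ := p
  rw [h, adjoint_graph_mem_iff hd]

theorem graph_symm {A : H →ₗ.[ℂ] H} (hA : IsSelfAdjoint A) {x x' y y' : H}
    (hx : (x, x') ∈ A.graph) (hy : (y, y') ∈ A.graph) : ⟪x', y⟫_ℂ = ⟪x, y'⟫_ℂ :=
  (graph_mem_iff hA y y').1 hy x x' hx

theorem graph_add {A : H →ₗ.[ℂ] H} {x x' y y' : H}
    (hx : (x, x') ∈ A.graph) (hy : (y, y') ∈ A.graph) : (x + y, x' + y') ∈ A.graph :=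
  A.graph.add_mem hx hy

theorem graph_sub {A : H →ₗ.[ℂ] H} {x x' y y' : H}
    (hx : (x, x') ∈ A.graph) (hy : (y, y') ∈ A.graph) : (x - y, x' - y') ∈ A.graph :=
  A.graph.sub_mem hx hy

theorem graph_smul {A : H →ₗ.[ℂ] H} {x x' : H} (c : ℂ)
    (hx : (x, x') ∈ A.graph) : (c • x, c • x') ∈ A.graph :=
  A.graph.smul_mem c hx

theorem graph_unique {A : H →ₗ.[ℂ] H} {x y y' : H}
    (hx : (x, y) ∈ A.graph) (hy : (x, y') ∈ A.graph) : y = y' :=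
  LinearPMap.mem_graph_snd_inj _ hx hy rfl

theorem isClosed_graph {A : H →ₗ.[ℂ] H} (hA : IsSelfAdjoint A) :
    IsClosed (A.graph : Set (H × H)) := hA.isClosed

theorem graph_of_tendsto {A : H →ₗ.[ℂ] H} (hA : IsSelfAdjoint A) {u v : ℕ → H} {x y : H}
    (h : ∀ k, (u k, v k) ∈ A.graph) (hu : Tendsto u atTop (𝓝 x)) (hv : Tendsto v atTop (𝓝 y)) :
    (x, y) ∈ A.graph :=
  (isClosed_graph hA).mem_of_tendsto (hu.prodMk_nhds hv) (Eventually.of_forall h)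

/-- The closure of the graph of `A`, as a subspace of the Hilbert space `H ⊕ H`. -/
def graphL2 (A : H →ₗ.[ℂ] H) : Submodule ℂ (WithLp 2 (H × H)) :=
  (A.graph.comap (WithLp.linearEquiv 2 ℂ (H × H)).toLinearMap).topologicalClosure

instance (A : H →ₗ.[ℂ] H) : CompleteSpace (graphL2 A) :=
  Submodule.topologicalClosure.completeSpace _

theorem mem_graphL2 {A : H →ₗ.[ℂ] H} (hA : IsSelfAdjoint A) (p : WithLp 2 (H × H)) :
    p ∈ graphL2 A ↔ (p.fst, p.snd) ∈ A.graph := by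
  have hc : IsClosed ((A.graph.comap (WithLp.linearEquiv 2 ℂ (H × H)).toLinearMap :
      Submodule ℂ (WithLp 2 (H × H))) : Set (WithLp 2 (H × H))) :=
    (isClosed_graph hA).preimage (WithLp.prod_continuous_ofLp 2 H H)
  rw [graphL2, IsClosed.submodule_topologicalClosure_eq hc]
  rfl

/-- The isometric embedding `η ↦ (η, 0)`. -/
def inlL2 : H →L[ℂ] WithLp 2 (H × H) :=
  (WithLp.prodContinuousLinearEquiv 2 ℂ H H).symm.toContinuousLinearMap ∘L
    ContinuousLinearMap.inl ℂ H H

/-- `(1 + A²)⁻¹` for a self-adjoint `A`: the first component of the orthogonal projection of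
`(η, 0)` onto the graph of `A`. -/
def resK (A : H →ₗ.[ℂ] H) : H →L[ℂ] H :=
  WithLp.fstL 2 ℂ H H ∘L (graphL2 A).starProjection ∘L inlL2

/-- `A (1 + A²)⁻¹` for a self-adjoint `A`: the second component of the orthogonal projection of
`(η, 0)` onto the graph of `A`. -/
def resM (A : H →ₗ.[ℂ] H) : H →L[ℂ] H :=
  WithLp.sndL 2 ℂ H H ∘L (graphL2 A).starProjection ∘L inlL2

theorem resK_resM_mem {A : H →ₗ.[ℂ] H} (hA : IsSelfAdjoint A) (η : H) :
    (resK A η, resM A η) ∈ A.graph :=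
  (mem_graphL2 hA _).1 ((graphL2 A).starProjection_apply_mem (inlL2 η))

theorem resM_sub_resK_mem {A : H →ₗ.[ℂ] H} (hA : IsSelfAdjoint A) (η : H) :
    (resM A η, η - resK A η) ∈ A.graph := by
  rw [graph_mem_iff hA]
  intro x x' hx
  have h := (graphL2 A).starProjection_inner_eq_zero (inlL2 η) (WithLp.toLp 2 (x, x'))
    ((mem_graphL2 hA _).2 hx)
  rw [← inner_conj_symm, map_eq_zero, WithLp.prod_inner_apply] at h
  have h1 : ⟪x, η - resK A η⟫_ℂ + ⟪x', 0 - resM A η⟫_ℂ = 0 := h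
  rw [zero_sub, inner_neg_right] at h1
  linear_combination -h1

/-- The pair `((1 + A²)⁻¹ η, A (1 + A²)⁻¹ η)` is the only one that solves `a + A b = η`, `b = A a`. -/
theorem res_unique {A : H →ₗ.[ℂ] H} (hA : IsSelfAdjoint A) {η a b : H}
    (h1 : (a, b) ∈ A.graph) (h2 : (b, η - a) ∈ A.graph) : resK A η = a ∧ resM A η = b := by
  have h3 := graph_sub (resK_resM_mem hA η) h1
  have h4 := graph_sub (resM_sub_resK_mem hA η) h2
  have h5 := graph_symm hA h4 h4
  have h6 := graph_symm hA h3 h4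
  have e : η - resK A η - (η - a) = -(resK A η - a) := by abel
  rw [e] at h4 h6
  rw [inner_neg_right] at h6
  have h7 : ‖resM A η - b‖ ^ 2 + ‖resK A η - a‖ ^ 2 = 0 := by
    have := congrArg Complex.re h6
    rw [Complex.neg_re] at this
    have e1 := inner_self_eq_norm_sq (𝕜 := ℂ) (resM A η - b)
    have e2 := inner_self_eq_norm_sq (𝕜 := ℂ) (resK A η - a)
    simp only [RCLike.re_to_complex] at e1 e2
    linarith
  have h8 : ‖resM A η - b‖ ^ 2 = 0 := by nlinarith [sq_nonneg ‖resM A η - b‖, sq_nonneg ‖resK A η - a‖]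
  have h9 : ‖resK A η - a‖ ^ 2 = 0 := by nlinarith [sq_nonneg ‖resM A η - b‖, sq_nonneg ‖resK A η - a‖]
  exact ⟨sub_eq_zero.1 (by simpa using h9), sub_eq_zero.1 (by simpa using h8)⟩

theorem res_graph {A : H →ₗ.[ℂ] H} (hA : IsSelfAdjoint A) {x y : H} (h : (x, y) ∈ A.graph) :
    resK A y = resM A x ∧ resM A y = x - resK A x := by
  refine res_unique hA (resM_sub_resK_mem hA x) ?_
  exact graph_sub h (resK_resM_mem hA x)

theorem inner_resK_left {A : H →ₗ.[ℂ] H} (hA : IsSelfAdjoint A) (η ζ : H) :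
    ⟪resK A η, ζ⟫_ℂ = ⟪resK A η, resK A ζ⟫_ℂ + ⟪resM A η, resM A ζ⟫_ℂ := by
  rw [graph_symm hA (resK_resM_mem hA η) (resM_sub_resK_mem hA ζ), ← inner_add_right]
  simp

theorem isSelfAdjoint_resK {A : H →ₗ.[ℂ] H} (hA : IsSelfAdjoint A) : IsSelfAdjoint (resK A) := by
  rw [ContinuousLinearMap.isSelfAdjoint_iff_isSymmetric]
  intro η ζ
  change ⟪resK A η, ζ⟫_ℂ = ⟪η, resK A ζ⟫_ℂ
  rw [← inner_conj_symm η (resK A ζ), inner_resK_left hA η ζ, inner_resK_left hA ζ η, map_add,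
    inner_conj_symm, inner_conj_symm]

theorem isSelfAdjoint_resM {A : H →ₗ.[ℂ] H} (hA : IsSelfAdjoint A) : IsSelfAdjoint (resM A) := by
  rw [ContinuousLinearMap.isSelfAdjoint_iff_isSymmetric]
  intro η ζ
  change ⟪resM A η, ζ⟫_ℂ = ⟪η, resM A ζ⟫_ℂ
  have h1 := graph_symm hA (resK_resM_mem hA η) (resK_resM_mem hA ζ)
  have h2 := graph_symm hA (resM_sub_resK_mem hA η) (resM_sub_resK_mem hA ζ)
  rw [inner_sub_left, inner_sub_right] at h2
  linear_combination h1 - h2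

theorem resK_comp_resM {A : H →ₗ.[ℂ] H} (hA : IsSelfAdjoint A) :
    resK A * resM A = resM A * resK A :=
  ContinuousLinearMap.ext fun η => (res_graph hA (resK_resM_mem hA η)).1

theorem resM_comp_resM {A : H →ₗ.[ℂ] H} (hA : IsSelfAdjoint A) :
    resM A * resM A = resK A - resK A * resK A :=
  ContinuousLinearMap.ext fun η => (res_graph hA (resK_resM_mem hA η)).2

theorem re_inner_resK_self {A : H →ₗ.[ℂ] H} (hA : IsSelfAdjoint A) (η : H) :
    (⟪resK A η, η⟫_ℂ).re = ‖resK A η‖ ^ 2 + ‖resM A η‖ ^ 2 := by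
  rw [inner_resK_left hA, Complex.add_re]
  have e1 := inner_self_eq_norm_sq (𝕜 := ℂ) (resM A η)
  have e2 := inner_self_eq_norm_sq (𝕜 := ℂ) (resK A η)
  simp only [RCLike.re_to_complex] at e1 e2
  rw [e1, e2]

theorem nonneg_of_re_inner {L : H →L[ℂ] H} (h1 : IsSelfAdjoint L)
    (h2 : ∀ x, 0 ≤ (⟪L x, x⟫_ℂ).re) : 0 ≤ L := by
  rw [ContinuousLinearMap.nonneg_iff_isPositive, ContinuousLinearMap.isPositive_def']
  exact ⟨h1, h2⟩

theorem re_inner_nonneg {L : H →L[ℂ] H} (h : 0 ≤ L) (x : H) : 0 ≤ (⟪L x, x⟫_ℂ).re :=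
  ((ContinuousLinearMap.nonneg_iff_isPositive L).1 h).re_inner_nonneg_left x

theorem resK_nonneg {A : H →ₗ.[ℂ] H} (hA : IsSelfAdjoint A) : 0 ≤ resK A := by
  refine nonneg_of_re_inner (isSelfAdjoint_resK hA) fun η => ?_
  rw [re_inner_resK_self hA]
  positivity

theorem resK_le_one {A : H →ₗ.[ℂ] H} (hA : IsSelfAdjoint A) : resK A ≤ 1 := by
  rw [← sub_nonneg]
  refine nonneg_of_re_inner ((IsSelfAdjoint.one _).sub (isSelfAdjoint_resK hA)) fun η => ?_
  have h1 := re_inner_resK_self hA η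
  have e1 := norm_sub_sq (𝕜 := ℂ) (resK A η) η
  have e2 := inner_self_eq_norm_sq (𝕜 := ℂ) η
  simp only [RCLike.re_to_complex] at e1 e2
  change 0 ≤ (⟪η - resK A η, η⟫_ℂ).re
  rw [inner_sub_left, Complex.sub_re, e2]
  nlinarith [sq_nonneg ‖resK A η - η‖, sq_nonneg ‖resM A η‖]

theorem resK_injective {A : H →ₗ.[ℂ] H} (hA : IsSelfAdjoint A) :
    Function.Injective (resK A) := by
  rw [injective_iff_map_eq_zero]
  intro η h
  have h1 := resK_resM_mem hA η
  have h2 := resM_sub_resK_mem hA η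
  rw [h] at h1
  have h3 := LinearPMap.graph_fst_eq_zero_snd _ h1 rfl
  rw [h3] at h2
  have h4 := LinearPMap.graph_fst_eq_zero_snd _ h2 rfl
  rwa [h, sub_zero] at h4

/-- The range of `(1 + A²)⁻¹` is a core of `A`. -/
theorem exists_seq_resK {A : H →ₗ.[ℂ] H} (hA : IsSelfAdjoint A) {x y : H}
    (h : (x, y) ∈ A.graph) : ∃ u : ℕ → H,
      Tendsto (fun k => resK A (u k)) atTop (𝓝 x) ∧
      Tendsto (fun k => resM A (u k)) atTop (𝓝 y) := by
  set R : Submodule ℂ (WithLp 2 (H × H)) :=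
    LinearMap.range ((WithLp.linearEquiv 2 ℂ (H × H)).symm.toLinearMap ∘ₗ
      ((resK A).toLinearMap.prod (resM A).toLinearMap)) with hR
  have hRmem : ∀ η, WithLp.toLp 2 (resK A η, resM A η) ∈ R := fun η => ⟨η, rfl⟩
  have hle : R.topologicalClosure ≤ graphL2 A := by
    refine Submodule.topologicalClosure_minimal _ ?_ (Submodule.isClosed_topologicalClosure _)
    rintro _ ⟨η, rfl⟩
    exact (mem_graphL2 hA _).2 (resK_resM_mem hA η)
  have : CompleteSpace R.topologicalClosure := Submodule.topologicalClosure.completeSpace _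
  have hp : WithLp.toLp 2 (x, y) ∈ R.topologicalClosure := by
    set p : WithLp 2 (H × H) := WithLp.toLp 2 (x, y) with hp
    set r := R.topologicalClosure.starProjection p with hr
    have hs : p - r ∈ graphL2 A := (graphL2 A).sub_mem ((mem_graphL2 hA _).2 h)
      (hle (Submodule.starProjection_apply_mem _ _))
    have hz : (p - r).fst = 0 := by
      refine ext_inner_right ℂ fun η => ?_
      have h1 := R.topologicalClosure.starProjection_inner_eq_zero p
        _ (R.le_topologicalClosure (hRmem η))
      rw [WithLp.prod_inner_apply] at h1
      have h2 := graph_symm hA ((mem_graphL2 hA _).1 hs) (resM_sub_resK_mem hA η)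
      have h1' : ⟪(p - r).fst, resK A η⟫_ℂ + ⟪(p - r).snd, resM A η⟫_ℂ = 0 := h1
      rw [h2, ← inner_add_right] at h1'
      rw [inner_zero_left, ← h1']
      congr 1
      abel
    have hz2 := LinearPMap.graph_fst_eq_zero_snd _ ((mem_graphL2 hA _).1 hs) hz
    have hpr : p - r = 0 := by
      apply (WithLp.equiv 2 (H × H)).injective
      exact Prod.ext hz hz2
    rw [sub_eq_zero.1 hpr]
    exact Submodule.starProjection_apply_mem _ _
  have hcl : WithLp.toLp 2 (x, y) ∈ closure (R : Set (WithLp 2 (H × H))) := hp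
  obtain ⟨v, hv, hlim⟩ := mem_closure_iff_seq_limit.1 hcl
  choose u hu using hv
  refine ⟨u, ?_, ?_⟩
  · have := ((WithLp.fstL 2 ℂ H H).continuous.tendsto _).comp hlim
    refine this.congr fun k => ?_
    simp only [Function.comp, ← hu k]
    rfl
  · have := ((WithLp.sndL 2 ℂ H H).continuous.tendsto _).comp hlim
    refine this.congr fun k => ?_
    simp only [Function.comp, ← hu k]
    rfl

/-- The pair `((1 + A²)⁻¹, A (1 + A²)⁻¹)` of bounded operators determines `A`. -/
theorem eq_of_resK_resM {A B : H →ₗ.[ℂ] H} (hA : IsSelfAdjoint A) (hB : IsSelfAdjoint B)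
    (hK : resK A = resK B) (hM : resM A = resM B) : A = B := by
  have key : ∀ {A B : H →ₗ.[ℂ] H}, IsSelfAdjoint A → IsSelfAdjoint B → resK A = resK B →
      resM A = resM B → A.graph ≤ B.graph := by
    intro A B hA hB hK hM p hp
    obtain ⟨u, h1, h2⟩ := exists_seq_resK hA (x := p.1) (y := p.2) hp
    rw [hK] at h1
    rw [hM] at h2
    exact graph_of_tendsto hB (fun k => resK_resM_mem hB (u k)) h1 h2
  exact LinearPMap.eq_of_eq_graph (le_antisymm (key hA hB hK hM) (key hB hA hK.symm hM.symm))

theorem mem_sqGraph_iff {A : H →ₗ.[ℂ] H} (hA : IsSelfAdjoint A) (p : H × H) :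
    p ∈ sqGraph A ↔ resK A (p.1 + p.2) = p.1 := by
  constructor
  · rintro ⟨z, h1, h2⟩
    exact (res_unique hA h1 (by simpa using h2)).1
  · intro h
    refine ⟨resM A (p.1 + p.2), ?_, ?_⟩
    · have := resK_resM_mem hA (p.1 + p.2)
      rwa [h] at this
    · have := resM_sub_resK_mem hA (p.1 + p.2)
      rwa [h, add_sub_cancel_left] at this

theorem resK_eq_iff_sqGraph_eq {A B : H →ₗ.[ℂ] H} (hA : IsSelfAdjoint A) (hB : IsSelfAdjoint B) :
    sqGraph A = sqGraph B ↔ resK A = resK B := by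
  constructor
  · intro h
    ext η
    have h1 : (resK A η, η - resK A η) ∈ sqGraph A := by
      rw [mem_sqGraph_iff hA]; simp
    rw [h, mem_sqGraph_iff hB] at h1
    simpa using h1.symm
  · intro h
    ext p
    rw [mem_sqGraph_iff hA, mem_sqGraph_iff hB, h]

theorem IsPositiveOp.nonneg {A : H →ₗ.[ℂ] H} (hA : IsPositiveOp A) {x y : H}
    (h : (x, y) ∈ A.graph) : 0 ≤ (⟪x, y⟫_ℂ).re := by
  obtain ⟨z, h1, h2⟩ := (LinearPMap.mem_graph_iff _).1 h
  simp only at h1 h2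
  rw [← h1, ← h2]
  exact hA.2 z

theorem isPositiveOp_of_graph {A : H →ₗ.[ℂ] H} (hA : IsSelfAdjoint A)
    (h : ∀ x y, (x, y) ∈ A.graph → 0 ≤ (⟪x, y⟫_ℂ).re) : IsPositiveOp A :=
  ⟨hA, fun x => h _ _ (A.mem_graph x)⟩

theorem resM_nonneg {A : H →ₗ.[ℂ] H} (hA : IsPositiveOp A) : 0 ≤ resM A := by
  refine nonneg_of_re_inner (isSelfAdjoint_resM hA.1) fun η => ?_
  have h1 := hA.nonneg (resK_resM_mem hA.1 η)
  have h2 := hA.nonneg (resM_sub_resK_mem hA.1 η)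
  have e : ⟪resM A η, η⟫_ℂ = ⟪resM A η, resK A η⟫_ℂ + ⟪resM A η, η - resK A η⟫_ℂ := by
    rw [← inner_add_right]; simp
  rw [e, Complex.add_re]
  have h3 : (⟪resM A η, resK A η⟫_ℂ).re = (⟪resK A η, resM A η⟫_ℂ).re := by
    rw [← inner_conj_symm, Complex.conj_re]
  linarith

/-- For `A ≥ 0`, `A (1 + A²)⁻¹` is the square root of `K - K²` with `K = (1 + A²)⁻¹`. Thus `K` alone
determines `A`. -/
theorem resM_eq_sqrt {A : H →ₗ.[ℂ] H} (hA : IsPositiveOp A) :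
    resM A = CFC.sqrt (resK A - resK A * resK A) :=
  (CFC.sqrt_unique (resM_comp_resM hA.1) (resM_nonneg hA)).symm

/-- A positive self-adjoint operator is determined by its square. -/
theorem eq_of_sqGraph_eq {A B : H →ₗ.[ℂ] H} (hA : IsPositiveOp A) (hB : IsPositiveOp B)
    (h : sqGraph A = sqGraph B) : A = B := by
  have hK := (resK_eq_iff_sqGraph_eq hA.1 hB.1).1 h
  refine eq_of_resK_resM hA.1 hB.1 hK ?_
  rw [resM_eq_sqrt hA, resM_eq_sqrt hB, hK]

theorem commute_sqrt {a b : H →L[ℂ] H} (h : Commute a b) : Commute (CFC.sqrt a) b := by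
  rw [CFC.sqrt]
  exact Commute.cfcₙ_nnreal h _

end Toolkit

section Toolkit

open Filter Topology

variable {H : Type} [NormedAddCommGroup H] [InnerProductSpace ℂ H] [CompleteSpace H]

/-! ### Absolute value, square root and sign of a self-adjoint operator -/

theorem inner_clm_symm {L : H →L[ℂ] H} (h : IsSelfAdjoint L) (x y : H) :
    ⟪L x, y⟫_ℂ = ⟪x, L y⟫_ℂ :=
  (ContinuousLinearMap.isSelfAdjoint_iff_isSymmetric.1 h) x y

theorem dense_range_of_injective {L : H →L[ℂ] H} (h : IsSelfAdjoint L)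
    (hi : Function.Injective L) : Dense (Set.range L) := by
  have h1 : (LinearMap.range L.toLinearMap).topologicalClosure = ⊤ := by
    rw [Submodule.topologicalClosure_eq_top_iff, Submodule.eq_bot_iff]
    intro y hy
    refine hi ?_
    rw [map_zero]
    refine ext_inner_left ℂ fun x => ?_
    rw [← inner_clm_symm h, inner_zero_right]
    exact (Submodule.mem_orthogonal _ _).1 hy _ ⟨x, rfl⟩
  exact Submodule.dense_iff_topologicalClosure_eq_top.2 h1

/-- A bounded injective `0 ≤ L ≤ 1` is `(1 + S²)⁻¹` for a positive self-adjoint operator `S`, namely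
for the one with graph `{(L^{1/2} x, (1 - L)^{1/2} x)}`. -/
theorem exists_positive_resK_eq {L : H →L[ℂ] H} (h0 : 0 ≤ L) (h1 : L ≤ 1)
    (hi : Function.Injective L) : ∃ S : H →ₗ.[ℂ] H, IsPositiveOp S ∧ resK S = L := by
  set D := CFC.sqrt L with hD
  set C := CFC.sqrt (1 - L) with hC
  have hDD : D * D = L := CFC.sqrt_mul_sqrt_self L h0
  have hCC : C * C = 1 - L := CFC.sqrt_mul_sqrt_self _ (sub_nonneg.2 h1)
  have hD0 : 0 ≤ D := CFC.sqrt_nonneg L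
  have hC0 : 0 ≤ C := CFC.sqrt_nonneg _
  have hDs : IsSelfAdjoint D := hD0.isSelfAdjoint
  have hCs : IsSelfAdjoint C := hC0.isSelfAdjoint
  have hcomm : Commute D C := by
    refine commute_sqrt (Commute.symm (commute_sqrt ?_))
    exact (Commute.one_left L).sub_left (Commute.refl L)
  have hDC : 0 ≤ D * C := hcomm.mul_nonneg hD0 hC0
  have hDi : Function.Injective D := by
    rw [injective_iff_map_eq_zero]
    intro x hx
    refine (injective_iff_map_eq_zero L).1 hi x ?_
    rw [← hDD, mul_apply_eq_comp, hx, map_zero]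
  have eDC : ∀ x, D (C x) = C (D x) := fun x => congrArg (fun T : H →L[ℂ] H => T x) hcomm.eq
  have eDD : ∀ x, D (D x) = L x := fun x => congrArg (fun T : H →L[ℂ] H => T x) hDD
  have eCC : ∀ x, C (C x) = x - L x := fun x => congrArg (fun T : H →L[ℂ] H => T x) hCC
  set g : Submodule ℂ (H × H) := LinearMap.range (D.toLinearMap.prod C.toLinearMap) with hg
  have hmem : ∀ p : H × H, p ∈ g ↔ ∃ x, D x = p.1 ∧ C x = p.2 := by
    intro p
    simp only [hg, LinearMap.mem_range, LinearMap.prod_apply, Prod.ext_iff]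
    rfl
  have hfun : ∀ x ∈ g, x.1 = 0 → x.2 = 0 := by
    intro p hp h
    obtain ⟨x, h2, h3⟩ := (hmem p).1 hp
    rw [h] at h2
    rw [← h3, (injective_iff_map_eq_zero D).1 hDi x h2, map_zero]
  have hgraph : g.toLinearPMap.graph = g := Submodule.toLinearPMap_graph_eq g hfun
  have hmem' : ∀ a b : H, (a, b) ∈ g.toLinearPMap.graph ↔ ∃ x, D x = a ∧ C x = b := by
    intro a b
    rw [hgraph, hmem]
  have hdense : Dense (g.toLinearPMap.domain : Set H) := by
    refine (dense_range_of_injective hDs hDi).mono ?_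
    rintro _ ⟨x, rfl⟩
    exact LinearPMap.mem_domain_of_mem_graph ((hmem' _ _).2 ⟨x, rfl, rfl⟩)
  have hsa : IsSelfAdjoint g.toLinearPMap := by
    refine isSelfAdjoint_of_graph_mem_iff hdense fun y z => ?_
    constructor
    · rintro h x x' hx
      obtain ⟨a, rfl, rfl⟩ := (hmem' _ _).1 h
      obtain ⟨b, rfl, rfl⟩ := (hmem' _ _).1 hx
      rw [inner_clm_symm hCs, inner_clm_symm hDs, eDC]
    · intro h
      have h2 : C y = D z := by
        refine ext_inner_left ℂ fun x => ?_
        rw [← inner_clm_symm hCs, ← inner_clm_symm hDs]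
        exact h _ _ ((hmem' _ _).2 ⟨x, rfl, rfl⟩)
      refine (hmem' _ _).2 ⟨D y + C z, ?_, ?_⟩
      · rw [map_add, eDC, ← h2, eDD, eCC]; abel
      · rw [map_add, ← eDC, h2, eDD, eCC]; abel
  refine ⟨g.toLinearPMap, isPositiveOp_of_graph hsa ?_, ?_⟩
  · intro a b hab
    obtain ⟨x, rfl, rfl⟩ := (hmem' _ _).1 hab
    have := re_inner_nonneg hDC x
    rw [mul_apply_eq_comp, inner_clm_symm hDs] at this
    rwa [← inner_conj_symm, Complex.conj_re]
  · ext η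
    refine (res_unique hsa (b := C (D η)) ?_ ?_).1
    · exact (hmem' _ _).2 ⟨D η, eDD η, rfl⟩
    · exact (hmem' _ _).2 ⟨C η, eDC η, eCC η⟩

theorem absOp_spec {A : H →ₗ.[ℂ] H} (hA : IsSelfAdjoint A) :
    IsPositiveOp (absOp A) ∧ sqGraph (absOp A) = sqGraph A := by
  refine Classical.epsilon_spec (p := fun B => IsPositiveOp B ∧ sqGraph B = sqGraph A) ?_
  obtain ⟨S, hS, hK⟩ := exists_positive_resK_eq (resK_nonneg hA) (resK_le_one hA)
    (resK_injective hA)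
  exact ⟨S, hS, (resK_eq_iff_sqGraph_eq hS.1 hA).2 hK⟩

theorem absOp_eq {A B : H →ₗ.[ℂ] H} (hA : IsSelfAdjoint A) (hB : IsPositiveOp B)
    (h : resK B = resK A) : absOp A = B :=
  eq_of_sqGraph_eq (absOp_spec hA).1 hB
    ((absOp_spec hA).2.trans ((resK_eq_iff_sqGraph_eq hB.1 hA).2 h).symm)

theorem resK_absOp {A : H →ₗ.[ℂ] H} (hA : IsSelfAdjoint A) : resK (absOp A) = resK A :=
  (resK_eq_iff_sqGraph_eq (absOp_spec hA).1.1 hA).1 (absOp_spec hA).2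

/-- `(1 + T)⁻¹` for a positive self-adjoint operator `T`. -/
theorem exists_resolvent {T : H →ₗ.[ℂ] H} (hT : IsPositiveOp T) :
    ∃ L : H →L[ℂ] H, 0 ≤ L ∧ L ≤ 1 ∧ Function.Injective L ∧
      ∀ p : H × H, p ∈ T.graph ↔ L (p.1 + p.2) = p.1 := by
  set K := resK T
  set M := resM T
  have hM0 : 0 ≤ M := resM_nonneg hT
  -- With `K = (1 + T²)⁻¹` and `M = T K`, the inverse of `1 + T` is `(K + M) (1 + 2 M)⁻¹`, because
  -- `(1 + T) (K + M) = K + 2 M + T² K = 1 + 2 M`.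
  have hu : IsUnit (1 + (M + M)) := by
    refine ContinuousLinearMap.isUnit_of_forall_le_norm_inner_map _ (c := 1) one_pos fun x => ?_
    refine le_trans ?_ (Complex.re_le_norm _)
    have e2 := inner_self_eq_norm_sq (𝕜 := ℂ) x
    simp only [RCLike.re_to_complex] at e2
    have h3 := re_inner_nonneg hM0 x
    change _ ≤ (⟪x + (M x + M x), x⟫_ℂ).re
    rw [inner_add_left, inner_add_left, Complex.add_re, Complex.add_re, e2]
    norm_num
    linarith
  obtain ⟨u, hu⟩ := hu
  set X : H →L[ℂ] H := (↑u⁻¹ : H →L[ℂ] H) with hX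
  have hX1 : ∀ η, X η + (M (X η) + M (X η)) = η := by
    intro η
    have := congrArg (fun T : H →L[ℂ] H => T η) u.mul_inv
    rw [hu] at this
    exact this
  set L : H →L[ℂ] H := (K + M) * X with hL
  have hg : ∀ η, (L η, η - L η) ∈ T.graph := by
    intro η
    have h1 := graph_add (resK_resM_mem hT.1 (X η)) (resM_sub_resK_mem hT.1 (X η))
    have e1 : L η = K (X η) + M (X η) := rfl
    have e2 : η - L η = M (X η) + (X η - K (X η)) := by
      rw [e1]
      nth_rewrite 1 [← hX1 η]
      abel
    rw [e2, e1]
    exact h1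
  have huniq : ∀ p : H × H, p ∈ T.graph ↔ L (p.1 + p.2) = p.1 := by
    intro p
    constructor
    · intro hp
      have h1 := graph_sub (hg (p.1 + p.2)) (x := L (p.1 + p.2)) (y := p.1) (y' := p.2) hp
      have h2 := hT.nonneg h1
      have e : p.1 + p.2 - L (p.1 + p.2) - p.2 = -(L (p.1 + p.2) - p.1) := by abel
      rw [e, inner_neg_right, Complex.neg_re] at h2
      have e2 := inner_self_eq_norm_sq (𝕜 := ℂ) (L (p.1 + p.2) - p.1)
      simp only [RCLike.re_to_complex] at e2
      rw [e2] at h2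
      have h3 : ‖L (p.1 + p.2) - p.1‖ ^ 2 = 0 := by
        nlinarith [sq_nonneg ‖L (p.1 + p.2) - p.1‖]
      exact sub_eq_zero.1 (by simpa using h3)
    · intro h
      have := hg (p.1 + p.2)
      rwa [h, add_sub_cancel_left] at this
  have hLs : IsSelfAdjoint L := by
    rw [ContinuousLinearMap.isSelfAdjoint_iff_isSymmetric]
    intro η ζ
    change ⟪L η, ζ⟫_ℂ = ⟪η, L ζ⟫_ℂ
    have h1 := graph_symm hT.1 (hg η) (hg ζ)
    rw [inner_sub_left, inner_sub_right] at h1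
    linear_combination -h1
  refine ⟨L, ?_, ?_, ?_, huniq⟩
  · refine nonneg_of_re_inner hLs fun η => ?_
    have h1 := hT.nonneg (hg η)
    have e2 := inner_self_eq_norm_sq (𝕜 := ℂ) (L η)
    simp only [RCLike.re_to_complex] at e2
    rw [inner_sub_right, Complex.sub_re, e2] at h1
    nlinarith [sq_nonneg ‖L η‖]
  · rw [← sub_nonneg]
    refine nonneg_of_re_inner ((IsSelfAdjoint.one _).sub hLs) fun η => ?_
    change 0 ≤ (⟪η - L η, η⟫_ℂ).re
    have h1 := hT.nonneg (hg η)
    have e : ⟪η - L η, η⟫_ℂ = ⟪η - L η, η - L η⟫_ℂ + ⟪η - L η, L η⟫_ℂ := by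
      rw [← inner_add_right, sub_add_cancel]
    have e2 := inner_self_eq_norm_sq (𝕜 := ℂ) (η - L η)
    simp only [RCLike.re_to_complex] at e2
    rw [e, Complex.add_re, e2, ← inner_conj_symm, Complex.conj_re]
    positivity
  · rw [injective_iff_map_eq_zero]
    intro η h
    have h1 := hg η
    rw [h] at h1
    have := LinearPMap.graph_fst_eq_zero_snd _ h1 rfl
    simpa using this

theorem sqrtOp_spec {T : H →ₗ.[ℂ] H} (hT : IsPositiveOp T) :
    IsPositiveOp (sqrtOp T) ∧ sqGraph (sqrtOp T) = (T.graph : Set (H × H)) := by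
  refine Classical.epsilon_spec
    (p := fun S => IsPositiveOp S ∧ sqGraph S = (T.graph : Set (H × H))) ?_
  obtain ⟨L, h0, h1, hi, hg⟩ := exists_resolvent hT
  obtain ⟨S, hS, hK⟩ := exists_positive_resK_eq h0 h1 hi
  refine ⟨S, hS, Set.ext fun p => ?_⟩
  rw [mem_sqGraph_iff hS.1, hK]
  exact (hg p).symm

theorem sqrtOp_eq {T S : H →ₗ.[ℂ] H} (hT : IsPositiveOp T) (hS : IsPositiveOp S)
    (h : sqGraph S = (T.graph : Set (H × H))) : sqrtOp T = S :=
  eq_of_sqGraph_eq (sqrtOp_spec hT).1 hS ((sqrtOp_spec hT).2.trans h.symm)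

theorem sqrtAbs_positive {A : H →ₗ.[ℂ] H} (hA : IsSelfAdjoint A) : IsPositiveOp (sqrtAbs A) :=
  (sqrtOp_spec (absOp_spec hA).1).1

theorem sqrtAbs_isSelfAdjoint {A : H →ₗ.[ℂ] H} (hA : IsSelfAdjoint A) :
    IsSelfAdjoint (sqrtAbs A) := (sqrtAbs_positive hA).1

theorem sqGraph_sqrtAbs {A : H →ₗ.[ℂ] H} (hA : IsSelfAdjoint A) :
    sqGraph (sqrtAbs A) = ((absOp A).graph : Set (H × H)) :=
  (sqrtOp_spec (absOp_spec hA).1).2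

theorem mem_absOp_graph_iff {A : H →ₗ.[ℂ] H} (hA : IsSelfAdjoint A) (x y : H) :
    (x, y) ∈ (absOp A).graph ↔ resK (sqrtAbs A) (x + y) = x := by
  rw [← mem_sqGraph_iff (sqrtAbs_isSelfAdjoint hA) (x, y), sqGraph_sqrtAbs hA]
  rfl

theorem resK_sqrtAbs_mem {A : H →ₗ.[ℂ] H} (hA : IsSelfAdjoint A) (η : H) :
    (resK (sqrtAbs A) η, η - resK (sqrtAbs A) η) ∈ (absOp A).graph := by
  rw [mem_absOp_graph_iff hA]; simp

/-- Two self-adjoint operators with the same square have the same domain, a common core, and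
vectors of the same norm as values. -/
theorem exists_common_seq {A B : H →ₗ.[ℂ] H} (hA : IsSelfAdjoint A) (hB : IsSelfAdjoint B)
    (hK : resK A = resK B) {x y : H} (h : (x, y) ∈ A.graph) :
    ∃ y', (x, y') ∈ B.graph ∧ ∃ u : ℕ → H, Tendsto (fun k => resK A (u k)) atTop (𝓝 x) ∧
      Tendsto (fun k => resM A (u k)) atTop (𝓝 y) ∧
      Tendsto (fun k => resM B (u k)) atTop (𝓝 y') := by
  obtain ⟨u, h1, h2⟩ := exists_seq_resK hA h
  have hn : ∀ η, ‖resM B η‖ = ‖resM A η‖ := by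
    intro η
    have e1 := re_inner_resK_self hA η
    have e2 := re_inner_resK_self hB η
    rw [← hK, e1] at e2
    have : ‖resM B η‖ ^ 2 = ‖resM A η‖ ^ 2 := by linarith
    exact (sq_eq_sq₀ (norm_nonneg _) (norm_nonneg _)).1 this
  have hc : CauchySeq fun k => resM B (u k) := by
    have hc' := h2.cauchySeq
    rw [Metric.cauchySeq_iff] at hc' ⊢
    intro ε hε
    obtain ⟨N, hN⟩ := hc' ε hε
    refine ⟨N, fun m hm k hk => ?_⟩
    have := hN m hm k hk
    rw [dist_eq_norm, ← map_sub] at this ⊢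
    rwa [hn]
  obtain ⟨y', hy'⟩ := cauchySeq_tendsto_of_complete hc
  refine ⟨y', ?_, u, h1, h2, hy'⟩
  rw [hK] at h1
  exact graph_of_tendsto hB (fun k => resK_resM_mem hB (u k)) h1 hy'

/-- `‖B x‖ = ‖A x‖` if `A² = B²`; applied to `A` and `|A|`. -/
theorem exists_graph_norm_eq {A B : H →ₗ.[ℂ] H} (hA : IsSelfAdjoint A) (hB : IsSelfAdjoint B)
    (hK : resK A = resK B) {x y : H} (h : (x, y) ∈ A.graph) :
    ∃ y', (x, y') ∈ B.graph ∧ ‖y'‖ = ‖y‖ := by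
  obtain ⟨y', h1, u, hu, h2, h3⟩ := exists_common_seq hA hB hK h
  refine ⟨y', h1, tendsto_nhds_unique h3.norm ?_⟩
  refine h2.norm.congr fun k => ?_
  have e1 := re_inner_resK_self hA (u k)
  have e2 := re_inner_resK_self hB (u k)
  rw [← hK, e1] at e2
  exact (sq_eq_sq₀ (norm_nonneg _) (norm_nonneg _)).1 (by linarith)

theorem commute_resM_absOp {A : H →ₗ.[ℂ] H} (hA : IsSelfAdjoint A) :
    Commute (resM (absOp A)) (resM A) := by
  rw [resM_eq_sqrt (absOp_spec hA).1, resK_absOp hA]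
  have h : Commute (resK A) (resM A) := resK_comp_resM hA
  exact commute_sqrt (h.sub_left (h.mul_left h))

/-- The identities `⟨A x, |A| y⟩ = ⟨|A| x, A y⟩` and `⟨A x, A y⟩ = ⟨|A| x, |A| y⟩`. -/
theorem inner_graph_absOp_eq {A : H →ₗ.[ℂ] H} (hA : IsSelfAdjoint A) {x x' x'' y y' y'' : H}
    (hx : (x, x') ∈ A.graph) (hx' : (x, x'') ∈ (absOp A).graph)
    (hy : (y, y') ∈ A.graph) (hy' : (y, y'') ∈ (absOp A).graph) :
    ⟪x', y''⟫_ℂ = ⟪x'', y'⟫_ℂ ∧ ⟪x', y'⟫_ℂ = ⟪x'', y''⟫_ℂ := by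
  have hB := (absOp_spec hA).1.1
  obtain ⟨x1, h1, u, hu1, hu2, hu3⟩ := exists_common_seq hA hB (resK_absOp hA).symm hx
  obtain ⟨y1, h2, v, hv1, hv2, hv3⟩ := exists_common_seq hA hB (resK_absOp hA).symm hy
  obtain rfl := graph_unique h1 hx'
  obtain rfl := graph_unique h2 hy'
  constructor
  · refine tendsto_nhds_unique (hu2.inner hv3) ((hu3.inner hv2).congr fun k => ?_)
    rw [inner_clm_symm (isSelfAdjoint_resM hA), inner_clm_symm (isSelfAdjoint_resM hB)]
    congr 1
    exact congrArg (fun T : H →L[ℂ] H => T (v k)) (commute_resM_absOp hA).eq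
  · refine tendsto_nhds_unique (hu2.inner hv2) ((hu3.inner hv3).congr fun k => ?_)
    rw [inner_clm_symm (isSelfAdjoint_resM hA), inner_clm_symm (isSelfAdjoint_resM hB)]
    congr 1
    have e1 := congrArg (fun T : H →L[ℂ] H => T (v k)) (resM_comp_resM hA)
    have e2 := congrArg (fun T : H →L[ℂ] H => T (v k)) (resM_comp_resM hB)
    rw [resK_absOp hA] at e2
    exact e2.trans e1.symm

theorem mem_ker_absOp {A : H →ₗ.[ℂ] H} (hA : IsSelfAdjoint A) {x : H} :
    (x, (0 : H)) ∈ A.graph ↔ (x, (0 : H)) ∈ (absOp A).graph := by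
  have hB := (absOp_spec hA).1.1
  constructor
  · intro h
    obtain ⟨y, h1, h2⟩ := exists_graph_norm_eq hA hB (resK_absOp hA).symm h
    rw [norm_zero, norm_eq_zero] at h2
    rwa [h2] at h1
  · intro h
    obtain ⟨y, h1, h2⟩ := exists_graph_norm_eq hB hA (resK_absOp hA) h
    rw [norm_zero, norm_eq_zero] at h2
    rwa [h2] at h1

/-- Existence of the sign. On the graph `{(|A| x, A x)}` the two components have equal norms, hence the
orthogonal projection of `(|A| x, 0)` onto its closure is half of `(|A| x, A x)`. -/
theorem signOp_spec {A : H →ₗ.[ℂ] H} (hA : IsSelfAdjoint A) :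
    (∀ x y : H, (x, y) ∈ (absOp A).graph → (x, signOp A y) ∈ A.graph) ∧
      ∀ x : H, (x, (0 : H)) ∈ A.graph → signOp A x = 0 := by
  refine Classical.epsilon_spec (p := fun U : H →L[ℂ] H =>
    (∀ x y : H, (x, y) ∈ (absOp A).graph → (x, U y) ∈ A.graph) ∧
    ∀ x : H, (x, (0 : H)) ∈ A.graph → U x = 0) ?_
  have hB := (absOp_spec hA).1.1
  -- `Z` is the closure of `{(|A| x, A x)}`, the graph of the sign on the range of `|A|`.
  set Z₀ : Submodule ℂ (WithLp 2 (H × H)) := Submodule.span ℂ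
    {p | ∃ x, (x, p.fst) ∈ (absOp A).graph ∧ (x, p.snd) ∈ A.graph} with hZ₀
  set Z := Z₀.topologicalClosure with hZ
  have : CompleteSpace Z := Submodule.topologicalClosure.completeSpace _
  have horth : ∀ p : WithLp 2 (H × H), (∀ x y z, (x, y) ∈ (absOp A).graph → (x, z) ∈ A.graph →
      ⟪y, p.fst⟫_ℂ + ⟪z, p.snd⟫_ℂ = 0) → p ∈ Zᗮ := by
    intro p hp
    rw [hZ, Submodule.orthogonal_closure]
    rw [hZ₀, Submodule.mem_orthogonal]
    intro q hq
    induction hq using Submodule.span_induction with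
    | mem q hq =>
      obtain ⟨x, h1, h2⟩ := hq
      exact hp x _ _ h1 h2
    | zero => exact inner_zero_left _
    | add a b _ _ ha hb => rw [inner_add_left, ha, hb, add_zero]
    | smul c a _ ha => rw [inner_smul_left, ha, mul_zero]
  refine ⟨(2 : ℂ) • (WithLp.sndL 2 ℂ H H ∘L Z.starProjection ∘L inlL2), ?_, ?_⟩
  · intro x y hxy
    obtain ⟨z, hz, -⟩ := exists_graph_norm_eq hB hA (resK_absOp hA) hxy
    have hmem : (2⁻¹ : ℂ) • WithLp.toLp 2 (y, z) ∈ Z :=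
      Z.smul_mem _ (Submodule.le_topologicalClosure _ (Submodule.subset_span ⟨x, hxy, hz⟩))
    have hproj : Z.starProjection (inlL2 y) = (2⁻¹ : ℂ) • WithLp.toLp 2 (y, z) := by
      refine Submodule.eq_starProjection_of_mem_orthogonal hmem (horth _ ?_)
      intro x1 y1 z1 h1 h2
      change ⟪y1, y - (2⁻¹ : ℂ) • y⟫_ℂ + ⟪z1, 0 - (2⁻¹ : ℂ) • z⟫_ℂ = 0
      have := (inner_graph_absOp_eq hA h2 h1 hz hxy).2
      rw [zero_sub, inner_sub_right, inner_neg_right, inner_smul_right, inner_smul_right, this]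
      ring
    have e : ((2 : ℂ) • (WithLp.sndL 2 ℂ H H ∘L Z.starProjection ∘L inlL2)) y = z := by
      change (2 : ℂ) • (Z.starProjection (inlL2 y)).snd = z
      rw [hproj]
      change (2 : ℂ) • ((2⁻¹ : ℂ) • z) = z
      rw [smul_smul]
      norm_num
    rw [e]
    exact hz
  · intro x hx
    have hproj : Z.starProjection (inlL2 x) = 0 := by
      refine (Submodule.starProjection_apply_eq_zero_iff Z).2 (horth _ ?_)
      intro x1 y1 z1 h1 h2
      change ⟪y1, x⟫_ℂ + ⟪z1, (0 : H)⟫_ℂ = 0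
      rw [graph_symm hB h1 ((mem_ker_absOp hA).1 hx)]
      simp
    change (2 : ℂ) • (Z.starProjection (inlL2 x)).snd = 0
    rw [hproj]
    exact smul_zero _

/-- Vectors that are orthogonal to the range and the kernel of a self-adjoint operator vanish. -/
theorem eq_zero_of_orthogonal {A : H →ₗ.[ℂ] H} (hA : IsSelfAdjoint A) {y : H}
    (h1 : ∀ x x', (x, x') ∈ (absOp A).graph → ⟪x', y⟫_ℂ = 0)
    (h2 : ∀ x, (x, (0 : H)) ∈ A.graph → ⟪x, y⟫_ℂ = 0) : y = 0 := by
  have hB := (absOp_spec hA).1.1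
  have : (y, (0 : H)) ∈ (absOp A).graph := by
    rw [graph_mem_iff hB]
    intro x x' hx
    rw [h1 x x' hx, inner_zero_right]
  have := h2 y ((mem_ker_absOp hA).2 this)
  exact inner_self_eq_zero.1 this

theorem clm_eq_zero_of_range_ker {A : H →ₗ.[ℂ] H} (hA : IsSelfAdjoint A) {F : Type}
    [NormedAddCommGroup F] [InnerProductSpace ℂ F] [CompleteSpace F] {X : H →L[ℂ] F}
    (h1 : ∀ x x', (x, x') ∈ (absOp A).graph → X x' = 0)
    (h2 : ∀ x, (x, (0 : H)) ∈ A.graph → X x = 0) : X = 0 := by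
  have h : X.adjoint = 0 := by
    ext y
    refine eq_zero_of_orthogonal hA ?_ ?_
    · intro x x' hx
      rw [ContinuousLinearMap.adjoint_inner_right, h1 x x' hx, inner_zero_left]
    · intro x hx
      rw [ContinuousLinearMap.adjoint_inner_right, h2 x hx, inner_zero_left]
  rw [← ContinuousLinearMap.adjoint_adjoint X, h, map_zero]

theorem isSelfAdjoint_signOp {A : H →ₗ.[ℂ] H} (hA : IsSelfAdjoint A) :
    IsSelfAdjoint (signOp A) := by
  have hB := (absOp_spec hA).1.1
  obtain ⟨h1, h2⟩ := signOp_spec hA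
  have key : ContinuousLinearMap.adjoint (signOp A) - signOp A = 0 := by
    refine clm_eq_zero_of_range_ker hA ?_ ?_
    · intro x x' hx
      refine eq_zero_of_orthogonal hA ?_ ?_
      · intro y y' hy
        rw [sub_apply, inner_sub_right,
          ContinuousLinearMap.adjoint_inner_right,
          (inner_graph_absOp_eq hA (h1 _ _ hy) hy (h1 _ _ hx) hx).1, sub_self]
      · intro y hy
        rw [sub_apply, inner_sub_right,
          ContinuousLinearMap.adjoint_inner_right, h2 y hy, inner_zero_left,
          ← graph_symm hA hy (h1 _ _ hx), inner_zero_left, sub_zero]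
    · intro x hx
      refine eq_zero_of_orthogonal hA ?_ ?_
      · intro y y' hy
        rw [sub_apply, inner_sub_right,
          ContinuousLinearMap.adjoint_inner_right, h2 x hx, inner_zero_right, sub_zero,
          graph_symm hA (h1 _ _ hy) hx, inner_zero_right]
      · intro y hy
        rw [sub_apply, inner_sub_right,
          ContinuousLinearMap.adjoint_inner_right, h2 x hx, h2 y hy, inner_zero_right,
          inner_zero_left, sub_zero]
  exact sub_eq_zero.1 key

theorem opForm_conj {A : H →ₗ.[ℂ] H} (hA : IsSelfAdjoint A) (x y : (sqrtAbs A).domain) :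
    conj (opForm A x y) = opForm A y x := by
  rw [opForm, opForm, inner_conj_symm, inner_clm_symm (isSelfAdjoint_signOp hA)]

/-- Bounded operators leaving the graph of a positive operator invariant do the same for its
square root. -/
theorem sqrtAbs_graph_invariant {A : H →ₗ.[ℂ] H} (hA : IsSelfAdjoint A) {X : H →L[ℂ] H}
    (hX : ∀ x y, (x, y) ∈ (absOp A).graph → (X x, X y) ∈ (absOp A).graph) {x y : H}
    (h : (x, y) ∈ (sqrtAbs A).graph) : (X x, X y) ∈ (sqrtAbs A).graph := by
  have hS := sqrtAbs_positive hA
  have hK : Commute (resK (sqrtAbs A)) X := by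
    refine ContinuousLinearMap.ext fun η => ?_
    have h1 := (mem_absOp_graph_iff hA _ _).1 (hX _ _ (resK_sqrtAbs_mem hA η))
    rw [← map_add, add_sub_cancel] at h1
    exact h1
  have hM : Commute (resM (sqrtAbs A)) X := by
    rw [resM_eq_sqrt hS]
    exact commute_sqrt (hK.sub_left (hK.mul_left hK))
  obtain ⟨u, h1, h2⟩ := exists_seq_resK hS.1 h
  refine graph_of_tendsto hS.1 (fun k => resK_resM_mem hS.1 (X (u k)))
    (((X.continuous.tendsto _).comp h1).congr fun k => ?_)
    (((X.continuous.tendsto _).comp h2).congr fun k => ?_)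
  · exact (congrArg (fun T : H →L[ℂ] H => T (u k)) hK.eq).symm
  · exact (congrArg (fun T : H →L[ℂ] H => T (u k)) hM.eq).symm

theorem signOp_absOp_graph {A : H →ₗ.[ℂ] H} (hA : IsSelfAdjoint A) {x y : H}
    (h : (x, y) ∈ (absOp A).graph) : (signOp A x, signOp A y) ∈ (absOp A).graph := by
  obtain ⟨h1, h2⟩ := signOp_spec hA
  rw [graph_mem_iff (absOp_spec hA).1.1]
  intro z z' hz
  rw [← inner_clm_symm (isSelfAdjoint_signOp hA)]
  exact graph_symm hA (h1 _ _ hz) (h1 _ _ h)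

theorem mem_sqrtAbs_of_absOp {A : H →ₗ.[ℂ] H} (hA : IsSelfAdjoint A) {x y : H}
    (h : (x, y) ∈ (absOp A).graph) :
    ∃ z, (x, z) ∈ (sqrtAbs A).graph ∧ (z, y) ∈ (sqrtAbs A).graph := by
  have : (x, y) ∈ sqGraph (sqrtAbs A) := by rw [sqGraph_sqrtAbs hA]; exact h
  exact this

theorem mem_sqrtAbs_domain_of_graph {A : H →ₗ.[ℂ] H} (hA : IsSelfAdjoint A) {x y : H}
    (h : (x, y) ∈ A.graph) : x ∈ (sqrtAbs A).domain := by
  obtain ⟨y', h1, -⟩ := exists_graph_norm_eq hA (absOp_spec hA).1.1 (resK_absOp hA).symm h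
  obtain ⟨z, h2, -⟩ := mem_sqrtAbs_of_absOp hA h1
  exact LinearPMap.mem_domain_of_mem_graph h2

/-- On the operator domain, the quadratic form of `A` is `⟨x, A y⟩`. -/
theorem opForm_eq_inner {A : H →ₗ.[ℂ] H} (hA : IsSelfAdjoint A) (x y : (sqrtAbs A).domain) {z : H}
    (h : ((y : H), z) ∈ A.graph) : opForm A x y = ⟪(x : H), z⟫_ℂ := by
  obtain ⟨y', h1, -⟩ := exists_graph_norm_eq hA (absOp_spec hA).1.1 (resK_absOp hA).symm h
  have hz : signOp A y' = z := graph_unique ((signOp_spec hA).1 _ _ h1) h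
  obtain ⟨t, h2, h3⟩ := mem_sqrtAbs_of_absOp hA h1
  have ht : sqrtAbs A y = t := graph_unique ((sqrtAbs A).mem_graph y) h2
  have h4 := sqrtAbs_graph_invariant hA (fun _ _ => signOp_absOp_graph hA) h3
  rw [opForm, ht, ← hz]
  exact graph_symm (sqrtAbs_isSelfAdjoint hA) ((sqrtAbs A).mem_graph x) h4

end Toolkit

section Toolkit

open Filter Topology

variable {H : Type} [NormedAddCommGroup H] [InnerProductSpace ℂ H] [CompleteSpace H]

/-! ### Comparison of form domains and bounded perturbations -/

theorem norm_resK_le {A : H →ₗ.[ℂ] H} (hA : IsSelfAdjoint A) (η : H) : ‖resK A η‖ ≤ ‖η‖ := by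
  have h1 := re_inner_resK_self hA η
  have h2 := (Complex.re_le_norm _).trans (norm_inner_le_norm (𝕜 := ℂ) (resK A η) η)
  by_contra! h
  nlinarith [norm_nonneg η, norm_nonneg (resK A η), sq_nonneg ‖resM A η‖]

theorem norm_sub_resK_le {A : H →ₗ.[ℂ] H} (hA : IsSelfAdjoint A) (η : H) :
    ‖η - resK A η‖ ≤ ‖η‖ := by
  have h1 := re_inner_resK_self hA η
  have e1 := norm_sub_sq (𝕜 := ℂ) η (resK A η)
  rw [← inner_conj_symm] at e1
  simp only [RCLike.re_to_complex, Complex.conj_re] at e1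
  rw [h1] at e1
  refine abs_le_of_sq_le_sq' ?_ (norm_nonneg _) |>.2
  nlinarith [sq_nonneg ‖resM A η‖, sq_nonneg ‖resK A η‖]

theorem norm_inner_sq_le_of_nonneg {L : H →L[ℂ] H} (h : 0 ≤ L) (x y : H) :
    ‖⟪L x, y⟫_ℂ‖ ^ 2 ≤ (⟪L x, x⟫_ℂ).re * (⟪L y, y⟫_ℂ).re := by
  have hs : IsSelfAdjoint (CFC.sqrt L) := (CFC.sqrt_nonneg L).isSelfAdjoint
  have e : ∀ x y, ⟪L x, y⟫_ℂ = ⟪CFC.sqrt L x, CFC.sqrt L y⟫_ℂ := by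
    intro x y
    rw [← inner_clm_symm hs, ← mul_apply_eq_comp, CFC.sqrt_mul_sqrt_self L h]
  have e1 : ∀ x, (⟪L x, x⟫_ℂ).re = ‖CFC.sqrt L x‖ ^ 2 := by
    intro x
    rw [e]
    exact inner_self_eq_norm_sq (𝕜 := ℂ) _
  rw [e1, e1, e, ← mul_pow]
  exact pow_le_pow_left₀ (norm_nonneg _) (norm_inner_le_norm _ _) 2

/-- The Heinz inequality: a bound of `A'` by `A` on the domain of `A` gives a bound of
`|A'|^{1/2}` by `|A|^{1/2}` on the form domain of `A`. -/
theorem exists_sqrtAbs_bound {A A' : H →ₗ.[ℂ] H} (hA : IsSelfAdjoint A) (hA' : IsSelfAdjoint A')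
    {a b : ℝ} (ha : 0 ≤ a) (hb : 0 ≤ b)
    (h : ∀ x y, (x, y) ∈ A.graph → ∃ y', (x, y') ∈ A'.graph ∧ ‖y'‖ ≤ a * ‖y‖ + b * ‖x‖) :
    ∃ C : ℝ, 0 ≤ C ∧ ∀ x z, (x, z) ∈ (sqrtAbs A).graph →
      ∃ z', (x, z') ∈ (sqrtAbs A').graph ∧ ‖z'‖ ^ 2 ≤ C * (‖z‖ ^ 2 + ‖x‖ ^ 2) := by
  have hS := sqrtAbs_isSelfAdjoint hA
  have hS' := sqrtAbs_isSelfAdjoint hA'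
  set L := resK (sqrtAbs A) with hL
  set L' := resK (sqrtAbs A') with hL'
  set c : ℝ := 1 + a + b with hc
  have hc0 : 0 ≤ c := by positivity
  -- in terms of `L = (1 + |A|)⁻¹` and `L' = (1 + |A'|)⁻¹`: the range of `L` is in the domain of `A'`
  have hdom : ∀ w, ∃ t', (L w, t') ∈ (absOp A').graph ∧ ‖t'‖ ≤ (a + b) * ‖w‖ := by
    intro w
    obtain ⟨y, h1, h2⟩ := exists_graph_norm_eq (absOp_spec hA).1.1 hA (resK_absOp hA)
      (resK_sqrtAbs_mem hA w)
    obtain ⟨y', h3, h4⟩ := h _ _ h1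
    obtain ⟨t', h5, h6⟩ := exists_graph_norm_eq hA' (absOp_spec hA').1.1 (resK_absOp hA').symm h3
    refine ⟨t', h5, ?_⟩
    rw [h6]
    refine h4.trans ?_
    rw [h2, add_mul]
    exact add_le_add (mul_le_mul_of_nonneg_left (norm_sub_resK_le hS w) ha)
      (mul_le_mul_of_nonneg_left (norm_resK_le hS w) hb)
  -- the hypothesis says that `(1 + |A'|) L` is bounded by `c`; its adjoint gives `L² ≤ c² L'²`
  have step1 : ∀ x, ‖L x‖ ≤ c * ‖L' x‖ := by
    intro x
    set w := L x with hw
    obtain ⟨t', h1, h2⟩ := hdom w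
    have h3 := graph_symm (absOp_spec hA').1.1 h1 (resK_sqrtAbs_mem hA' x)
    have h4 : ⟪w, w⟫_ℂ = ⟪L w, L' x⟫_ℂ + ⟪t', L' x⟫_ℂ := by
      rw [h3, ← inner_add_right, add_sub_cancel]
      exact (inner_clm_symm (isSelfAdjoint_resK hS) w x).symm
    have h5 : ‖w‖ ^ 2 = ‖⟪w, w⟫_ℂ‖ := by rw [inner_self_eq_norm_sq_to_K]; simp
    have h6 : ‖w‖ ^ 2 ≤ ‖w‖ * ‖L' x‖ + (a + b) * ‖w‖ * ‖L' x‖ := by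
      rw [h5, h4]
      refine (norm_add_le _ _).trans (add_le_add ?_ ?_)
      · exact (norm_inner_le_norm _ _).trans
          (mul_le_mul_of_nonneg_right (norm_resK_le hS w) (norm_nonneg _))
      · exact (norm_inner_le_norm _ _).trans
          (mul_le_mul_of_nonneg_right h2 (norm_nonneg _))
    rcases (norm_nonneg w).eq_or_lt with h0 | h0
    · rw [← h0]; positivity
    · have : ‖w‖ * ‖w‖ ≤ ‖w‖ * (c * ‖L' x‖) := by rw [hc]; nlinarith
      exact le_of_mul_le_mul_left this h0
  have hL0 : 0 ≤ L := resK_nonneg hS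
  have hL'0 : 0 ≤ L' := resK_nonneg hS'
  -- the square root is operator monotone
  have step2 : L ≤ c • L' := by
    have hcL : 0 ≤ c • L' := smul_nonneg hc0 hL'0
    rw [← CFC.sqrt_mul_self L hL0, ← CFC.sqrt_mul_self (c • L') hcL]
    refine CFC.sqrt_le_sqrt _ _ ?_
    rw [← sub_nonneg]
    have s1 : IsSelfAdjoint L := isSelfAdjoint_resK hS
    have s2 : IsSelfAdjoint (c • L') := hcL.isSelfAdjoint
    refine nonneg_of_re_inner ?_ fun x => ?_
    · refine IsSelfAdjoint.sub ?_ ?_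
      · exact (s2.commute_iff s2).1 (Commute.refl _)
      · exact (s1.commute_iff s1).1 (Commute.refl _)
    · rw [sub_apply, inner_sub_left, mul_apply_eq_comp, mul_apply_eq_comp,
        inner_clm_symm s1, inner_clm_symm s2, Complex.sub_re]
      have e1 := inner_self_eq_norm_sq (𝕜 := ℂ) (L x)
      have e2 := inner_self_eq_norm_sq (𝕜 := ℂ) ((c • L') x)
      simp only [RCLike.re_to_complex] at e1 e2
      rw [e1, e2, sub_nonneg]
      refine pow_le_pow_left₀ (norm_nonneg _) ((step1 x).trans ?_) 2
      rw [smul_apply, norm_smul, Real.norm_of_nonneg hc0]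
  have step2' : ∀ x, (⟪L x, x⟫_ℂ).re ≤ c * (⟪L' x, x⟫_ℂ).re := by
    intro x
    have := re_inner_nonneg (sub_nonneg.2 step2) x
    rw [sub_apply, inner_sub_left, Complex.sub_re, smul_apply,
      inner_smul_left_eq_smul, Complex.smul_re, smul_eq_mul] at this
    linarith
  -- the bound on the core `ran L` of `|A|^{1/2}`, from the Cauchy–Schwarz inequality for `L`
  have step3 : ∀ η, ∃ z', (L η, z') ∈ (sqrtAbs A').graph ∧
      ‖z'‖ ^ 2 ≤ c * (‖resM (sqrtAbs A) η‖ ^ 2 + ‖L η‖ ^ 2) := by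
    intro η
    obtain ⟨t', h1, -⟩ := hdom η
    obtain ⟨z', h2, h3⟩ := mem_sqrtAbs_of_absOp hA' h1
    refine ⟨z', h2, ?_⟩
    set x := L η with hx
    set ζ := x + t' with hζ
    have h4 : L' ζ = x := (mem_absOp_graph_iff hA' _ _).1 h1
    have h5 : (⟪x, ζ⟫_ℂ).re = ‖x‖ ^ 2 + ‖z'‖ ^ 2 := by
      rw [hζ, inner_add_right, ← graph_symm hS' h2 h3, Complex.add_re]
      exact congrArg₂ (· + ·) (inner_self_eq_norm_sq (𝕜 := ℂ) x)
        (inner_self_eq_norm_sq (𝕜 := ℂ) z')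
    have h6 := norm_inner_sq_le_of_nonneg hL0 η ζ
    have h7 := step2' ζ
    rw [h4] at h7
    have h8 : (⟪x, ζ⟫_ℂ).re ≤ ‖⟪L η, ζ⟫_ℂ‖ := Complex.re_le_norm _
    have h9 : (⟪L η, η⟫_ℂ).re = ‖L η‖ ^ 2 + ‖resM (sqrtAbs A) η‖ ^ 2 := re_inner_resK_self hS η
    rw [h9] at h6
    set X := (⟪x, ζ⟫_ℂ).re with hX
    set Y := ‖x‖ ^ 2 + ‖resM (sqrtAbs A) η‖ ^ 2 with hY
    have hY0 : 0 ≤ Y := by positivity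
    have hX0 : 0 ≤ X := by rw [h5]; positivity
    have h10 : X * X ≤ X * (c * Y) := by
      calc X * X ≤ ‖⟪L η, ζ⟫_ℂ‖ ^ 2 := by nlinarith
        _ ≤ Y * (⟪L ζ, ζ⟫_ℂ).re := h6
        _ ≤ Y * (c * X) := mul_le_mul_of_nonneg_left h7 hY0
        _ = X * (c * Y) := by ring
    have h11 : X ≤ c * Y := by
      rcases hX0.eq_or_lt with h0 | h0
      · rw [← h0]; positivity
      · exact le_of_mul_le_mul_left h10 h0
    have h12 : ‖resM (sqrtAbs A) η‖ ^ 2 + ‖x‖ ^ 2 = Y := by rw [hY]; ring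
    rw [h12]
    nlinarith [sq_nonneg ‖x‖]
  refine ⟨c, hc0, fun x z hxz => ?_⟩
  -- passage from the core to the form domain
  obtain ⟨u, hu1, hu2⟩ := exists_seq_resK hS hxz
  choose f hf1 hf2 using step3
  have hsub : ∀ i j, f (u i) - f (u j) = f (u i - u j) := by
    intro i j
    refine graph_unique (graph_sub (hf1 (u i)) (hf1 (u j))) ?_
    rw [← map_sub]
    exact hf1 _
  have hcau : CauchySeq fun k => f (u k) := by
    rw [Metric.cauchySeq_iff]
    intro ε hε
    have hδ : 0 < ε / (2 * (c + 1)) := by positivity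
    obtain ⟨N1, hN1⟩ := Metric.cauchySeq_iff.1 hu1.cauchySeq _ hδ
    obtain ⟨N2, hN2⟩ := Metric.cauchySeq_iff.1 hu2.cauchySeq _ hδ
    refine ⟨max N1 N2, fun m hm k hk => ?_⟩
    have h1 := hN1 m (le_of_max_le_left hm) k (le_of_max_le_left hk)
    have h2 := hN2 m (le_of_max_le_right hm) k (le_of_max_le_right hk)
    rw [dist_eq_norm, ← map_sub] at h1 h2
    rw [dist_eq_norm, hsub]
    have h3 := hf2 (u m - u k)
    set δ := ε / (2 * (c + 1)) with hδ'
    have hεδ : ε = 2 * (c + 1) * δ := by rw [hδ']; field_simp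
    have h4 : ‖f (u m - u k)‖ ^ 2 ≤ c * (δ ^ 2 + δ ^ 2) := by
      refine h3.trans (mul_le_mul_of_nonneg_left ?_ hc0)
      exact add_le_add (pow_le_pow_left₀ (norm_nonneg _) h2.le 2)
        (pow_le_pow_left₀ (norm_nonneg _) h1.le 2)
    refine lt_of_pow_lt_pow_left₀ 2 hε.le (h4.trans_lt ?_)
    rw [hεδ]
    nlinarith [mul_nonneg hc0 (sq_nonneg δ), mul_nonneg (mul_nonneg hc0 hc0) (sq_nonneg δ),
      sq_pos_of_pos hδ]
  obtain ⟨z', hz'⟩ := cauchySeq_tendsto_of_complete hcau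
  refine ⟨z', graph_of_tendsto hS' (fun k => hf1 (u k)) hu1 hz', ?_⟩
  refine le_of_tendsto_of_tendsto' (hz'.norm.pow 2)
    (((hu2.norm.pow 2).add (hu1.norm.pow 2)).const_mul c) fun k => hf2 (u k)

theorem mem_add_ofBounded_graph {A : H →ₗ.[ℂ] H} {B : H →L[ℂ] H} (x y : H) :
    (x, y) ∈ (A + ofBounded B).graph ↔ (x, y - B x) ∈ A.graph := by
  constructor
  · intro h
    obtain ⟨t, h1, h2⟩ := (LinearPMap.mem_graph_iff _).1 h
    simp only at h1 h2
    rw [LinearPMap.add_apply] at h2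
    have h3 := A.mem_graph ⟨t, t.2.1⟩
    have e : A ⟨t, t.2.1⟩ = y - B x := by
      rw [← h2, ← h1]
      change _ = _ + B (t : H) - B (t : H)
      rw [add_sub_cancel_right]
    rw [e] at h3
    simp only [h1] at h3
    exact h3
  · intro h
    have hx := LinearPMap.mem_domain_of_mem_graph h
    have hx' : x ∈ (A + ofBounded B).domain := ⟨hx, trivial⟩
    have h1 := (A + ofBounded B).mem_graph ⟨x, hx'⟩
    have e : (A + ofBounded B) ⟨x, hx'⟩ = y := by
      rw [LinearPMap.add_apply, ← (LinearPMap.image_iff hx).2 h]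
      change y - B x + B x = y
      abel
    rwa [e] at h1

theorem isSelfAdjoint_add_ofBounded {A : H →ₗ.[ℂ] H} {B : H →L[ℂ] H} (hA : IsSelfAdjoint A)
    (hB : IsSelfAdjoint B) : IsSelfAdjoint (A + ofBounded B) := by
  refine isSelfAdjoint_of_graph_mem_iff ?_ fun y z => ?_
  · have e : (A + ofBounded B).domain = A.domain := by
      change A.domain ⊓ ⊤ = _
      simp
    rw [e]
    exact hA.dense_domain
  · rw [mem_add_ofBounded_graph, graph_mem_iff hA]
    constructor
    · intro h x x' hx
      have := h x _ ((mem_add_ofBounded_graph _ _).1 hx)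
      rw [inner_sub_left, inner_sub_right, inner_clm_symm hB] at this
      linear_combination this
    · intro h x x' hx
      have := h x (x' + B x) ((mem_add_ofBounded_graph _ _).2 (by simpa using hx))
      rw [inner_add_left, inner_clm_symm hB] at this
      rw [inner_sub_right]
      linear_combination this

theorem mem_ofBounded_graph {B : H →L[ℂ] H} (x y : H) :
    (x, y) ∈ (ofBounded B).graph ↔ y = B x := by
  constructor
  · intro h
    obtain ⟨t, h1, h2⟩ := (LinearPMap.mem_graph_iff _).1 h
    simp only at h1 h2
    rw [← h1, ← h2]
    rfl
  · rintro rfl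
    exact (ofBounded B).mem_graph ⟨x, trivial⟩

theorem isSelfAdjoint_ofBounded {B : H →L[ℂ] H} (hB : IsSelfAdjoint B) :
    IsSelfAdjoint (ofBounded B) := by
  refine isSelfAdjoint_of_graph_mem_iff dense_univ fun y z => ?_
  simp only [mem_ofBounded_graph]
  constructor
  · rintro rfl x x' rfl
    rw [inner_clm_symm hB]
  · intro h
    refine ext_inner_left ℂ fun x => ?_
    rw [← h x _ rfl, inner_clm_symm hB]

theorem mem_sqrtAbs_domain_ofBounded {B : H →L[ℂ] H} (hB : IsSelfAdjoint B) (x : H) :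
    x ∈ (sqrtAbs (ofBounded B)).domain :=
  mem_sqrtAbs_domain_of_graph (isSelfAdjoint_ofBounded hB) ((mem_ofBounded_graph x _).2 rfl)

theorem norm_sqrtAbs_sq_le {A : H →ₗ.[ℂ] H} (hA : IsSelfAdjoint A) (x : (sqrtAbs A).domain) {y : H}
    (h : ((x : H), y) ∈ A.graph) : ‖sqrtAbs A x‖ ^ 2 ≤ ‖(x : H)‖ * ‖y‖ := by
  obtain ⟨y', h1, hn⟩ := exists_graph_norm_eq hA (absOp_spec hA).1.1 (resK_absOp hA).symm h
  obtain ⟨t, h2, h3⟩ := mem_sqrtAbs_of_absOp hA h1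
  have ht : sqrtAbs A x = t := graph_unique ((sqrtAbs A).mem_graph x) h2
  have e := graph_symm (sqrtAbs_isSelfAdjoint hA) h2 h3
  have e2 : ‖t‖ ^ 2 = ‖⟪t, t⟫_ℂ‖ := by rw [inner_self_eq_norm_sq_to_K]; simp
  rw [ht, e2, e, ← hn]
  exact norm_inner_le_norm _ _

theorem opForm_ofBounded {B : H →L[ℂ] H} (hB : IsSelfAdjoint B)
    (x y : (sqrtAbs (ofBounded B)).domain) : opForm (ofBounded B) x y = ⟪(x : H), B y⟫_ℂ :=
  opForm_eq_inner (isSelfAdjoint_ofBounded hB) x y ((mem_ofBounded_graph _ _).2 rfl)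

theorem exists_sqrtAbs_bound_add {A : H →ₗ.[ℂ] H} {B : H →L[ℂ] H} (hA : IsSelfAdjoint A)
    (hB : IsSelfAdjoint B) :
    ∃ C : ℝ, 0 ≤ C ∧ ∀ x z, (x, z) ∈ (sqrtAbs A).graph →
      ∃ z', (x, z') ∈ (sqrtAbs (A + ofBounded B)).graph ∧
        ‖z'‖ ^ 2 ≤ C * (‖z‖ ^ 2 + ‖x‖ ^ 2) := by
  refine exists_sqrtAbs_bound hA (isSelfAdjoint_add_ofBounded hA hB) (a := 1) zero_le_one
    (norm_nonneg B) fun x y hxy => ⟨y + B x, ?_, ?_⟩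
  · rw [mem_add_ofBounded_graph]; simpa using hxy
  · rw [one_mul]
    exact (norm_add_le _ _).trans (add_le_add le_rfl (B.le_opNorm x))

theorem sqrtAbs_add_domain {A : H →ₗ.[ℂ] H} {B : H →L[ℂ] H} (hA : IsSelfAdjoint A)
    (hB : IsSelfAdjoint B) : (sqrtAbs (A + ofBounded B)).domain = (sqrtAbs A).domain := by
  have key : ∀ {A : H →ₗ.[ℂ] H} {B : H →L[ℂ] H}, IsSelfAdjoint A → IsSelfAdjoint B →
      (sqrtAbs A).domain ≤ (sqrtAbs (A + ofBounded B)).domain := by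
    intro A B hA hB x hx
    obtain ⟨C, -, h⟩ := exists_sqrtAbs_bound_add hA hB
    obtain ⟨z', h1, -⟩ := h _ _ ((sqrtAbs A).mem_graph ⟨x, hx⟩)
    exact LinearPMap.mem_domain_of_mem_graph h1
  refine le_antisymm ?_ (key hA hB)
  have e : A + ofBounded B + ofBounded (-B) = A := by
    refine LinearPMap.eq_of_eq_graph (Submodule.ext fun p => ?_)
    obtain ⟨x, y⟩ := p
    rw [mem_add_ofBounded_graph, mem_add_ofBounded_graph]
    simp
  have := key (isSelfAdjoint_add_ofBounded hA hB) hB.neg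
  rwa [e] at this

theorem sqrtAbs_apply_eq {A : H →ₗ.[ℂ] H} (x : (sqrtAbs A).domain) {z : H}
    (h : ((x : H), z) ∈ (sqrtAbs A).graph) : sqrtAbs A x = z :=
  graph_unique ((sqrtAbs A).mem_graph x) h

/-- The quadratic form of a bounded perturbation. -/
theorem opForm_add_ofBounded {A : H →ₗ.[ℂ] H} {B : H →L[ℂ] H} (hA : IsSelfAdjoint A)
    (hB : IsSelfAdjoint B) {x y : H} (hx : x ∈ (sqrtAbs A).domain) (hy : y ∈ (sqrtAbs A).domain)
    (hx' : x ∈ (sqrtAbs (A + ofBounded B)).domain)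
    (hy' : y ∈ (sqrtAbs (A + ofBounded B)).domain) :
    opForm (A + ofBounded B) ⟨x, hx'⟩ ⟨y, hy'⟩ = opForm A ⟨x, hx⟩ ⟨y, hy⟩ + ⟪x, B y⟫_ℂ := by
  have hA' := isSelfAdjoint_add_ofBounded hA hB
  have hS := sqrtAbs_isSelfAdjoint hA
  have hS' := sqrtAbs_isSelfAdjoint hA'
  obtain ⟨C, hC0, hC⟩ := exists_sqrtAbs_bound_add hA hB
  have hyg := (sqrtAbs A).mem_graph ⟨y, hy⟩
  obtain ⟨u, hu1, hu2⟩ := exists_seq_resK hS hyg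
  set z := sqrtAbs A ⟨y, hy⟩ with hz
  set z' := sqrtAbs (A + ofBounded B) ⟨y, hy'⟩ with hz'
  have hyg' : (y, z') ∈ (sqrtAbs (A + ofBounded B)).graph :=
    (sqrtAbs (A + ofBounded B)).mem_graph ⟨y, hy'⟩
  choose f hf1 hf2 using fun k => hC _ _ (resK_resM_mem hS (u k))
  -- approximation of `y` by elements of the operator domain, in both form norms
  have hlim : Tendsto f atTop (𝓝 z') := by
    rw [tendsto_iff_norm_sub_tendsto_zero]
    have hb : ∀ k, ‖f k - z'‖ ≤
        √(C * (‖resM (sqrtAbs A) (u k) - z‖ ^ 2 + ‖resK (sqrtAbs A) (u k) - y‖ ^ 2)) := by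
      intro k
      obtain ⟨t, h1, h2⟩ := hC _ _ (graph_sub (resK_resM_mem hS (u k)) hyg)
      have : f k - z' = t := graph_unique (graph_sub (hf1 k) hyg') h1
      rw [this]
      exact Real.le_sqrt_of_sq_le h2
    refine squeeze_zero (fun _ => norm_nonneg _) hb ?_
    have h1 := tendsto_iff_norm_sub_tendsto_zero.1 hu1
    have h2 := tendsto_iff_norm_sub_tendsto_zero.1 hu2
    have h3 := (((h2.pow 2).add (h1.pow 2)).const_mul C).sqrt
    simpa using h3
  have hcore : ∀ k, ∃ w, (resK (sqrtAbs A) (u k), w) ∈ A.graph := by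
    intro k
    obtain ⟨w, h1, -⟩ := exists_graph_norm_eq (absOp_spec hA).1.1 hA (resK_absOp hA)
      (resK_sqrtAbs_mem hA (u k))
    exact ⟨w, h1⟩
  choose w hw using hcore
  -- on the operator domain, the forms are given by the operators
  have hk : ∀ k, ⟪sqrtAbs (A + ofBounded B) ⟨x, hx'⟩, signOp (A + ofBounded B) (f k)⟫_ℂ =
      ⟪sqrtAbs A ⟨x, hx⟩, signOp A (resM (sqrtAbs A) (u k))⟫_ℂ +
        ⟪x, B (resK (sqrtAbs A) (u k))⟫_ℂ := by
    intro k
    have d1 := LinearPMap.mem_domain_of_mem_graph (hf1 k)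
    have d2 := LinearPMap.mem_domain_of_mem_graph (resK_resM_mem hS (u k))
    have e1 : sqrtAbs (A + ofBounded B) ⟨_, d1⟩ = f k := sqrtAbs_apply_eq _ (hf1 k)
    have e2 : sqrtAbs A ⟨_, d2⟩ = resM (sqrtAbs A) (u k) :=
      sqrtAbs_apply_eq _ (resK_resM_mem hS (u k))
    rw [← e1, ← e2]
    change opForm (A + ofBounded B) ⟨x, hx'⟩ ⟨_, d1⟩ = opForm A ⟨x, hx⟩ ⟨_, d2⟩ + _
    rw [opForm_eq_inner hA _ _ (hw k), opForm_eq_inner hA' _ _ (z := w k + B (resK (sqrtAbs A) (u k)))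
      ((mem_add_ofBounded_graph _ _).2 (by simpa using hw k)), inner_add_right]
  have l1 : Tendsto (fun k => ⟪sqrtAbs (A + ofBounded B) ⟨x, hx'⟩,
      signOp (A + ofBounded B) (f k)⟫_ℂ) atTop
      (𝓝 (opForm (A + ofBounded B) ⟨x, hx'⟩ ⟨y, hy'⟩)) :=
    tendsto_const_nhds.inner (((signOp (A + ofBounded B)).continuous.tendsto _).comp hlim)
  have l2 : Tendsto (fun k => ⟪sqrtAbs A ⟨x, hx⟩, signOp A (resM (sqrtAbs A) (u k))⟫_ℂ +
        ⟪x, B (resK (sqrtAbs A) (u k))⟫_ℂ) atTop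
      (𝓝 (opForm A ⟨x, hx⟩ ⟨y, hy⟩ + ⟪x, B y⟫_ℂ)) :=
    (tendsto_const_nhds.inner (((signOp A).continuous.tendsto _).comp hu2)).add
      (tendsto_const_nhds.inner ((B.continuous.tendsto _).comp hu1))
  exact tendsto_nhds_unique l1 (l2.congr fun k => (hk k).symm)

end Toolkit

section Tensor

open Filter Topology

/-! ### Tensor products of one-body and many-body functions -/

/-- A square integrable function whose integrals over all rectangles of finite measure vanish is zero. -/
theorem ae_eq_zero_of_forall_rect {X Y : Type} [MeasureSpace X] [MeasureSpace Y]
    [SigmaFinite (volume : Measure X)] [SigmaFinite (volume : Measure Y)] {f : X × Y → ℂ}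
    (hf : MemLp f 2 ((volume : Measure X).prod (volume : Measure Y)))
    (h : ∀ (A : Set X) (B : Set Y), MeasurableSet A → MeasurableSet B → volume A < ⊤ →
      volume B < ⊤ →
      ∫ p in A ×ˢ B, f p ∂((volume : Measure X).prod (volume : Measure Y)) = 0) :
    f =ᵐ[(volume : Measure X).prod (volume : Measure Y)] 0 := by
  set μ := (volume : Measure X).prod (volume : Measure Y) with hμ
  set S : ℕ → Set (X × Y) := fun k =>
    spanningSets (volume : Measure X) k ×ˢ spanningSets (volume : Measure Y) k with hS
  have hSm : ∀ k, MeasurableSet (S k) := fun k =>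
    (measurableSet_spanningSets _ k).prod (measurableSet_spanningSets _ k)
  have hSfin : ∀ k, μ (S k) < ⊤ := fun k => by
    rw [hμ, Measure.prod_prod]
    exact ENNReal.mul_lt_top (measure_spanningSets_lt_top _ k) (measure_spanningSets_lt_top _ k)
  have hint : ∀ k, IntegrableOn f (S k) μ := fun k => by
    have : IsFiniteMeasure (μ.restrict (S k)) := ⟨by simpa using hSfin k⟩
    exact (hf.restrict (S k)).integrable (by norm_num)
  have key : ∀ k t, MeasurableSet t → ∫ p in t, f p ∂(μ.restrict (S k)) = 0 := by
    intro k t ht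
    induction t, ht using MeasurableSpace.induction_on_inter generateFrom_prod.symm
      isPiSystem_prod with
    | empty => simp
    | basic t ht =>
      obtain ⟨A, hA, B, hB, rfl⟩ := ht
      rw [Measure.restrict_restrict (hA.prod hB), hS, Set.prod_inter_prod]
      refine h _ _ (hA.inter (measurableSet_spanningSets _ k))
        (hB.inter (measurableSet_spanningSets _ k)) ?_ ?_
      · exact (measure_mono Set.inter_subset_right).trans_lt (measure_spanningSets_lt_top _ k)
      · exact (measure_mono Set.inter_subset_right).trans_lt (measure_spanningSets_lt_top _ k)
    | compl t ht ih =>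
      have h1 := integral_add_compl ht (hint k)
      rw [ih, zero_add] at h1
      rw [h1]
      exact h _ _ (measurableSet_spanningSets _ k) (measurableSet_spanningSets _ k)
        (measure_spanningSets_lt_top _ k) (measure_spanningSets_lt_top _ k)
    | iUnion g hd hm ih =>
      rw [integral_iUnion hm hd (hint k).integrable.integrableOn]
      simp [ih]
  have hk : ∀ k, ∀ᵐ p ∂μ, p ∈ S k → f p = 0 := by
    intro k
    rw [← ae_restrict_iff' (hSm k)]
    exact (hint k).integrable.ae_eq_zero_of_forall_setIntegral_eq_zero fun t ht _ => key k t ht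
  have hall := ae_all_iff.2 hk
  filter_upwards [hall] with p hp
  have h1 : p.1 ∈ ⋃ k, spanningSets (volume : Measure X) k := by simp [iUnion_spanningSets]
  have h2 : p.2 ∈ ⋃ k, spanningSets (volume : Measure Y) k := by simp [iUnion_spanningSets]
  obtain ⟨a, ha⟩ := Set.mem_iUnion.1 h1
  obtain ⟨b, hb⟩ := Set.mem_iUnion.1 h2
  exact hp (max a b) ⟨monotone_spanningSets _ (le_max_left a b) ha,
    monotone_spanningSets _ (le_max_right a b) hb⟩

variable {d n : ℕ}

theorem tensorAt_coeFn (i : Fin (n + 1)) (u : L2 (Space d)) (v : L2 (Config d n)) :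
    tensorAt i u v =ᵐ[volume] fun x => u (x i) * v (i.removeNth x) :=
  MemLp.coeFn_toLp _

theorem mp_removeNth (i : Fin (n + 1)) : MeasurePreserving
    (MeasurableEquiv.piFinSuccAbove (fun _ : Fin (n + 1) => Space d) i) volume
    ((volume : Measure (Space d)).prod (volume : Measure (Config d n))) :=
  volume_preserving_piFinSuccAbove (fun _ => Space d) i

theorem quasi_apply (i : Fin (n + 1)) :
    Measure.QuasiMeasurePreserving (fun x : Config d (n + 1) => x i) :=
  Measure.quasiMeasurePreserving_fst.comp (mp_removeNth i).quasiMeasurePreserving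

theorem quasi_removeNth (i : Fin (n + 1)) :
    Measure.QuasiMeasurePreserving (fun x : Config d (n + 1) => (i.removeNth x : Config d n)) :=
  Measure.quasiMeasurePreserving_snd.comp (mp_removeNth i).quasiMeasurePreserving

theorem integral_removeNth (i : Fin (n + 1)) (f : Space d → Config d n → ℂ) :
    ∫ x : Config d (n + 1), f (x i) (i.removeNth x) =
      ∫ p, f p.1 p.2 ∂((volume : Measure (Space d)).prod (volume : Measure (Config d n))) :=
  (mp_removeNth i).integral_comp' (g := fun p => f p.1 p.2)

theorem inner_L2_def {X : Type} [MeasureSpace X] (f g : L2 X) :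
    ⟪f, g⟫_ℂ = ∫ x, conj (f x) * g x := by
  rw [L2.inner_def]
  refine integral_congr_ae (Eventually.of_forall fun x => ?_)
  simp [RCLike.inner_apply, mul_comm]

theorem inner_tensorAt (i : Fin (n + 1)) (u u' : L2 (Space d)) (v v' : L2 (Config d n)) :
    ⟪tensorAt i u v, tensorAt i u' v'⟫_ℂ = ⟪u, u'⟫_ℂ * ⟪v, v'⟫_ℂ := by
  rw [inner_L2_def, inner_L2_def, inner_L2_def, ← integral_prod_mul,
    ← integral_removeNth i (fun a b => conj (u a) * u' a * (conj (v b) * v' b))]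
  refine integral_congr_ae ?_
  filter_upwards [tensorAt_coeFn i u v, tensorAt_coeFn i u' v'] with x h1 h2
  rw [h1, h2, map_mul]
  ring

theorem tensorAt_add_left (i : Fin (n + 1)) (u u' : L2 (Space d)) (v : L2 (Config d n)) :
    tensorAt i (u + u') v = tensorAt i u v + tensorAt i u' v := by
  apply Lp.ext
  filter_upwards [tensorAt_coeFn i u v, tensorAt_coeFn i u' v, tensorAt_coeFn i (u + u') v,
    Lp.coeFn_add (tensorAt i u v) (tensorAt i u' v),
    (quasi_apply i).ae (Lp.coeFn_add u u')] with x h1 h2 h3 h4 h5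
  rw [h3, h4, Pi.add_apply, h1, h2, h5, Pi.add_apply]
  ring

theorem tensorAt_add_right (i : Fin (n + 1)) (u : L2 (Space d)) (v v' : L2 (Config d n)) :
    tensorAt i u (v + v') = tensorAt i u v + tensorAt i u v' := by
  apply Lp.ext
  filter_upwards [tensorAt_coeFn i u v, tensorAt_coeFn i u v', tensorAt_coeFn i u (v + v'),
    Lp.coeFn_add (tensorAt i u v) (tensorAt i u v'),
    (quasi_removeNth i).ae (Lp.coeFn_add v v')] with x h1 h2 h3 h4 h5
  rw [h3, h4, Pi.add_apply, h1, h2, h5, Pi.add_apply]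
  ring

theorem tensorAt_smul_left (i : Fin (n + 1)) (c : ℂ) (u : L2 (Space d)) (v : L2 (Config d n)) :
    tensorAt i (c • u) v = c • tensorAt i u v := by
  apply Lp.ext
  filter_upwards [tensorAt_coeFn i u v, tensorAt_coeFn i (c • u) v,
    Lp.coeFn_smul c (tensorAt i u v), (quasi_apply i).ae (Lp.coeFn_smul c u)] with x h1 h3 h4 h5
  rw [h3, h4, Pi.smul_apply, h1, h5, Pi.smul_apply, smul_eq_mul, smul_eq_mul]
  ring

theorem tensorAt_smul_right (i : Fin (n + 1)) (c : ℂ) (u : L2 (Space d)) (v : L2 (Config d n)) :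
    tensorAt i u (c • v) = c • tensorAt i u v := by
  apply Lp.ext
  filter_upwards [tensorAt_coeFn i u v, tensorAt_coeFn i u (c • v),
    Lp.coeFn_smul c (tensorAt i u v), (quasi_removeNth i).ae (Lp.coeFn_smul c v)]
    with x h1 h3 h4 h5
  rw [h3, h4, Pi.smul_apply, h1, h5, Pi.smul_apply, smul_eq_mul, smul_eq_mul]
  ring

theorem norm_tensorAt (i : Fin (n + 1)) (u : L2 (Space d)) (v : L2 (Config d n)) :
    ‖tensorAt i u v‖ = ‖u‖ * ‖v‖ := by
  have h := inner_tensorAt i u u v v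
  rw [inner_self_eq_norm_sq_to_K, inner_self_eq_norm_sq_to_K, inner_self_eq_norm_sq_to_K] at h
  have h' : ‖tensorAt i u v‖ ^ 2 = (‖u‖ * ‖v‖) ^ 2 := by
    rw [mul_pow]
    exact_mod_cast h
  exact (sq_eq_sq₀ (norm_nonneg _) (by positivity)).1 h'

/-- The operator `v ↦ u ⊗_i v`; up to normalization, it creates a body in the state `u`. -/
def tensorL (i : Fin (n + 1)) (u : L2 (Space d)) : L2 (Config d n) →L[ℂ] L2 (Config d (n + 1)) :=
  LinearMap.mkContinuous
    { toFun := fun v => tensorAt i u v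
      map_add' := tensorAt_add_right i u
      map_smul' := fun c v => tensorAt_smul_right i c u v } ‖u‖
    fun v => (norm_tensorAt i u v).le

/-- The operator `u ↦ u ⊗_i v`. -/
def tensorR (i : Fin (n + 1)) (v : L2 (Config d n)) : L2 (Space d) →L[ℂ] L2 (Config d (n + 1)) :=
  LinearMap.mkContinuous
    { toFun := fun u => tensorAt i u v
      map_add' := fun u u' => tensorAt_add_left i u u' v
      map_smul' := fun c u => tensorAt_smul_left i c u v } ‖v‖
    fun u => by
      rw [mul_comm]
      exact (norm_tensorAt i u v).le

theorem tensorL_apply (i : Fin (n + 1)) (u : L2 (Space d)) (v : L2 (Config d n)) :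
    tensorL i u v = tensorAt i u v := rfl

theorem tensorR_apply (i : Fin (n + 1)) (u : L2 (Space d)) (v : L2 (Config d n)) :
    tensorR i v u = tensorAt i u v := rfl

/-- The adjoint of `v ↦ u ⊗_i v`, that is `ψ ↦ ∫ conj (u(x_i)) ψ(x) dx_i`. -/
def annih (i : Fin (n + 1)) (u : L2 (Space d)) : L2 (Config d (n + 1)) →L[ℂ] L2 (Config d n) :=
  ContinuousLinearMap.adjoint (tensorL i u)

/-- The adjoint of `u ↦ u ⊗_i v`, that is the integration of `ψ` against `conj v` over all
variables except `x_i`. -/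
def contr (i : Fin (n + 1)) (v : L2 (Config d n)) : L2 (Config d (n + 1)) →L[ℂ] L2 (Space d) :=
  ContinuousLinearMap.adjoint (tensorR i v)

theorem inner_annih (i : Fin (n + 1)) (u : L2 (Space d)) (v : L2 (Config d n))
    (ψ : L2 (Config d (n + 1))) : ⟪v, annih i u ψ⟫_ℂ = ⟪tensorAt i u v, ψ⟫_ℂ :=
  ContinuousLinearMap.adjoint_inner_right _ _ _

theorem inner_contr (i : Fin (n + 1)) (u : L2 (Space d)) (v : L2 (Config d n))
    (ψ : L2 (Config d (n + 1))) : ⟪u, contr i v ψ⟫_ℂ = ⟪tensorAt i u v, ψ⟫_ℂ :=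
  ContinuousLinearMap.adjoint_inner_right _ _ _

theorem annih_tensorAt (i : Fin (n + 1)) (u u' : L2 (Space d)) (v : L2 (Config d n)) :
    annih i u (tensorAt i u' v) = ⟪u, u'⟫_ℂ • v := by
  refine ext_inner_left ℂ fun v' => ?_
  rw [inner_annih, inner_tensorAt, inner_smul_right]

theorem contr_tensorAt (i : Fin (n + 1)) (u : L2 (Space d)) (v v' : L2 (Config d n)) :
    contr i v (tensorAt i u v') = ⟪v, v'⟫_ℂ • u := by
  refine ext_inner_left ℂ fun u' => ?_
  rw [inner_contr, inner_tensorAt, inner_smul_right, mul_comm]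

/-- The functions `u ⊗_i v` are total. -/
theorem eq_zero_of_inner_tensorAt (i : Fin (n + 1)) {ψ : L2 (Config d (n + 1))}
    (h : ∀ u v, ⟪tensorAt i u v, ψ⟫_ℂ = 0) : ψ = 0 := by
  set e := MeasurableEquiv.piFinSuccAbove (fun _ : Fin (n + 1) => Space d) i with he
  have hmp := mp_removeNth (d := d) i
  have hsymm : MeasurePreserving e.symm
      ((volume : Measure (Space d)).prod (volume : Measure (Config d n))) volume := hmp.symm e
  have hf : MemLp (fun p => ψ (e.symm p)) 2
      ((volume : Measure (Space d)).prod (volume : Measure (Config d n))) :=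
    (Lp.memLp ψ).comp_measurePreserving hsymm
  have h0 := ae_eq_zero_of_forall_rect hf ?_
  · rw [Lp.eq_zero_iff_ae_eq_zero]
    have := hmp.quasiMeasurePreserving.ae h0
    filter_upwards [this] with x hx
    have e1 : e.symm (e x) = x := e.symm_apply_apply x
    simp only [Pi.zero_apply] at hx ⊢
    rw [← hx]
    exact congrArg _ e1.symm
  · intro A B hA hB hA' hB'
    have h1 := h (indicatorConstLp 2 hA hA'.ne (1 : ℂ)) (indicatorConstLp 2 hB hB'.ne (1 : ℂ))
    rw [inner_L2_def] at h1
    rw [← integral_indicator (hA.prod hB), ← h1, ← hmp.integral_comp' (g := fun p =>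
      (A ×ˢ B).indicator (fun p => ψ (e.symm p)) p)]
    refine integral_congr_ae ?_
    filter_upwards [tensorAt_coeFn i (indicatorConstLp 2 hA hA'.ne (1 : ℂ))
      (indicatorConstLp 2 hB hB'.ne (1 : ℂ)),
      (quasi_apply i).ae (indicatorConstLp_coeFn (p := 2) (hs := hA) (hμs := hA'.ne) (c := (1 : ℂ))),
      (quasi_removeNth i).ae
        (indicatorConstLp_coeFn (p := 2) (hs := hB) (hμs := hB'.ne) (c := (1 : ℂ)))]
      with x h1 h2 h3
    rw [h1, h2, h3]
    have e0 : e x = (x i, i.removeNth x) := rfl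
    have e1 : e.symm (x i, i.removeNth x) = x := e.symm_apply_apply x
    change (A ×ˢ B).indicator (fun p => ψ (e.symm p)) (e x) = _
    rw [e0]
    by_cases hxA : x i ∈ A
    · by_cases hxB : i.removeNth x ∈ B
      · rw [Set.indicator_of_mem (Set.mk_mem_prod hxA hxB), Set.indicator_of_mem hxA,
          Set.indicator_of_mem hxB, e1]
        simp
      · rw [Set.indicator_of_notMem (fun hh => hxB hh.2), Set.indicator_of_notMem hxB]
        simp
    · rw [Set.indicator_of_notMem (fun hh => hxA hh.1), Set.indicator_of_notMem hxA]
      simp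

theorem ext_contr (i : Fin (n + 1)) {ψ χ : L2 (Config d (n + 1))}
    (h : ∀ v, contr i v ψ = contr i v χ) : ψ = χ := by
  rw [← sub_eq_zero]
  refine eq_zero_of_inner_tensorAt i fun u v => ?_
  rw [← inner_contr, map_sub, h, sub_self, inner_zero_right]

theorem hilbertBasis_eq_zero {ι E : Type} [NormedAddCommGroup E] [InnerProductSpace ℂ E]
    (b : HilbertBasis ι ℂ E) {x : E} (h : ∀ k, ⟪b k, x⟫_ℂ = 0) : x = 0 := by
  refine (b.repr.map_eq_zero_iff).1 (lp.ext (funext fun k => ?_))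
  rw [b.repr_apply_apply, h]
  rfl

/-- The product of Hilbert bases of the two factors. -/
def tensorBasis (i : Fin (n + 1)) {κ ι : Type} (e : HilbertBasis κ ℂ (L2 (Config d n)))
    (f : HilbertBasis ι ℂ (L2 (Space d))) : HilbertBasis (κ × ι) ℂ (L2 (Config d (n + 1))) :=
  HilbertBasis.mkOfOrthogonalEqBot (v := fun q : κ × ι => tensorAt i (f q.2) (e q.1))
    (by
      classical
      rw [orthonormal_iff_ite]
      rintro ⟨k, j⟩ ⟨k', j'⟩
      simp only [inner_tensorAt, orthonormal_iff_ite.1 e.orthonormal,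
        orthonormal_iff_ite.1 f.orthonormal, Prod.mk.injEq]
      by_cases h1 : k = k' <;> by_cases h2 : j = j' <;> simp [h1, h2])
    (by
      rw [Submodule.eq_bot_iff]
      intro ψ hψ
      have h : ∀ k j, ⟪tensorAt i (f j) (e k), ψ⟫_ℂ = 0 := fun k j =>
        (Submodule.mem_orthogonal _ _).1 hψ _ (Submodule.subset_span ⟨(k, j), rfl⟩)
      refine eq_zero_of_inner_tensorAt i fun u v => ?_
      rw [← inner_annih]
      have : annih i u ψ = 0 := by
        refine hilbertBasis_eq_zero e fun k => ?_
        rw [inner_annih, ← inner_contr]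
        have : contr i (e k) ψ = 0 := by
          refine hilbertBasis_eq_zero f fun j => ?_
          rw [inner_contr, h]
        rw [this, inner_zero_right]
      rw [this, inner_zero_right])

theorem tensorBasis_apply (i : Fin (n + 1)) {κ ι : Type} (e : HilbertBasis κ ℂ (L2 (Config d n)))
    (f : HilbertBasis ι ℂ (L2 (Space d))) (q : κ × ι) :
    tensorBasis i e f q = tensorAt i (f q.2) (e q.1) := by
  rw [tensorBasis, HilbertBasis.coe_mkOfOrthogonalEqBot]

/-- Parseval's identity over the variables other than `x_i`. -/
theorem hasSum_inner_contr (i : Fin (n + 1)) {κ : Type} (e : HilbertBasis κ ℂ (L2 (Config d n)))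
    (ψ χ : L2 (Config d (n + 1))) :
    HasSum (fun k => ⟪contr i (e k) ψ, contr i (e k) χ⟫_ℂ) ⟪ψ, χ⟫_ℂ := by
  obtain ⟨w, f, -⟩ := exists_hilbertBasis ℂ (L2 (Space d))
  have h := (tensorBasis i e f).hasSum_inner_mul_inner ψ χ
  refine h.prod_fiberwise fun k => ?_
  have h2 := f.hasSum_inner_mul_inner (contr i (e k) ψ) (contr i (e k) χ)
  refine h2.congr_fun ?_
  intro j
  rw [tensorBasis_apply, ← inner_conj_symm ψ, ← inner_contr, ← inner_contr, inner_conj_symm]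

end Tensor

section Lift

open Filter Topology

variable {d n : ℕ}

/-! ### One-body operators acting on one of the variables -/

/-- The operator `A_i` acts fiberwise: it commutes with contractions over the other variables. -/
theorem mem_liftAt_graph (i : Fin (n + 1)) {A : L2 (Space d) →ₗ.[ℂ] L2 (Space d)}
    (hA : IsSelfAdjoint A) (p q : L2 (Config d (n + 1))) :
    (p, q) ∈ (liftAt i A).graph ↔ ∀ v, (contr i v p, contr i v q) ∈ A.graph := by
  have h1 : ∀ p q : L2 (Config d (n + 1)), (∀ (u : A.domain) (v : L2 (Config d n)),
      ⟪tensorAt i (A u) v, p⟫_ℂ = ⟪tensorAt i u v, q⟫_ℂ) ↔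
      ∀ v, (contr i v p, contr i v q) ∈ A.graph := by
    intro p q
    rw [forall_comm]
    refine forall_congr' fun v => ?_
    rw [graph_mem_iff hA]
    constructor
    · intro h x x' hx
      have hxd := LinearPMap.mem_domain_of_mem_graph hx
      have e := (LinearPMap.image_iff hxd).2 hx
      rw [inner_contr, inner_contr, e]
      exact h ⟨x, hxd⟩
    · intro h u
      rw [← inner_contr, ← inner_contr]
      exact h _ _ (A.mem_graph u)
  rw [← h1, liftAt, Submodule.toLinearPMap_graph_eq]
  · rfl
  · rintro ⟨p, q⟩ hpq (rfl : p = 0)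
    refine ext_contr i fun v => ?_
    have := (h1 _ _).1 hpq v
    rw [map_zero] at this
    rw [LinearPMap.graph_fst_eq_zero_snd _ this rfl, map_zero]

theorem tensorAt_mem_liftAt (i : Fin (n + 1)) {A : L2 (Space d) →ₗ.[ℂ] L2 (Space d)}
    (hA : IsSelfAdjoint A) {u u' : L2 (Space d)} (h : (u, u') ∈ A.graph) (v : L2 (Config d n)) :
    (tensorAt i u v, tensorAt i u' v) ∈ (liftAt i A).graph := by
  rw [mem_liftAt_graph i hA]
  intro v'
  rw [contr_tensorAt, contr_tensorAt]
  exact graph_smul _ h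

theorem isSelfAdjoint_liftAt (i : Fin (n + 1)) {A : L2 (Space d) →ₗ.[ℂ] L2 (Space d)}
    (hA : IsSelfAdjoint A) : IsSelfAdjoint (liftAt i A) := by
  refine isSelfAdjoint_of_graph_mem_iff ?_ fun y z => ?_
  · rw [Submodule.dense_iff_topologicalClosure_eq_top, Submodule.topologicalClosure_eq_top_iff,
      Submodule.eq_bot_iff]
    intro ψ hψ
    refine ext_contr i fun v => ?_
    rw [map_zero]
    have : contr i v ψ ∈ A.domainᗮ := by
      rw [Submodule.mem_orthogonal]
      intro u hu
      rw [inner_contr]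
      exact (Submodule.mem_orthogonal _ _).1 hψ _ (LinearPMap.mem_domain_of_mem_graph
        (tensorAt_mem_liftAt i hA (A.mem_graph ⟨u, hu⟩) v))
    rwa [(Submodule.topologicalClosure_eq_top_iff).1
      (Submodule.dense_iff_topologicalClosure_eq_top.1 hA.dense_domain), Submodule.mem_bot] at this
  · constructor
    · intro h x x' hx
      obtain ⟨w, e, -⟩ := exists_hilbertBasis ℂ (L2 (Config d n))
      rw [mem_liftAt_graph i hA] at h hx
      refine (hasSum_inner_contr i e x' y).unique ((hasSum_inner_contr i e x z).congr_fun ?_)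
      exact fun k => graph_symm hA (hx _) (h _)
    · intro h
      rw [mem_liftAt_graph i hA]
      intro v
      rw [graph_mem_iff hA]
      intro x x' hx
      rw [inner_contr, inner_contr]
      exact h _ _ (tensorAt_mem_liftAt i hA hx v)

theorem contr_resK (i : Fin (n + 1)) {A : L2 (Space d) →ₗ.[ℂ] L2 (Space d)}
    (hA : IsSelfAdjoint A) (v : L2 (Config d n)) (η : L2 (Config d (n + 1))) :
    contr i v (resK (liftAt i A) η) = resK A (contr i v η) := by
  have hl := isSelfAdjoint_liftAt i hA
  have h1 := (mem_liftAt_graph i hA _ _).1 (resK_resM_mem hl η) v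
  have h2 := (mem_liftAt_graph i hA _ _).1 (resM_sub_resK_mem hl η) v
  rw [map_sub] at h2
  exact (res_unique hA h1 h2).1.symm

theorem resK_liftAt_eq (i : Fin (n + 1)) {A B : L2 (Space d) →ₗ.[ℂ] L2 (Space d)}
    (hA : IsSelfAdjoint A) (hB : IsSelfAdjoint B) (h : resK A = resK B) :
    resK (liftAt i A) = resK (liftAt (n := n) i B) := by
  ext1 η
  refine ext_contr i fun v => ?_
  rw [contr_resK i hA, contr_resK i hB, h]

theorem isPositiveOp_liftAt (i : Fin (n + 1)) {A : L2 (Space d) →ₗ.[ℂ] L2 (Space d)}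
    (hA : IsPositiveOp A) : IsPositiveOp (liftAt (n := n) i A) := by
  refine isPositiveOp_of_graph (isSelfAdjoint_liftAt i hA.1) fun x y hxy => ?_
  obtain ⟨w, e, -⟩ := exists_hilbertBasis ℂ (L2 (Config d n))
  rw [mem_liftAt_graph i hA.1] at hxy
  have h := Complex.hasSum_re (hasSum_inner_contr i e x y)
  exact h.nonneg fun k => hA.nonneg (hxy _)

theorem absOp_liftAt (i : Fin (n + 1)) {A : L2 (Space d) →ₗ.[ℂ] L2 (Space d)}
    (hA : IsSelfAdjoint A) : absOp (liftAt i A) = liftAt (n := n) i (absOp A) :=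
  absOp_eq (isSelfAdjoint_liftAt i hA) (isPositiveOp_liftAt i (absOp_spec hA).1)
    (resK_liftAt_eq i (absOp_spec hA).1.1 hA (resK_absOp hA))

theorem sqrtAbs_liftAt (i : Fin (n + 1)) {A : L2 (Space d) →ₗ.[ℂ] L2 (Space d)}
    (hA : IsSelfAdjoint A) : sqrtAbs (liftAt i A) = liftAt (n := n) i (sqrtAbs A) := by
  have hS := sqrtAbs_isSelfAdjoint hA
  rw [sqrtAbs, absOp_liftAt i hA]
  refine sqrtOp_eq (isPositiveOp_liftAt i (absOp_spec hA).1)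
    (isPositiveOp_liftAt i (sqrtAbs_positive hA)) (Set.ext fun p => ?_)
  rw [mem_sqGraph_iff (isSelfAdjoint_liftAt i hS)]
  change _ ↔ (p.1, p.2) ∈ (liftAt i (absOp A)).graph
  rw [mem_liftAt_graph i (absOp_spec hA).1.1]
  simp only [mem_absOp_graph_iff hA]
  constructor
  · intro h v
    rw [← map_add, ← contr_resK i hS, h]
  · intro h
    refine ext_contr i fun v => ?_
    rw [contr_resK i hS, map_add, h]

theorem contr_sqrtAbs (i : Fin (n + 1)) {A : L2 (Space d) →ₗ.[ℂ] L2 (Space d)}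
    (hA : IsSelfAdjoint A) (v : L2 (Config d n)) {ψ ξ : L2 (Config d (n + 1))}
    (h : (ψ, ξ) ∈ (sqrtAbs (liftAt i A)).graph) :
    (contr i v ψ, contr i v ξ) ∈ (sqrtAbs A).graph := by
  rw [sqrtAbs_liftAt i hA] at h
  exact (mem_liftAt_graph i (sqrtAbs_isSelfAdjoint hA) _ _).1 h v

theorem tensorAt_mem_sqrtAbs (i : Fin (n + 1)) {A : L2 (Space d) →ₗ.[ℂ] L2 (Space d)}
    (hA : IsSelfAdjoint A) {u u' : L2 (Space d)} (h : (u, u') ∈ (sqrtAbs A).graph)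
    (v : L2 (Config d n)) :
    (tensorAt i u v, tensorAt i u' v) ∈ (sqrtAbs (liftAt i A)).graph := by
  rw [sqrtAbs_liftAt i hA]
  exact tensorAt_mem_liftAt i (sqrtAbs_isSelfAdjoint hA) h v

theorem signOp_tensorAt (i : Fin (n + 1)) {A : L2 (Space d) →ₗ.[ℂ] L2 (Space d)}
    (hA : IsSelfAdjoint A) (u : L2 (Space d)) (v : L2 (Config d n)) :
    signOp (liftAt i A) (tensorAt i u v) = tensorAt i (signOp A u) v := by
  have hl := isSelfAdjoint_liftAt (n := n) i hA
  obtain ⟨h1, h2⟩ := signOp_spec hA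
  obtain ⟨h3, h4⟩ := signOp_spec hl
  have key : signOp (liftAt i A) ∘L tensorR i v - tensorR i v ∘L signOp A = 0 := by
    refine clm_eq_zero_of_range_ker hA ?_ ?_
    · intro x x' hx
      have h5 := tensorAt_mem_liftAt i (absOp_spec hA).1.1 hx v
      rw [← absOp_liftAt i hA] at h5
      exact sub_eq_zero.2 (graph_unique (h3 _ _ h5) (tensorAt_mem_liftAt i hA (h1 _ _ hx) v))
    · intro x hx
      have h5 := tensorAt_mem_liftAt i hA hx v
      have e : tensorAt i (0 : L2 (Space d)) v = 0 := map_zero (tensorR i v)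
      rw [e] at h5
      have h6 := h4 _ h5
      change signOp (liftAt i A) (tensorAt i x v) - tensorR i v (signOp A x) = 0
      rw [h6, h2 x hx, map_zero, sub_zero]
  exact sub_eq_zero.1 (congrArg (fun T : L2 (Space d) →L[ℂ] L2 (Config d (n + 1)) => T u) key)

theorem contr_signOp (i : Fin (n + 1)) {A : L2 (Space d) →ₗ.[ℂ] L2 (Space d)}
    (hA : IsSelfAdjoint A) (v : L2 (Config d n)) (ψ : L2 (Config d (n + 1))) :
    contr i v (signOp (liftAt i A) ψ) = signOp A (contr i v ψ) := by
  refine ext_inner_left ℂ fun u => ?_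
  rw [inner_contr, ← inner_clm_symm (isSelfAdjoint_signOp (isSelfAdjoint_liftAt i hA)),
    signOp_tensorAt i hA, ← inner_contr, inner_clm_symm (isSelfAdjoint_signOp hA)]

theorem contr_mem_sqrtAbs_domain (i : Fin (n + 1)) {A : L2 (Space d) →ₗ.[ℂ] L2 (Space d)}
    (hA : IsSelfAdjoint A) (v : L2 (Config d n)) {ψ : L2 (Config d (n + 1))}
    (h : ψ ∈ (sqrtAbs (liftAt i A)).domain) : contr i v ψ ∈ (sqrtAbs A).domain :=
  LinearPMap.mem_domain_of_mem_graph (contr_sqrtAbs i hA v ((sqrtAbs _).mem_graph ⟨ψ, h⟩))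

theorem tensorAt_mem_sqrtAbs_domain (i : Fin (n + 1)) {A : L2 (Space d) →ₗ.[ℂ] L2 (Space d)}
    (hA : IsSelfAdjoint A) {u : L2 (Space d)} (h : u ∈ (sqrtAbs A).domain)
    (v : L2 (Config d n)) : tensorAt i u v ∈ (sqrtAbs (liftAt i A)).domain :=
  LinearPMap.mem_domain_of_mem_graph
    (tensorAt_mem_sqrtAbs i hA ((sqrtAbs A).mem_graph ⟨u, h⟩) v)

/-- The quadratic form of `A_i` is the sum of the forms of `A` over the fibers of a Hilbert basis of
the functions of the remaining variables. -/
theorem hasSum_opForm_liftAt (i : Fin (n + 1)) {A : L2 (Space d) →ₗ.[ℂ] L2 (Space d)}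
    (hA : IsSelfAdjoint A) {κ : Type} (e : HilbertBasis κ ℂ (L2 (Config d n)))
    (χ ψ : (sqrtAbs (liftAt i A)).domain) :
    HasSum (fun k => opForm A ⟨_, contr_mem_sqrtAbs_domain i hA (e k) χ.2⟩
      ⟨_, contr_mem_sqrtAbs_domain i hA (e k) ψ.2⟩) (opForm (liftAt i A) χ ψ) := by
  refine (hasSum_inner_contr i e _ _).congr_fun fun k => ?_
  rw [contr_signOp i hA, opForm,
    sqrtAbs_apply_eq ⟨_, contr_mem_sqrtAbs_domain i hA (e k) χ.2⟩
      (contr_sqrtAbs i hA (e k) ((sqrtAbs _).mem_graph χ)),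
    sqrtAbs_apply_eq ⟨_, contr_mem_sqrtAbs_domain i hA (e k) ψ.2⟩
      (contr_sqrtAbs i hA (e k) ((sqrtAbs _).mem_graph ψ))]

theorem opForm_liftAt_tensorAt (i : Fin (n + 1)) {A : L2 (Space d) →ₗ.[ℂ] L2 (Space d)}
    (hA : IsSelfAdjoint A) {u : L2 (Space d)} (hu : u ∈ (sqrtAbs A).domain)
    (v : L2 (Config d n)) (ψ : (sqrtAbs (liftAt i A)).domain) :
    opForm (liftAt i A) ⟨_, tensorAt_mem_sqrtAbs_domain i hA hu v⟩ ψ =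
      opForm A ⟨u, hu⟩ ⟨_, contr_mem_sqrtAbs_domain i hA v ψ.2⟩ := by
  rw [opForm, opForm,
    sqrtAbs_apply_eq ⟨_, tensorAt_mem_sqrtAbs_domain i hA hu v⟩
      (tensorAt_mem_sqrtAbs i hA ((sqrtAbs A).mem_graph ⟨u, hu⟩) v),
    sqrtAbs_apply_eq ⟨_, contr_mem_sqrtAbs_domain i hA v ψ.2⟩
      (contr_sqrtAbs i hA v ((sqrtAbs _).mem_graph ψ)), ← contr_signOp i hA, inner_contr]

theorem contr_rankOne (i : Fin (n + 1)) (a b : L2 (Space d)) (v : L2 (Config d n))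
    (ψ : L2 (Config d (n + 1))) :
    contr i v ((tensorL i a ∘L annih i b) ψ) = InnerProductSpace.rankOne ℂ a b (contr i v ψ) := by
  rw [InnerProductSpace.rankOne_apply, ContinuousLinearMap.comp_apply, tensorL_apply,
    contr_tensorAt, inner_annih, inner_contr]

theorem liftAt_add_ofBounded (i : Fin (n + 1)) {A : L2 (Space d) →ₗ.[ℂ] L2 (Space d)}
    (hA : IsSelfAdjoint A) {B : L2 (Space d) →L[ℂ] L2 (Space d)} (hB : IsSelfAdjoint B)
    {B' : L2 (Config d (n + 1)) →L[ℂ] L2 (Config d (n + 1))}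
    (h : ∀ v ψ, contr i v (B' ψ) = B (contr i v ψ)) :
    liftAt i (A + ofBounded B) = liftAt i A + ofBounded B' := by
  refine LinearPMap.eq_of_eq_graph (Submodule.ext fun p => ?_)
  obtain ⟨x, y⟩ := p
  rw [mem_add_ofBounded_graph, mem_liftAt_graph i hA,
    mem_liftAt_graph i (isSelfAdjoint_add_ofBounded hA hB)]
  refine forall_congr' fun v => ?_
  rw [mem_add_ofBounded_graph, map_sub, h]

theorem liftAt_ofBounded (i : Fin (n + 1)) {B : L2 (Space d) →L[ℂ] L2 (Space d)}
    (hB : IsSelfAdjoint B) {B' : L2 (Config d (n + 1)) →L[ℂ] L2 (Config d (n + 1))}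
    (h : ∀ v ψ, contr i v (B' ψ) = B (contr i v ψ)) :
    liftAt i (ofBounded B) = ofBounded B' := by
  refine LinearPMap.eq_of_eq_graph (Submodule.ext fun p => ?_)
  obtain ⟨x, y⟩ := p
  rw [mem_ofBounded_graph, mem_liftAt_graph i (isSelfAdjoint_ofBounded hB)]
  simp only [mem_ofBounded_graph, ← h]
  exact ⟨fun h => ext_contr i h, fun h v => by rw [h]⟩

theorem isSelfAdjoint_of_contr (i : Fin (n + 1)) {B : L2 (Space d) →L[ℂ] L2 (Space d)}
    (hB : IsSelfAdjoint B) {B' : L2 (Config d (n + 1)) →L[ℂ] L2 (Config d (n + 1))}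
    (h : ∀ v ψ, contr i v (B' ψ) = B (contr i v ψ)) : IsSelfAdjoint B' := by
  rw [ContinuousLinearMap.isSelfAdjoint_iff_isSymmetric]
  intro x y
  obtain ⟨w, e, -⟩ := exists_hilbertBasis ℂ (L2 (Config d n))
  refine (hasSum_inner_contr i e (B' x) y).unique ((hasSum_inner_contr i e x (B' y)).congr_fun ?_)
  intro k
  rw [h, h, inner_clm_symm hB]

theorem isSelfAdjoint_proj {H : Type} [NormedAddCommGroup H] [InnerProductSpace ℂ H]
    [CompleteSpace H] (φ : H) : IsSelfAdjoint (proj φ) := by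
  rw [ContinuousLinearMap.isSelfAdjoint_iff_isSymmetric]
  intro x y
  change ⟪proj φ x, y⟫_ℂ = ⟪x, proj φ y⟫_ℂ
  simp only [proj, InnerProductSpace.rankOne_apply, inner_smul_left, inner_smul_right,
    inner_conj_symm]
  ring

end Lift

section Perm

open Filter Topology

variable {d n : ℕ}

/-! ### Permutations of the variables -/

/-- The action `ψ ↦ ψ(x ∘ σ)` of a permutation of the variables. -/
def permL2 {N : ℕ} (σ : Equiv.Perm (Fin N)) : L2 (Config d N) →ₗᵢ[ℂ] L2 (Config d N) :=
  Lp.compMeasurePreservingₗᵢ ℂ (fun x : Config d N => x ∘ σ) (measurePreserving_perm σ)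

theorem permL2_coeFn {N : ℕ} (σ : Equiv.Perm (Fin N)) (ψ : L2 (Config d N)) :
    permL2 σ ψ =ᵐ[volume] fun x => ψ (x ∘ σ) :=
  Lp.coeFn_compMeasurePreserving ψ (measurePreserving_perm σ)

theorem permL2_mul {N : ℕ} (σ τ : Equiv.Perm (Fin N)) (ψ : L2 (Config d N)) :
    permL2 σ (permL2 τ ψ) = permL2 (σ * τ) ψ := by
  apply Lp.ext
  filter_upwards [permL2_coeFn σ (permL2 τ ψ), permL2_coeFn (σ * τ) ψ,
    (measurePreserving_perm (d := d) σ).quasiMeasurePreserving.ae (permL2_coeFn τ ψ)]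
    with x h1 h2 h3
  rw [h1, h2, h3]
  rfl

theorem permL2_one {N : ℕ} (ψ : L2 (Config d N)) : permL2 1 ψ = ψ := by
  apply Lp.ext
  filter_upwards [permL2_coeFn 1 ψ] with x h1
  rw [h1]
  rfl

/-- The sign of a permutation, as a complex number. -/
def sgn {N : ℕ} (σ : Equiv.Perm (Fin N)) : ℂ := ((Equiv.Perm.sign σ : ℤ) : ℂ)

theorem sgn_mul_self {N : ℕ} (σ : Equiv.Perm (Fin N)) : sgn σ * sgn σ = 1 := by
  rw [sgn, ← Int.cast_mul, Int.units_coe_mul_self, Int.cast_one]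

theorem sgn_mul {N : ℕ} (σ τ : Equiv.Perm (Fin N)) : sgn (σ * τ) = sgn σ * sgn τ := by
  rw [sgn, sgn, sgn, Equiv.Perm.sign_mul, Units.val_mul, Int.cast_mul]

theorem sgn_inv {N : ℕ} (σ : Equiv.Perm (Fin N)) : sgn σ⁻¹ = sgn σ := by
  rw [sgn, sgn, Equiv.Perm.sign_inv]

theorem conj_sgn {N : ℕ} (σ : Equiv.Perm (Fin N)) : conj (sgn σ) = sgn σ := by
  rw [sgn, map_intCast]

theorem mem_antisym_iff {N : ℕ} (ψ : L2 (Config d N)) :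
    ψ ∈ antisym d N ↔ ∀ σ, permL2 σ ψ = sgn σ • ψ := by
  refine forall_congr' fun σ => ?_
  constructor
  · intro h
    apply Lp.ext
    filter_upwards [h, permL2_coeFn σ ψ, Lp.coeFn_smul (sgn σ) ψ] with x h1 h2 h3
    rw [h2, h1, h3]
    rfl
  · intro h
    have h2 := permL2_coeFn σ ψ
    rw [h] at h2
    filter_upwards [h2, Lp.coeFn_smul (sgn σ) ψ] with x h1 h3
    rw [← h1, h3]
    rfl

theorem isClosed_antisym {N : ℕ} : IsClosed (antisym d N : Set (L2 (Config d N))) := by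
  have e : (antisym d N : Set (L2 (Config d N))) =
      ⋂ σ : Equiv.Perm (Fin N), {ψ | permL2 σ ψ = sgn σ • ψ} := by
    ext ψ
    rw [SetLike.mem_coe, mem_antisym_iff, Set.mem_iInter]
    rfl
  rw [e]
  refine isClosed_iInter fun σ => isClosed_eq (permL2 σ).continuous (continuous_const_smul _)

theorem inner_permL2_left {N : ℕ} (σ : Equiv.Perm (Fin N)) {ψ : L2 (Config d N)}
    (hψ : ψ ∈ antisym d N) (χ : L2 (Config d N)) : ⟪permL2 σ χ, ψ⟫_ℂ = sgn σ * ⟪χ, ψ⟫_ℂ := by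
  have h := (permL2 σ).inner_map_map χ ψ
  rw [(mem_antisym_iff ψ).1 hψ σ, inner_smul_right] at h
  rw [← h, ← mul_assoc, sgn_mul_self, one_mul]

theorem permL2_tensorAt_zero (i : Fin (n + 1)) (u : L2 (Space d)) (v : L2 (Config d n)) :
    permL2 i.cycleRange.symm (tensorAt 0 u v) = tensorAt i u v := by
  apply Lp.ext
  filter_upwards [permL2_coeFn i.cycleRange.symm (tensorAt 0 u v), tensorAt_coeFn i u v,
    (measurePreserving_perm (d := d) i.cycleRange.symm).quasiMeasurePreserving.ae
      (tensorAt_coeFn 0 u v)] with x h1 h2 h3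
  rw [h1, h2, h3]
  have e1 : (x ∘ i.cycleRange.symm) 0 = x i := by
    rw [Function.comp_apply, Fin.cycleRange_symm_zero]
  have e2 : (0 : Fin (n + 1)).removeNth (x ∘ i.cycleRange.symm) = i.removeNth x := by
    funext j
    simp only [Fin.removeNth, Function.comp_apply, Fin.zero_succAbove, Fin.cycleRange_symm_succ]
  rw [e1, e2]

theorem sgn_cycleRange_symm (i : Fin (n + 1)) : sgn i.cycleRange.symm = (-1) ^ (i : ℕ) := by
  have h : sgn i.cycleRange.symm = sgn i.cycleRange := sgn_inv i.cycleRange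
  rw [h, sgn, Fin.sign_cycleRange]
  push_cast
  rfl

theorem annih_antisym (i : Fin (n + 1)) (u : L2 (Space d)) {ψ : L2 (Config d (n + 1))}
    (hψ : ψ ∈ antisym d (n + 1)) : annih i u ψ = (-1 : ℂ) ^ (i : ℕ) • annih 0 u ψ := by
  refine ext_inner_left ℂ fun v => ?_
  rw [inner_annih, inner_smul_right, inner_annih, ← permL2_tensorAt_zero i,
    inner_permL2_left _ hψ, sgn_cycleRange_symm]

theorem contr_antisym (i : Fin (n + 1)) (v : L2 (Config d n)) {ψ : L2 (Config d (n + 1))}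
    (hψ : ψ ∈ antisym d (n + 1)) : contr i v ψ = (-1 : ℂ) ^ (i : ℕ) • contr 0 v ψ := by
  refine ext_inner_left ℂ fun u => ?_
  rw [inner_contr, inner_smul_right, inner_contr, ← permL2_tensorAt_zero i,
    inner_permL2_left _ hψ, sgn_cycleRange_symm]

theorem annih_mem_antisym (u : L2 (Space d)) {ψ : L2 (Config d (n + 1))}
    (hψ : ψ ∈ antisym d (n + 1)) : annih 0 u ψ ∈ antisym d n := by
  rw [mem_antisym_iff]
  intro σ
  set τ : Equiv.Perm (Fin (n + 1)) := Equiv.Perm.decomposeFin.symm (0, σ) with hτ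
  have hsgn : sgn τ = sgn σ := by
    rw [sgn, sgn, hτ, Equiv.Perm.decomposeFin.symm_sign]
    simp
  have hperm : ∀ v, permL2 τ (tensorAt 0 u v) = tensorAt 0 u (permL2 σ v) := by
    intro v
    apply Lp.ext
    filter_upwards [permL2_coeFn τ (tensorAt 0 u v), tensorAt_coeFn 0 u (permL2 σ v),
      (measurePreserving_perm (d := d) τ).quasiMeasurePreserving.ae (tensorAt_coeFn 0 u v),
      (quasi_removeNth 0).ae (permL2_coeFn σ v)] with x h1 h2 h3 h4
    rw [h1, h2, h3, h4]
    have e1 : (x ∘ τ) 0 = x 0 := by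
      rw [Function.comp_apply, hτ, Equiv.Perm.decomposeFin_symm_apply_zero]
    have e2 : (0 : Fin (n + 1)).removeNth (x ∘ τ) = (0 : Fin (n + 1)).removeNth x ∘ σ := by
      funext j
      simp only [Fin.removeNth, Function.comp_apply, Fin.zero_succAbove, hτ,
        Equiv.Perm.decomposeFin_symm_apply_succ, Equiv.swap_self, Equiv.refl_apply]
    rw [e1, e2]
  refine ext_inner_left ℂ fun w' => ?_
  obtain ⟨w, rfl⟩ : ∃ w, permL2 σ w = w' :=
    ⟨permL2 σ⁻¹ w', by rw [permL2_mul, mul_inv_cancel, permL2_one]⟩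
  rw [(permL2 σ).inner_map_map, inner_smul_right, inner_annih, inner_annih, ← hperm,
    inner_permL2_left _ hψ, hsgn, ← mul_assoc, sgn_mul_self, one_mul]

theorem inner_wedge (φ : L2 (Space d)) (χ : L2 (Config d n)) {ψ : L2 (Config d (n + 1))}
    (hψ : ψ ∈ antisym d (n + 1)) :
    ⟪wedge φ χ, ψ⟫_ℂ = (√(n + 1 : ℝ) : ℂ)⁻¹ * ((n + 1) * ⟪χ, annih 0 φ ψ⟫_ℂ) := by
  have h : ∀ i : Fin (n + 1), ⟪(-1 : ℂ) ^ (i : ℕ) • tensorAt i φ χ, ψ⟫_ℂ = ⟪χ, annih 0 φ ψ⟫_ℂ := by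
    intro i
    rw [inner_smul_left, ← inner_annih, annih_antisym i φ hψ, inner_smul_right, ← mul_assoc,
      map_pow, map_neg, map_one, ← mul_pow]
    simp
  rw [wedge, inner_smul_left, sum_inner, Finset.sum_congr rfl fun i _ => h i, Finset.sum_const,
    Finset.card_univ, Fintype.card_fin, map_inv₀, Complex.conj_ofReal, nsmul_eq_mul]
  push_cast
  rfl

/-- The wedge orthogonality condition says that `φ` is annihilated by `ψ`. -/
theorem wedgeOrthogonal_iff (φ : L2 (Space d)) {ψ : L2 (Config d (n + 1))}
    (hψ : ψ ∈ antisym d (n + 1)) : WedgeOrthogonal φ ψ ↔ annih 0 φ ψ = 0 := by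
  constructor
  · intro h
    have h1 := h _ (annih_mem_antisym φ hψ)
    rw [inner_wedge φ _ hψ] at h1
    have h2 : (√(n + 1 : ℝ) : ℂ)⁻¹ ≠ 0 :=
      inv_ne_zero (Complex.ofReal_ne_zero.2 (by positivity))
    have h3 : (n + 1 : ℂ) ≠ 0 := by exact_mod_cast n.succ_ne_zero
    exact inner_self_eq_zero.1 ((mul_eq_zero.1 ((mul_eq_zero.1 h1).resolve_left h2)).resolve_left h3)
  · intro h χ _
    rw [inner_wedge φ _ hψ, h, inner_zero_right, mul_zero, mul_zero]

/-! ### Product functions and Slater determinants -/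

/-- The product function `x ↦ ∏ i, f i (x i)`. -/
def prodVec : {N : ℕ} → (Fin N → L2 (Space d)) → L2 (Config d N)
  | 0, _ => (memLp_const (1 : ℂ) : MemLp (fun _ : Config d 0 => (1 : ℂ)) 2 volume).toLp _
  | _ + 1, f => tensorAt 0 (f 0) (prodVec fun j => f j.succ)

theorem prodVec_succ (f : Fin (n + 1) → L2 (Space d)) :
    prodVec f = tensorAt 0 (f 0) (prodVec fun j => f j.succ) := rfl

theorem prodVec_coeFn {N : ℕ} (f : Fin N → L2 (Space d)) :
    prodVec f =ᵐ[volume] fun x => ∏ i, f i (x i) := by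
  induction N with
  | zero =>
    filter_upwards [MemLp.coeFn_toLp
      (memLp_const (1 : ℂ) : MemLp (fun _ : Config d 0 => (1 : ℂ)) 2 volume)] with x hx
    rw [Finset.univ_eq_empty, Finset.prod_empty]
    exact hx
  | succ n ih =>
    filter_upwards [tensorAt_coeFn 0 (f 0) (prodVec fun j => f j.succ),
      (quasi_removeNth 0).ae (ih fun j => f j.succ)] with x h1 h2
    rw [prodVec_succ, h1, h2, Fin.prod_univ_succ]
    rfl

theorem prodVec_eq_tensorAt (i : Fin (n + 1)) (f : Fin (n + 1) → L2 (Space d)) :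
    prodVec f = tensorAt i (f i) (prodVec (i.removeNth f)) := by
  apply Lp.ext
  filter_upwards [prodVec_coeFn f, tensorAt_coeFn i (f i) (prodVec (i.removeNth f)),
    (quasi_removeNth i).ae (prodVec_coeFn (i.removeNth f))] with x h1 h2 h3
  rw [h1, h2, h3, Fin.prod_univ_succAbove _ i]
  rfl

theorem volume_config_zero : (volume : Measure (Config d 0)).real Set.univ = 1 := by
  rw [Measure.volume_pi_eq_dirac default]
  simp

theorem inner_prodVec {N : ℕ} (f g : Fin N → L2 (Space d)) :
    ⟪prodVec f, prodVec g⟫_ℂ = ∏ i, ⟪f i, g i⟫_ℂ := by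
  induction N with
  | zero =>
    rw [inner_L2_def, Finset.univ_eq_empty, Finset.prod_empty]
    have : ∫ x : Config d 0, conj (prodVec f x) * prodVec g x = ∫ x : Config d 0, (1 : ℂ) := by
      refine integral_congr_ae ?_
      filter_upwards [prodVec_coeFn f, prodVec_coeFn g] with x h1 h2
      rw [h1, h2]
      simp
    rw [this, integral_const, volume_config_zero, one_smul]
  | succ n ih => rw [prodVec_succ, prodVec_succ, inner_tensorAt, ih, Fin.prod_univ_succ]

theorem permL2_prodVec {N : ℕ} (σ : Equiv.Perm (Fin N)) (f : Fin N → L2 (Space d)) :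
    permL2 σ (prodVec f) = prodVec (f ∘ σ.symm) := by
  apply Lp.ext
  filter_upwards [permL2_coeFn σ (prodVec f), prodVec_coeFn (f ∘ σ.symm),
    (measurePreserving_perm (d := d) σ).quasiMeasurePreserving.ae (prodVec_coeFn f)] with x h1 h2 h3
  rw [h1, h2, h3, ← Equiv.prod_comp σ (fun j => (f ∘ σ.symm) j (x j))]
  simp only [Function.comp_apply, Equiv.symm_apply_apply]

theorem inner_prodVec_comp {N : ℕ} (σ : Equiv.Perm (Fin N)) (f : Fin N → L2 (Space d))
    {ψ : L2 (Config d N)} (hψ : ψ ∈ antisym d N) :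
    ⟪prodVec (f ∘ σ), ψ⟫_ℂ = sgn σ * ⟪prodVec f, ψ⟫_ℂ := by
  have := permL2_prodVec σ.symm f
  rw [Equiv.symm_symm] at this
  rw [← this, inner_permL2_left _ hψ]
  congr 1
  exact sgn_inv σ

theorem inner_prodVec_eq_zero {N : ℕ} {f : Fin N → L2 (Space d)} (hf : ¬ Function.Injective f)
    {ψ : L2 (Config d N)} (hψ : ψ ∈ antisym d N) : ⟪prodVec f, ψ⟫_ℂ = 0 := by
  simp only [Function.Injective, not_forall] at hf
  obtain ⟨i, j, hij, hne⟩ := hf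
  have h := inner_prodVec_comp (Equiv.swap i j) f hψ
  have e : f ∘ Equiv.swap i j = f := by
    funext k
    rw [Function.comp_apply]
    rcases eq_or_ne k i with rfl | hki
    · rw [Equiv.swap_apply_left, hij]
    · rcases eq_or_ne k j with rfl | hkj
      · rw [Equiv.swap_apply_right, hij]
      · rw [Equiv.swap_apply_of_ne_of_ne hki hkj]
  have e2 : sgn (Equiv.swap i j) = -1 := by
    rw [sgn, Equiv.Perm.sign_swap hne]; simp
  rw [e, e2] at h
  linear_combination h / 2

theorem eq_zero_of_inner_prodVec {N : ℕ} {ι : Type} (u : HilbertBasis ι ℂ (L2 (Space d)))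
    {ψ : L2 (Config d N)} (h : ∀ α : Fin N → ι, ⟪prodVec (u ∘ α), ψ⟫_ℂ = 0) : ψ = 0 := by
  induction N with
  | zero =>
    have h0 := h Fin.elim0
    rw [inner_L2_def] at h0
    have : ∫ x : Config d 0, conj (prodVec (u ∘ Fin.elim0) x) * ψ x = ∫ x : Config d 0, ψ x := by
      refine integral_congr_ae ?_
      filter_upwards [prodVec_coeFn (u ∘ Fin.elim0)] with x h1
      rw [h1]
      simp
    rw [this, integral_unique, volume_config_zero, one_smul] at h0
    rw [Lp.eq_zero_iff_ae_eq_zero]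
    refine Eventually.of_forall fun x => ?_
    exact (congrArg (ψ : Config d 0 → ℂ) (Subsingleton.elim _ _)).trans h0
  | succ n ih =>
    refine eq_zero_of_inner_tensorAt 0 fun a b => ?_
    rw [← inner_contr]
    have : contr 0 b ψ = 0 := by
      refine hilbertBasis_eq_zero u fun k => ?_
      rw [inner_contr, ← inner_annih]
      have h2 : annih 0 (u k) ψ = 0 := by
        refine ih fun α => ?_
        rw [inner_annih]
        exact h (Fin.cons k α)
      rw [h2, inner_zero_right]
    rw [this, inner_zero_right]

/-- The Hilbert basis of product functions. -/
def prodBasis (N : ℕ) {ι : Type} (u : HilbertBasis ι ℂ (L2 (Space d))) :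
    HilbertBasis (Fin N → ι) ℂ (L2 (Config d N)) :=
  HilbertBasis.mkOfOrthogonalEqBot (v := fun α : Fin N → ι => prodVec (u ∘ α))
    (by
      classical
      rw [orthonormal_iff_ite]
      intro α β
      rw [inner_prodVec]
      split_ifs with h
      · rw [h]
        refine Finset.prod_eq_one fun i _ => ?_
        exact (orthonormal_iff_ite.1 u.orthonormal _ _).trans (if_pos rfl)
      · obtain ⟨i, hi⟩ := Function.ne_iff.1 h
        refine Finset.prod_eq_zero (Finset.mem_univ i) ?_
        exact (orthonormal_iff_ite.1 u.orthonormal _ _).trans (if_neg hi))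
    (by
      rw [Submodule.eq_bot_iff]
      intro ψ hψ
      refine eq_zero_of_inner_prodVec u fun α => ?_
      exact (Submodule.mem_orthogonal _ _).1 hψ _ (Submodule.subset_span ⟨α, rfl⟩))

theorem prodBasis_apply {N : ℕ} {ι : Type} (u : HilbertBasis ι ℂ (L2 (Space d))) (α : Fin N → ι) :
    prodBasis N u α = prodVec (u ∘ α) := by
  rw [prodBasis, HilbertBasis.coe_mkOfOrthogonalEqBot]

theorem hasSum_norm_sq {ι E : Type} [NormedAddCommGroup E] [InnerProductSpace ℂ E]
    (b : HilbertBasis ι ℂ E) (x : E) : HasSum (fun k => ‖⟪b k, x⟫_ℂ‖ ^ 2) (‖x‖ ^ 2) := by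
  have h := Complex.hasSum_re (b.hasSum_inner_mul_inner x x)
  have e := inner_self_eq_norm_sq (𝕜 := ℂ) x
  simp only [RCLike.re_to_complex] at e
  rw [e] at h
  refine h.congr_fun fun k => ?_
  rw [← inner_conj_symm x, ← Complex.normSq_eq_conj_mul_self, Complex.ofReal_re,
    Complex.normSq_eq_norm_sq]

theorem inner_prodVec_orthonormal {N : ℕ} {f : Fin N → L2 (Space d)} (hf : Orthonormal ℂ f)
    (σ τ : Equiv.Perm (Fin N)) :
    ⟪prodVec (f ∘ σ), prodVec (f ∘ τ)⟫_ℂ = if σ = τ then 1 else 0 := by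
  rw [inner_prodVec]
  split_ifs with h
  · rw [h]
    exact Finset.prod_eq_one fun i _ => (orthonormal_iff_ite.1 hf _ _).trans (if_pos rfl)
  · obtain ⟨i, hi⟩ := not_forall.1 (mt Equiv.ext h)
    exact Finset.prod_eq_zero (Finset.mem_univ i)
      ((orthonormal_iff_ite.1 hf _ _).trans (if_neg hi))

/-- The Slater determinant `(N!)^{-1/2} det (f_i(x_j))`. -/
def slater {N : ℕ} (f : Fin N → L2 (Space d)) : L2 (Config d N) :=
  (√(N.factorial : ℝ) : ℂ)⁻¹ • ∑ σ : Equiv.Perm (Fin N), sgn σ • prodVec (f ∘ σ)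

theorem slater_coeFn {N : ℕ} (f : Fin N → L2 (Space d)) :
    slater f =ᵐ[volume] fun x => (√(N.factorial : ℝ) : ℂ)⁻¹ *
      (Matrix.of fun i j => f i (x j)).det := by
  have h : ∀ᵐ x : Config d N, ∀ σ : Equiv.Perm (Fin N),
      (sgn σ • prodVec (f ∘ σ)) x = sgn σ * ∏ i, f (σ i) (x i) := by
    rw [ae_all_iff]
    intro σ
    filter_upwards [Lp.coeFn_smul (sgn σ) (prodVec (f ∘ σ)), prodVec_coeFn (f ∘ σ)] with x h1 h2
    rw [h1, Pi.smul_apply, h2]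
    rfl
  filter_upwards [h, Lp.coeFn_smul (√(N.factorial : ℝ) : ℂ)⁻¹
    (∑ σ : Equiv.Perm (Fin N), sgn σ • prodVec (f ∘ σ)),
    Lp.coeFn_finsetSum Finset.univ
      (fun σ : Equiv.Perm (Fin N) => sgn σ • prodVec (f ∘ σ))] with x h1 h2 h3
  rw [slater, h2, Pi.smul_apply, h3, Finset.sum_apply, Matrix.det_apply', smul_eq_mul]
  congr 1
  exact Finset.sum_congr rfl fun σ _ => h1 σ

theorem slater_mem_antisym {N : ℕ} (f : Fin N → L2 (Space d)) : slater f ∈ antisym d N := by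
  rw [mem_antisym_iff]
  intro τ
  rw [slater, map_smul, map_sum, smul_comm]
  congr 1
  rw [Finset.smul_sum, ← Equiv.sum_comp (Equiv.mulRight τ⁻¹)
    (fun σ : Equiv.Perm (Fin N) => sgn τ • sgn σ • prodVec (f ∘ σ))]
  refine Finset.sum_congr rfl fun σ _ => ?_
  rw [map_smul, permL2_prodVec, smul_smul, Equiv.coe_mulRight, sgn_mul, sgn_inv, mul_comm (sgn σ),
    ← mul_assoc, sgn_mul_self, one_mul]
  rfl

theorem inner_slater {N : ℕ} (f : Fin N → L2 (Space d)) {ψ : L2 (Config d N)}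
    (hψ : ψ ∈ antisym d N) :
    ⟪slater f, ψ⟫_ℂ = (√(N.factorial : ℝ) : ℂ) * ⟪prodVec f, ψ⟫_ℂ := by
  have h : ∀ σ : Equiv.Perm (Fin N), ⟪sgn σ • prodVec (f ∘ σ), ψ⟫_ℂ = ⟪prodVec f, ψ⟫_ℂ := by
    intro σ
    rw [inner_smul_left, inner_prodVec_comp σ f hψ, conj_sgn, ← mul_assoc, sgn_mul_self, one_mul]
  rw [slater, inner_smul_left, sum_inner, Finset.sum_congr rfl fun σ _ => h σ, Finset.sum_const,
    Finset.card_univ, Fintype.card_perm, Fintype.card_fin, map_inv₀, Complex.conj_ofReal,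
    nsmul_eq_mul, ← mul_assoc]
  congr 1
  have h1 : (√(N.factorial : ℝ) : ℂ) ≠ 0 :=
    Complex.ofReal_ne_zero.2 (by positivity)
  rw [inv_mul_eq_iff_eq_mul₀ h1, ← Complex.ofReal_mul, Real.mul_self_sqrt (by positivity)]
  simp

theorem inner_prodVec_slater {N : ℕ} {f : Fin N → L2 (Space d)} (hf : Orthonormal ℂ f) :
    ⟪prodVec f, slater f⟫_ℂ = (√(N.factorial : ℝ) : ℂ)⁻¹ := by
  rw [slater, inner_smul_right, inner_sum, Finset.sum_eq_single 1]
  · rw [inner_smul_right]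
    have := inner_prodVec_orthonormal hf 1 1
    rw [if_pos rfl] at this
    have e : f ∘ (1 : Equiv.Perm (Fin N)) = f := rfl
    rw [e] at this ⊢
    rw [this]
    simp [sgn]
  · intro σ _ hσ
    have := inner_prodVec_orthonormal hf 1 σ
    rw [if_neg (Ne.symm hσ)] at this
    have e : f ∘ (1 : Equiv.Perm (Fin N)) = f := rfl
    rw [e] at this
    rw [inner_smul_right, this, mul_zero]
  · simp

theorem norm_slater {N : ℕ} {f : Fin N → L2 (Space d)} (hf : Orthonormal ℂ f) :
    ‖slater f‖ = 1 := by
  have h := inner_slater f (slater_mem_antisym f)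
  have h1 : (√(N.factorial : ℝ) : ℂ) ≠ 0 :=
    Complex.ofReal_ne_zero.2 (by positivity)
  rw [inner_prodVec_slater hf, mul_inv_cancel₀ h1] at h
  have h2 := inner_self_eq_norm_sq (𝕜 := ℂ) (slater f)
  rw [h, RCLike.one_re] at h2
  exact (pow_eq_one_iff_of_nonneg (norm_nonneg _) two_ne_zero).1 h2.symm

end Perm

/-! ### Weak derivatives -/

section WeakDeriv

open Filter Topology

variable {X : Type} [NormedAddCommGroup X] [NormedSpace ℝ X] [MeasureSpace X] [BorelSpace X]
  [IsLocallyFiniteMeasure (volume : Measure X)]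

/-- Real smooth test functions with compact support. -/
def Test (X : Type) [NormedAddCommGroup X] [NormedSpace ℝ X] : Type :=
  {θ : X → ℝ // ContDiff ℝ ∞ θ ∧ HasCompactSupport θ}

/-- The derivative of a test function in the direction `m`. -/
def Test.deriv (m : X) (θ : Test X) : Test X :=
  ⟨fun x => fderiv ℝ θ.1 x m, (θ.2.1.fderiv_right (by simp)).clm_apply contDiff_const,
    θ.2.2.fderiv_apply ℝ m⟩

theorem Test.memLp (θ : Test X) : MemLp (fun x => (θ.1 x : ℂ)) 2 (volume : Measure X) := by
  have h : MemLp θ.1 2 (volume : Measure X) :=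
    θ.2.1.continuous.memLp_of_hasCompactSupport θ.2.2
  exact h.ofReal

/-- A test function as an element of `L²`. -/
def testL2 (θ : Test X) : L2 X := θ.memLp.toLp _

theorem testL2_coeFn (θ : Test X) : testL2 θ =ᵐ[volume] fun x => (θ.1 x : ℂ) :=
  MemLp.coeFn_toLp _

theorem inner_testL2 (θ : Test X) (f : L2 X) : ⟪testL2 θ, f⟫_ℂ = ∫ x, θ.1 x • f x := by
  rw [inner_L2_def]
  refine integral_congr_ae ?_
  filter_upwards [testL2_coeFn θ] with x hx
  rw [hx, Complex.conj_ofReal, Complex.real_smul]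

theorem mem_weakDerivGraph_iff (m : X) (p : L2 X × L2 X) :
    p ∈ weakDerivGraph m ↔ ∀ θ : Test X, ⟪testL2 (θ.deriv m), p.1⟫_ℂ = -⟪testL2 θ, p.2⟫_ℂ := by
  simp only [inner_testL2]
  exact ⟨fun h θ => h θ.1 θ.2.1 θ.2.2, fun h θ h1 h2 => h ⟨θ, h1, h2⟩⟩

theorem isClosed_weakDerivGraph (m : X) :
    IsClosed (weakDerivGraph m : Set (L2 X × L2 X)) := by
  have h : (weakDerivGraph m : Set (L2 X × L2 X)) =
      ⋂ θ : Test X, {p | ⟪testL2 (θ.deriv m), p.1⟫_ℂ = -⟪testL2 θ, p.2⟫_ℂ} := by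
    ext p
    rw [Set.mem_iInter]
    exact mem_weakDerivGraph_iff m p
  rw [h]
  refine isClosed_iInter fun θ => isClosed_eq (by fun_prop) (by fun_prop)

variable [FiniteDimensional ℝ X]

/-- The fundamental lemma of the calculus of variations. -/
theorem eq_zero_of_inner_testL2 {f : L2 X} (h : ∀ θ : Test X, ⟪testL2 θ, f⟫_ℂ = 0) : f = 0 := by
  apply Lp.ext
  have h1 := ae_eq_zero_of_integral_contDiff_smul_eq_zero
    ((Lp.memLp f).locallyIntegrable (by norm_num)) (fun g hg hc =>
      (inner_testL2 (⟨g, hg, hc⟩ : Test X) f).symm.trans (h ⟨g, hg, hc⟩))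
  filter_upwards [h1, Lp.coeFn_zero ℂ 2 (volume : Measure X)] with x hx hx'
  rw [hx, hx']
  rfl

theorem mem_weakDeriv_graph {m : X} {p : L2 X × L2 X} :
    p ∈ (weakDeriv m).graph ↔ p ∈ weakDerivGraph m := by
  rw [weakDeriv, Submodule.toLinearPMap_graph_eq]
  intro q hq hq0
  refine eq_zero_of_inner_testL2 fun θ => ?_
  have h := (mem_weakDerivGraph_iff m q).1 hq θ
  rw [hq0, inner_zero_right] at h
  exact neg_eq_zero.1 h.symm

theorem mem_H1_iff {f : L2 X} : f ∈ H1 X ↔ ∀ m : X, ∃ g, (f, g) ∈ weakDerivGraph m := by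
  rw [H1, Submodule.mem_iInf]
  refine forall_congr' fun m => ?_
  rw [LinearPMap.mem_domain_iff]
  simp only [mem_weakDeriv_graph]

theorem derivH1_mem (m : X) (f : H1 X) : ((f : L2 X), derivH1 m f) ∈ weakDerivGraph m :=
  mem_weakDeriv_graph.1 (LinearPMap.mem_graph (weakDeriv m) ⟨f, (Submodule.mem_iInf _).1 f.2 m⟩)

theorem derivH1_eq {m : X} {f : H1 X} {g : L2 X} (h : ((f : L2 X), g) ∈ weakDerivGraph m) :
    derivH1 m f = g :=
  graph_unique (mem_weakDeriv_graph.2 (derivH1_mem m f)) (mem_weakDeriv_graph.2 h)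

theorem derivH1_add (m : X) (f g : H1 X) : derivH1 m (f + g) = derivH1 m f + derivH1 m g :=
  derivH1_eq ((weakDerivGraph m).add_mem (derivH1_mem m f) (derivH1_mem m g))

theorem derivH1_smul (m : X) (c : ℂ) (f : H1 X) : derivH1 m (c • f) = c • derivH1 m f :=
  derivH1_eq ((weakDerivGraph m).smul_mem c (derivH1_mem m f))

/-- It suffices to have weak derivatives in `L²` along a spanning set of directions. -/
theorem mem_H1_of_span {f : L2 X} {s : Set X} (hs : Submodule.span ℝ s = ⊤)
    (h : ∀ m ∈ s, ∃ g, (f, g) ∈ weakDerivGraph m) : f ∈ H1 X := by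
  rw [mem_H1_iff]
  intro m
  have hm : m ∈ Submodule.span ℝ s := hs ▸ Submodule.mem_top
  induction hm using Submodule.span_induction with
  | mem m hm => exact h m hm
  | zero =>
    refine ⟨0, ?_⟩
    rw [mem_weakDerivGraph_iff]
    intro θ
    rw [inner_testL2]
    simp [Test.deriv]
  | add m m' _ _ h1 h2 =>
    obtain ⟨g, hg⟩ := h1
    obtain ⟨g', hg'⟩ := h2
    refine ⟨g + g', ?_⟩
    rw [mem_weakDerivGraph_iff] at *
    intro θ
    have h3 : testL2 (θ.deriv (m + m')) = testL2 (θ.deriv m) + testL2 (θ.deriv m') := by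
      apply Lp.ext
      filter_upwards [testL2_coeFn (θ.deriv (m + m')), testL2_coeFn (θ.deriv m),
        testL2_coeFn (θ.deriv m'), Lp.coeFn_add (testL2 (θ.deriv m)) (testL2 (θ.deriv m'))]
        with x h1 h2 h3 h4
      rw [h1, h4, Pi.add_apply, h2, h3]
      simp [Test.deriv]
    have h4 := hg θ
    have h5 := hg' θ
    simp only at h4 h5 ⊢
    rw [h3, inner_add_left, inner_add_right, h4, h5]
    ring
  | smul c m _ h1 =>
    obtain ⟨g, hg⟩ := h1
    refine ⟨(c : ℂ) • g, ?_⟩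
    rw [mem_weakDerivGraph_iff] at *
    intro θ
    have h3 : testL2 (θ.deriv (c • m)) = (c : ℂ) • testL2 (θ.deriv m) := by
      apply Lp.ext
      filter_upwards [testL2_coeFn (θ.deriv (c • m)), testL2_coeFn (θ.deriv m),
        Lp.coeFn_smul (c : ℂ) (testL2 (θ.deriv m))] with x h1 h2 h3
      rw [h1, h3, Pi.smul_apply, h2]
      simp [Test.deriv]
    have h4 := hg θ
    simp only at h4 ⊢
    rw [h3, inner_smul_left, inner_smul_right, h4, Complex.conj_ofReal]
    ring

theorem testL2_mem_weakDerivGraph [(volume : Measure X).IsAddHaarMeasure] (m : X) (η : Test X) :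
    (testL2 η, testL2 (η.deriv m)) ∈ weakDerivGraph m := by
  rw [mem_weakDerivGraph_iff]
  intro θ
  have hi : ∀ a b : Test X, Integrable (fun x => a.1 x * b.1 x) := fun a b =>
    (a.2.1.continuous.mul b.2.1.continuous).integrable_of_hasCompactSupport a.2.2.mul_right
  have h : ∀ a b : Test X, ⟪testL2 a, testL2 b⟫_ℂ = ((∫ x, a.1 x * b.1 x : ℝ) : ℂ) := by
    intro a b
    rw [inner_testL2, ← integral_complex_ofReal]
    refine integral_congr_ae ?_
    filter_upwards [testL2_coeFn b] with x hx
    rw [hx, Complex.real_smul, Complex.ofReal_mul]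
  simp only [h]
  rw [← Complex.ofReal_neg, Complex.ofReal_inj, eq_neg_iff_add_eq_zero, ← eq_neg_iff_add_eq_zero.1
    (integral_mul_fderiv_eq_neg_fderiv_mul_of_integrable (v := m) (hi (θ.deriv m) η)
      (hi θ (η.deriv m)) (hi θ η) (fun x _ => (θ.2.1.differentiable (by simp)) x)
      (fun x _ => (η.2.1.differentiable (by simp)) x)), add_comm]
  rfl

theorem testL2_mem_H1 [(volume : Measure X).IsAddHaarMeasure] (η : Test X) : testL2 η ∈ H1 X :=
  mem_H1_iff.2 fun m => ⟨_, testL2_mem_weakDerivGraph m η⟩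

end WeakDeriv

/-! ### Derivatives in the configuration space -/

section ConfigDeriv

open Filter Topology

variable {d n : ℕ}

theorem span_single_space : Submodule.span ℝ
    (Set.range fun a : Fin d => EuclideanSpace.single a (1 : ℝ)) = ⊤ := by
  have h := (EuclideanSpace.basisFun (Fin d) ℝ).toBasis.span_eq
  rw [← h]
  congr 2
  ext a
  simp

theorem span_dir : Submodule.span ℝ
    (Set.range fun q : Fin (n + 1) × Fin d => dir q.1 q.2) = ⊤ := by
  rw [eq_top_iff]
  intro x _
  have hx : x = ∑ i, LinearMap.single ℝ (fun _ : Fin (n + 1) => Space d) i (x i) := by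
    exact (Finset.univ_sum_single x).symm
  rw [hx]
  refine Submodule.sum_mem _ fun i _ => ?_
  have hxi : x i ∈ Submodule.span ℝ
      (Set.range fun a : Fin d => EuclideanSpace.single a (1 : ℝ)) :=
    span_single_space ▸ Submodule.mem_top
  have h := Submodule.mem_map_of_mem
    (f := LinearMap.single ℝ (fun _ : Fin (n + 1) => Space d) i) hxi
  rw [Submodule.map_span] at h
  refine Submodule.span_mono ?_ h
  rintro _ ⟨_, ⟨a, rfl⟩, rfl⟩
  exact ⟨(i, a), rfl⟩

theorem mem_H1_space {u : L2 (Space d)}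
    (h : ∀ a : Fin d, ∃ g, (u, g) ∈ weakDerivGraph (EuclideanSpace.single a (1 : ℝ))) :
    u ∈ H1 (Space d) :=
  mem_H1_of_span span_single_space (by rintro _ ⟨a, rfl⟩; exact h a)

theorem mem_H1_config {ψ : L2 (Config d (n + 1))}
    (h : ∀ i (a : Fin d), ∃ g, (ψ, g) ∈ weakDerivGraph (dir i a)) :
    ψ ∈ H1 (Config d (n + 1)) :=
  mem_H1_of_span span_dir (by rintro _ ⟨⟨i, a⟩, rfl⟩; exact h i a)

theorem contDiff_removeNth (i : Fin (n + 1)) :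
    ContDiff ℝ ∞ (fun x : Config d (n + 1) => (i.removeNth x : Config d n)) :=
  contDiff_pi.2 fun j => contDiff_apply ℝ (Space d) (i.succAbove j)

/-- The tensor product of two test functions. -/
def Test.tensor (i : Fin (n + 1)) (θ : Test (Space d)) (η : Test (Config d n)) :
    Test (Config d (n + 1)) :=
  ⟨fun x => θ.1 (x i) * η.1 (i.removeNth x),
    (θ.2.1.comp (contDiff_apply ℝ (Space d) i)).mul (η.2.1.comp (contDiff_removeNth i)),
    HasCompactSupport.intro (K := (fun p : Space d × Config d n =>
      (i.insertNth p.1 p.2 : Config d (n + 1))) '' (tsupport θ.1 ×ˢ tsupport η.1))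
      ((θ.2.2.isCompact.prod η.2.2.isCompact).image
        (Continuous.finInsertNth i continuous_fst continuous_snd)) (by
        intro x hx
        by_contra h
        refine hx ⟨(x i, i.removeNth x), ⟨subset_tsupport _ (left_ne_zero_of_mul h),
          subset_tsupport _ (right_ne_zero_of_mul h)⟩, ?_⟩
        simp)⟩

theorem testL2_tensor (i : Fin (n + 1)) (θ : Test (Space d)) (η : Test (Config d n)) :
    testL2 (θ.tensor i η) = tensorAt i (testL2 θ) (testL2 η) := by
  apply Lp.ext
  filter_upwards [testL2_coeFn (θ.tensor i η), tensorAt_coeFn i (testL2 θ) (testL2 η),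
    (quasi_apply i).ae (testL2_coeFn θ), (quasi_removeNth i).ae (testL2_coeFn η)] with x h1 h2 h3 h4
  rw [h1, h2, h3, h4, ← Complex.ofReal_mul]
  rfl

theorem deriv_tensor (i : Fin (n + 1)) (a : Fin d) (θ : Test (Space d)) (η : Test (Config d n)) :
    (θ.tensor i η).deriv (dir i a) = (θ.deriv (EuclideanSpace.single a (1 : ℝ))).tensor i η := by
  apply Subtype.ext
  funext x
  have h1 : HasFDerivAt (fun x : Config d (n + 1) => θ.1 (x i))
      ((fderiv ℝ θ.1 (x i)).comp (ContinuousLinearMap.proj i)) x :=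
    ((θ.2.1.differentiable (by simp)) (x i)).hasFDerivAt.comp x
      (ContinuousLinearMap.proj (R := ℝ) (φ := fun _ : Fin (n + 1) => Space d) i).hasFDerivAt
  have h2 : HasFDerivAt (fun x : Config d (n + 1) => η.1 (i.removeNth x))
      ((fderiv ℝ η.1 (i.removeNth x)).comp (ContinuousLinearMap.pi fun j =>
        ContinuousLinearMap.proj (R := ℝ) (φ := fun _ : Fin (n + 1) => Space d)
          (i.succAbove j))) x :=
    ((η.2.1.differentiable (by simp)) (i.removeNth x)).hasFDerivAt.comp x
      (ContinuousLinearMap.pi fun j =>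
        ContinuousLinearMap.proj (R := ℝ) (φ := fun _ : Fin (n + 1) => Space d)
          (i.succAbove j)).hasFDerivAt
  have h3 : (ContinuousLinearMap.pi fun j =>
        ContinuousLinearMap.proj (R := ℝ) (φ := fun _ : Fin (n + 1) => Space d)
          (i.succAbove j)) (dir i a) = (0 : Config d n) := by
    funext j
    simp [dir]
  change fderiv ℝ (fun x : Config d (n + 1) => θ.1 (x i) * η.1 (i.removeNth x)) x (dir i a) =
    fderiv ℝ θ.1 (x i) _ * η.1 (i.removeNth x)
  rw [(h1.fun_mul h2).fderiv]
  simp only [_root_.add_apply, _root_.smul_apply,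
    ContinuousLinearMap.comp_apply, h3, map_zero, smul_eq_mul]
  simp [dir, mul_comm]

/-- Contraction against a function of the other variables commutes with weak derivatives. -/
theorem contr_mem_weakDerivGraph (i : Fin (n + 1)) (a : Fin d) {ψ ξ : L2 (Config d (n + 1))}
    (h : (ψ, ξ) ∈ weakDerivGraph (dir i a)) (v : L2 (Config d n)) :
    (contr i v ψ, contr i v ξ) ∈ weakDerivGraph (EuclideanSpace.single a (1 : ℝ)) := by
  rw [mem_weakDerivGraph_iff] at *
  intro θ
  have hx : annih i (testL2 (θ.deriv (EuclideanSpace.single a (1 : ℝ)))) ψ +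
      annih i (testL2 θ) ξ = 0 := by
    refine eq_zero_of_inner_testL2 fun η => ?_
    have h1 := h (θ.tensor i η)
    rw [deriv_tensor, testL2_tensor, testL2_tensor] at h1
    rw [inner_add_right, inner_annih, inner_annih, h1, neg_add_cancel]
  simp only
  rw [inner_contr, inner_contr, ← inner_annih, ← inner_annih, eq_neg_iff_add_eq_zero,
    ← inner_add_right, hx, inner_zero_right]

/-- The restriction of a test function to the variable `x_i`. -/
def Test.slice (i : Fin (n + 1)) (y : Config d n) (Θ : Test (Config d (n + 1))) :
    Test (Space d) :=
  ⟨fun x => Θ.1 (i.insertNth x y : Config d (n + 1)), by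
    refine Θ.2.1.comp ?_
    have h : (fun x : Space d => (i.insertNth x y : Config d (n + 1))) =
        Function.update (i.insertNth 0 y : Config d (n + 1)) i := by
      funext x
      rw [Fin.update_insertNth]
    rw [h]
    exact contDiff_update _ _ _,
    HasCompactSupport.intro (K := (fun x : Config d (n + 1) => x i) '' tsupport Θ.1)
      (Θ.2.2.isCompact.image (continuous_apply i)) (by
        intro x hx
        by_contra h
        exact hx ⟨_, subset_tsupport _ h, by simp⟩)⟩

theorem slice_deriv (i : Fin (n + 1)) (a : Fin d) (y : Config d n) (Θ : Test (Config d (n + 1))) :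
    (Θ.deriv (dir i a)).slice i y = (Θ.slice i y).deriv (EuclideanSpace.single a (1 : ℝ)) := by
  apply Subtype.ext
  funext x
  have h : (fun x : Space d => (i.insertNth x y : Config d (n + 1))) =
      Function.update (i.insertNth 0 y : Config d (n + 1)) i := by
    funext x
    rw [Fin.update_insertNth]
  have h1 : HasFDerivAt (fun x : Space d => (i.insertNth x y : Config d (n + 1)))
      (.pi (Pi.single i (.id ℝ (Space d)))) x := by
    rw [h]
    exact hasFDerivAt_update _ _
  have h2 := ((Θ.2.1.differentiable (by simp)) (i.insertNth x y)).hasFDerivAt.comp x h1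
  change fderiv ℝ Θ.1 (i.insertNth x y) (dir i a) =
    fderiv ℝ (Θ.1 ∘ fun x : Space d => (i.insertNth x y : Config d (n + 1))) x _
  rw [h2.fderiv, ContinuousLinearMap.comp_apply]
  congr 1
  funext j
  rcases eq_or_ne j i with rfl | hj
  · simp [dir]
  · simp [dir, hj]

/-- Fubini: testing `u ⊗_i v` amounts to testing `u` with the slices of the test function. -/
theorem inner_testL2_tensorAt (i : Fin (n + 1)) (Θ : Test (Config d (n + 1)))
    (u : L2 (Space d)) (v : L2 (Config d n)) :
    ⟪testL2 Θ, tensorAt i u v⟫_ℂ = ∫ y, v y * ⟪testL2 (Θ.slice i y), u⟫_ℂ := by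
  have hi : Integrable (fun x : Config d (n + 1) => Θ.1 x • tensorAt i u v x) :=
    integrable_test_smul Θ.2.1.continuous Θ.2.2 _
  have hi' : Integrable (fun x : Config d (n + 1) =>
      Θ.1 (i.insertNth (x i) (i.removeNth x)) • (u (x i) * v (i.removeNth x))) := by
    refine hi.congr ?_
    filter_upwards [tensorAt_coeFn i u v] with x hx
    rw [hx]
    simp
  have hi2 : Integrable (fun p : Space d × Config d n =>
      Θ.1 (i.insertNth p.1 p.2 : Config d (n + 1)) • (u p.1 * v p.2))
      ((volume : Measure (Space d)).prod (volume : Measure (Config d n))) :=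
    ((mp_removeNth i).integrable_comp_emb (MeasurableEquiv.measurableEmbedding _)).1 hi'
  have h : ∫ x : Config d (n + 1), Θ.1 x • tensorAt i u v x =
      ∫ x : Config d (n + 1), Θ.1 (i.insertNth (x i) (i.removeNth x) : Config d (n + 1)) •
        (u (x i) * v (i.removeNth x)) := by
    refine integral_congr_ae ?_
    filter_upwards [tensorAt_coeFn i u v] with x hx
    rw [hx]
    simp
  rw [inner_testL2, h, integral_removeNth i (fun a b =>
    Θ.1 (i.insertNth a b : Config d (n + 1)) • (u a * v b)), integral_prod_symm _ hi2]
  refine integral_congr_ae (Eventually.of_forall fun y => ?_)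
  simp only
  rw [inner_testL2, ← integral_const_mul]
  refine integral_congr_ae (Eventually.of_forall fun x => ?_)
  simp only [Test.slice, Complex.real_smul]
  ring

theorem tensorAt_mem_weakDerivGraph (i : Fin (n + 1)) (a : Fin d) {u u' : L2 (Space d)}
    (h : (u, u') ∈ weakDerivGraph (EuclideanSpace.single a (1 : ℝ))) (v : L2 (Config d n)) :
    (tensorAt i u v, tensorAt i u' v) ∈ weakDerivGraph (dir i a) := by
  rw [mem_weakDerivGraph_iff] at *
  intro Θ
  simp only at h ⊢
  rw [inner_testL2_tensorAt, inner_testL2_tensorAt, ← integral_neg]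
  refine integral_congr_ae (Eventually.of_forall fun y => ?_)
  simp only
  rw [slice_deriv, h, mul_neg]

theorem contr_mem_H1 (i : Fin (n + 1)) {ψ : L2 (Config d (n + 1))}
    (h : ψ ∈ H1 (Config d (n + 1))) (v : L2 (Config d n)) : contr i v ψ ∈ H1 (Space d) :=
  mem_H1_space fun a => ⟨_, contr_mem_weakDerivGraph i a (derivH1_mem (dir i a) ⟨ψ, h⟩) v⟩

theorem derivH1_contr (i : Fin (n + 1)) (a : Fin d) (ψ : H1 (Config d (n + 1)))
    (v : L2 (Config d n)) (h : contr i v (ψ : L2 (Config d (n + 1))) ∈ H1 (Space d)) :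
    derivH1 (EuclideanSpace.single a (1 : ℝ)) ⟨_, h⟩ = contr i v (derivH1 (dir i a) ψ) :=
  derivH1_eq (contr_mem_weakDerivGraph i a (derivH1_mem (dir i a) ψ) v)

end ConfigDeriv

/-! ### The quadratic form of the Hamiltonian -/

section Form

open Filter Topology

variable {d n : ℕ}

theorem opForm_add_right {H : Type} [NormedAddCommGroup H] [InnerProductSpace ℂ H]
    [CompleteSpace H] {A : H →ₗ.[ℂ] H} (x y z : (sqrtAbs A).domain) :
    opForm A x (y + z) = opForm A x y + opForm A x z := by
  rw [opForm, LinearPMap.map_add, map_add, inner_add_right]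
  rfl

theorem opForm_smul_right {H : Type} [NormedAddCommGroup H] [InnerProductSpace ℂ H]
    [CompleteSpace H] {A : H →ₗ.[ℂ] H} (c : ℂ) (x y : (sqrtAbs A).domain) :
    opForm A x (c • y) = c * opForm A x y := by
  rw [opForm, LinearPMap.map_smul, map_smul, inner_smul_right]
  rfl

theorem quasi_sub {i j : Fin (n + 1)} (hij : i ≠ j) :
    Measure.QuasiMeasurePreserving (fun x : Config d (n + 1) => x i - x j) := by
  let L : Config d (n + 1) →ₗ[ℝ] Space d := LinearMap.proj (R := ℝ) (φ := fun _ : Fin (n + 1) => Space d) i -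
    LinearMap.proj (R := ℝ) (φ := fun _ : Fin (n + 1) => Space d) j
  have hL : Function.Surjective L := fun y => ⟨Pi.single i y, by
    simp [L, hij.symm]⟩
  have hm : Measurable (fun x : Config d (n + 1) => x i - x j) := by fun_prop
  refine ⟨hm, Measure.AbsolutelyContinuous.mk fun s hs h0 => ?_⟩
  rw [Measure.map_apply hm hs]
  have h := (ae_comp_linearMap_mem_iff L volume volume hL hs.compl).2
    (by rw [ae_iff]; simpa using h0)
  rw [ae_iff] at h
  refine (congrArg volume ?_).trans h
  ext x
  simp [L]

/-- The pair interaction is integrable against products of functions in its form domain. -/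
theorem integrable_pair {w : Space d → ℝ} (hw : AEStronglyMeasurable w) {i j : Fin (n + 1)}
    (hij : i ≠ j) {χ ψ : L2 (Config d (n + 1))} (hχ : χ ∈ pairDomain w i j)
    (hψ : ψ ∈ pairDomain w i j) :
    Integrable (fun x : Config d (n + 1) => (w (x i - x j) : ℂ) * (conj (χ x) * ψ x)) := by
  have h := (show MemLp _ 2 volume from hχ).star.integrable_mul (show MemLp _ 2 volume from hψ)
  refine h.mono ?_ (Eventually.of_forall fun x => ?_)
  · exact (Complex.continuous_ofReal.comp_aestronglyMeasurable
      (hw.comp_quasiMeasurePreserving (quasi_sub hij))).mul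
      ((Complex.continuous_conj.comp_aestronglyMeasurable (Lp.aestronglyMeasurable χ)).mul
        (Lp.aestronglyMeasurable ψ))
  · simp only [norm_mul, Complex.norm_real, Pi.mul_apply, Pi.star_apply, norm_star, RCLike.norm_conj,
      Real.norm_eq_abs, abs_of_nonneg (Real.sqrt_nonneg _)]
    rw [mul_mul_mul_comm, Real.mul_self_sqrt (abs_nonneg _)]

theorem mem_pairDomain {w : Space d → ℝ} {G : L2 (Space d) →ₗ.[ℂ] L2 (Space d)}
    (ψ : formDomain (n := n) w G) {i j : Fin (n + 1)} (hij : i < j) :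
    (ψ : L2 (Config d (n + 1))) ∈ pairDomain w i j := by
  have h : (ψ : L2 (Config d (n + 1))) ∈ ⨅ i, ⨅ j, ⨅ _ : i < j, pairDomain w i j := ψ.2.2
  exact (Submodule.mem_iInf _).1 ((Submodule.mem_iInf _).1 ((Submodule.mem_iInf _).1 h i) j) hij

theorem hamForm_add_right {w : Space d → ℝ} (hw : AEStronglyMeasurable w)
    {G : L2 (Space d) →ₗ.[ℂ] L2 (Space d)} (χ ψ ψ' : formDomain (n := n) w G) :
    hamForm w G χ (ψ + ψ') = hamForm w G χ ψ + hamForm w G χ ψ' := by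
  have h1 : ∀ (i : Fin (n + 1)) (a : Fin d),
      derivH1 (dir i a) ⟨↑(ψ + ψ'), (ψ + ψ').2.1.1.2⟩ =
      derivH1 (dir i a) ⟨ψ, ψ.2.1.1.2⟩ + derivH1 (dir i a) ⟨ψ', ψ'.2.1.1.2⟩ :=
    fun i a => derivH1_add (dir i a) (⟨ψ, ψ.2.1.1.2⟩ : H1 (Config d (n + 1)))
      (⟨ψ', ψ'.2.1.1.2⟩ : H1 (Config d (n + 1)))
  have h2 : ∀ i : Fin (n + 1), opForm (liftAt i G)
      ⟨χ, (Submodule.mem_iInf _).1 χ.2.1.2 i⟩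
      ⟨↑(ψ + ψ'), (Submodule.mem_iInf _).1 (ψ + ψ').2.1.2 i⟩ =
      opForm (liftAt i G) ⟨χ, (Submodule.mem_iInf _).1 χ.2.1.2 i⟩
        ⟨ψ, (Submodule.mem_iInf _).1 ψ.2.1.2 i⟩ +
      opForm (liftAt i G) ⟨χ, (Submodule.mem_iInf _).1 χ.2.1.2 i⟩
        ⟨ψ', (Submodule.mem_iInf _).1 ψ'.2.1.2 i⟩ :=
    fun i => opForm_add_right (A := liftAt i G) _
      ⟨(ψ : L2 (Config d (n + 1))), (Submodule.mem_iInf _).1 ψ.2.1.2 i⟩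
      ⟨(ψ' : L2 (Config d (n + 1))), (Submodule.mem_iInf _).1 ψ'.2.1.2 i⟩
  have h3 : ∀ i : Fin (n + 1), ∀ j ∈ Finset.Ioi i, ∫ x : Config d (n + 1),
      (w (x i - x j) : ℂ) * (conj ((χ : L2 (Config d (n + 1))) x)
        * ((ψ + ψ' : formDomain (n := n) w G) : L2 (Config d (n + 1))) x) =
      (∫ x : Config d (n + 1), (w (x i - x j) : ℂ) * (conj ((χ : L2 (Config d (n + 1))) x)
        * (ψ : L2 (Config d (n + 1))) x)) +
      ∫ x : Config d (n + 1), (w (x i - x j) : ℂ) * (conj ((χ : L2 (Config d (n + 1))) x)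
        * (ψ' : L2 (Config d (n + 1))) x) := by
    intro i j hj
    have hij := Finset.mem_Ioi.1 hj
    rw [← integral_add
      (integrable_pair hw hij.ne (mem_pairDomain χ hij) (mem_pairDomain ψ hij))
      (integrable_pair hw hij.ne (mem_pairDomain χ hij) (mem_pairDomain ψ' hij))]
    refine integral_congr_ae ?_
    filter_upwards [Lp.coeFn_add (ψ : L2 (Config d (n + 1))) ψ'] with x hx
    rw [Submodule.coe_add, hx, Pi.add_apply]
    ring
  simp only [hamForm, h1, h2, inner_add_right, Finset.sum_add_distrib]
  rw [Finset.sum_congr rfl fun i _ => Finset.sum_congr rfl (h3 i)]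
  simp only [Finset.sum_add_distrib]
  ring

theorem hamForm_smul_right {w : Space d → ℝ}
    {G : L2 (Space d) →ₗ.[ℂ] L2 (Space d)} (c : ℂ) (χ ψ : formDomain (n := n) w G) :
    hamForm w G χ (c • ψ) = c * hamForm w G χ ψ := by
  have h1 : ∀ (i : Fin (n + 1)) (a : Fin d),
      derivH1 (dir i a) ⟨↑(c • ψ), (c • ψ).2.1.1.2⟩ = c • derivH1 (dir i a) ⟨ψ, ψ.2.1.1.2⟩ :=
    fun i a => derivH1_smul (dir i a) c (⟨ψ, ψ.2.1.1.2⟩ : H1 (Config d (n + 1)))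
  have h2 : ∀ i : Fin (n + 1), opForm (liftAt i G)
      ⟨χ, (Submodule.mem_iInf _).1 χ.2.1.2 i⟩
      ⟨↑(c • ψ), (Submodule.mem_iInf _).1 (c • ψ).2.1.2 i⟩ =
      c * opForm (liftAt i G) ⟨χ, (Submodule.mem_iInf _).1 χ.2.1.2 i⟩
        ⟨ψ, (Submodule.mem_iInf _).1 ψ.2.1.2 i⟩ :=
    fun i => opForm_smul_right (A := liftAt i G) c _
      ⟨(ψ : L2 (Config d (n + 1))), (Submodule.mem_iInf _).1 ψ.2.1.2 i⟩
  have h3 : ∀ i j : Fin (n + 1), ∫ x : Config d (n + 1),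
      (w (x i - x j) : ℂ) * (conj ((χ : L2 (Config d (n + 1))) x)
        * ((c • ψ : formDomain (n := n) w G) : L2 (Config d (n + 1))) x) =
      c * ∫ x : Config d (n + 1), (w (x i - x j) : ℂ) * (conj ((χ : L2 (Config d (n + 1))) x)
        * (ψ : L2 (Config d (n + 1))) x) := by
    intro i j
    rw [← integral_const_mul]
    refine integral_congr_ae ?_
    filter_upwards [Lp.coeFn_smul c (ψ : L2 (Config d (n + 1)))] with x hx
    rw [Submodule.coe_smul, hx, Pi.smul_apply, smul_eq_mul]
    ring
  simp only [hamForm, h1, h2, h3, inner_smul_right, ← Finset.mul_sum]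
  ring

theorem hamForm_conj {w : Space d → ℝ} {G : L2 (Space d) →ₗ.[ℂ] L2 (Space d)}
    (hG : IsSelfAdjoint G) (χ ψ : formDomain (n := n) w G) :
    conj (hamForm w G χ ψ) = hamForm w G ψ χ := by
  simp only [hamForm, map_add, map_sum, inner_conj_symm, opForm_conj (isSelfAdjoint_liftAt _ hG),
    ← integral_conj, map_mul, Complex.conj_ofReal, Complex.conj_conj]
  simp only [mul_comm]

/-- The Cauchy–Schwarz inequality in the degenerate case: the null vectors of a nonnegative
Hermitian form belong to its kernel. -/
theorem form_eq_zero_of_null {V : Type} [AddCommGroup V] [Module ℂ V] (S : V → V → ℂ)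
    (hadd : ∀ x y z, S x (y + z) = S x y + S x z) (hsmul : ∀ (c : ℂ) x y, S x (c • y) = c * S x y)
    (hconj : ∀ x y, conj (S x y) = S y x) (hpos : ∀ x, 0 ≤ (S x x).re) {y : V}
    (hy : (S y y).re = 0) (x : V) : S x y = 0 := by
  let c : PreInnerProductSpace.Core ℂ V :=
    { inner := S
      conj_inner_symm := fun x y => hconj y x
      re_inner_nonneg := hpos
      add_left := fun x y z => by
        rw [← hconj, hadd, map_add, hconj, hconj]
      smul_left := fun x y r => by
        rw [← hconj, hsmul, map_mul, hconj] }
  have h := @InnerProductSpace.Core.inner_mul_inner_self_le ℂ V _ _ _ c x y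
  change ‖S x y‖ * ‖S y x‖ ≤ (S x x).re * (S y y).re at h
  rw [hy, mul_zero, ← hconj x y, RCLike.norm_conj] at h
  exact norm_eq_zero.1 (by nlinarith [norm_nonneg (S x y)])

theorem hamForm_smul_self {w : Space d → ℝ} {G : L2 (Space d) →ₗ.[ℂ] L2 (Space d)}
    (hG : IsSelfAdjoint G) (c : ℂ) (ψ : formDomain (n := n) w G) :
    (hamForm w G (c • ψ) (c • ψ)).re = ‖c‖ ^ 2 * (hamForm w G ψ ψ).re := by
  have h : hamForm w G (c • ψ) (c • ψ) = ((‖c‖ ^ 2 : ℝ) : ℂ) * hamForm w G ψ ψ := by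
    rw [hamForm_smul_right, ← hamForm_conj hG, hamForm_smul_right, map_mul, hamForm_conj hG,
      ← mul_assoc, Complex.mul_conj, Complex.normSq_eq_norm_sq]
  rw [h, Complex.re_ofReal_mul]

/-- By homogeneity, the ground state energy bounds the form from below on the form domain. -/
theorem IsGroundState.le_hamForm {w : Space d → ℝ} {G : L2 (Space d) →ₗ.[ℂ] L2 (Space d)}
    (hG : IsSelfAdjoint G) {ψ : L2 (Config d (n + 1))} (h : IsGroundState w G ψ)
    (χ : formDomain (n := n) w G) :
    (hamForm w G ⟨ψ, h.1⟩ ⟨ψ, h.1⟩).re * ‖(χ : L2 (Config d (n + 1)))‖ ^ 2 ≤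
      (hamForm w G χ χ).re := by
  rcases eq_or_ne (χ : L2 (Config d (n + 1))) 0 with h0 | h0
  · have h1 : χ = (0 : ℂ) • χ := by
      rw [zero_smul]; exact Subtype.ext h0
    have h2 := hamForm_smul_self hG 0 χ
    rw [← h1, norm_zero, zero_pow two_ne_zero, zero_mul] at h2
    rw [h2, h0, norm_zero, zero_pow two_ne_zero, mul_zero]
  · have hn : ‖(χ : L2 (Config d (n + 1)))‖ ≠ 0 := norm_ne_zero_iff.2 h0
    have h1 := h.2.2 (((‖(χ : L2 (Config d (n + 1)))‖⁻¹ : ℝ) : ℂ) • χ) (by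
      rw [Submodule.coe_smul, norm_smul, Complex.norm_real, norm_inv, norm_norm,
        inv_mul_cancel₀ hn])
    rw [hamForm_smul_self hG, Complex.norm_real, norm_inv, norm_norm] at h1
    have h3 : 0 < ‖(χ : L2 (Config d (n + 1)))‖ ^ 2 := by positivity
    have h4 := mul_le_mul_of_nonneg_right h1 h3.le
    rwa [mul_right_comm, inv_pow, inv_mul_cancel₀ h3.ne', one_mul] at h4

/-- The Euler–Lagrange equation of a ground state. -/
theorem IsGroundState.hamForm_eq {w : Space d → ℝ} (hw : AEStronglyMeasurable w)
    {G : L2 (Space d) →ₗ.[ℂ] L2 (Space d)}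
    (hG : IsSelfAdjoint G) {ψ : L2 (Config d (n + 1))} (h : IsGroundState w G ψ)
    (χ : formDomain (n := n) w G) :
    hamForm w G χ ⟨ψ, h.1⟩ =
      (hamForm w G ⟨ψ, h.1⟩ ⟨ψ, h.1⟩).re * ⟪(χ : L2 (Config d (n + 1))), ψ⟫_ℂ := by
  set E := (hamForm w G ⟨ψ, h.1⟩ ⟨ψ, h.1⟩).re with hE
  have hre : ∀ χ : L2 (Config d (n + 1)), ((E : ℂ) * ⟪χ, χ⟫_ℂ).re = E * ‖χ‖ ^ 2 := by
    intro χ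
    rw [Complex.re_ofReal_mul, inner_self_eq_norm_sq_to_K]
    norm_cast
  have key := form_eq_zero_of_null (V := formDomain (n := n) w G)
    (fun χ ψ => hamForm w G χ ψ - E * ⟪(χ : L2 (Config d (n + 1))), (ψ : L2 _)⟫_ℂ)
    (fun x y z => by
      rw [hamForm_add_right hw, Submodule.coe_add, inner_add_right]; ring)
    (fun c x y => by
      rw [hamForm_smul_right, Submodule.coe_smul, inner_smul_right]; ring)
    (fun x y => by
      rw [map_sub, map_mul, hamForm_conj hG, inner_conj_symm, Complex.conj_ofReal])
    (fun x => by
      rw [Complex.sub_re, hre, sub_nonneg]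
      exact h.le_hamForm hG x)
    (y := ⟨ψ, h.1⟩) (by rw [Complex.sub_re, hre, h.2.1, ← hE]; ring) χ
  exact sub_eq_zero.1 key

theorem IsGroundState.groundEnergy_eq {w : Space d → ℝ} {G : L2 (Space d) →ₗ.[ℂ] L2 (Space d)}
    {ψ : L2 (Config d (n + 1))} (h : IsGroundState w G ψ) :
    groundEnergy n w G = (hamForm w G ⟨ψ, h.1⟩ ⟨ψ, h.1⟩).re :=
  IsLeast.csInf_eq ⟨⟨⟨ψ, h.1⟩, h.2.1, rfl⟩, by
    rintro _ ⟨χ, h1, rfl⟩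
    exact h.2.2 χ h1⟩

end Form

/-! ### Bounded one-body perturbations -/

section Perturbation

open Filter Topology

variable {d n : ℕ}

theorem formDomain_add_ofBounded {w : Space d → ℝ} {G : L2 (Space d) →ₗ.[ℂ] L2 (Space d)}
    (hG : IsSelfAdjoint G) {B : L2 (Space d) →L[ℂ] L2 (Space d)} (hB : IsSelfAdjoint B)
    {B' : Fin (n + 1) → L2 (Config d (n + 1)) →L[ℂ] L2 (Config d (n + 1))}
    (h : ∀ i v ψ, contr i v (B' i ψ) = B (contr i v ψ)) :
    formDomain (n := n) w (G + ofBounded B) = formDomain w G := by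
  have h1 : ∀ i : Fin (n + 1), (sqrtAbs (liftAt i (G + ofBounded B))).domain =
      (sqrtAbs (liftAt i G)).domain := fun i => by
    rw [liftAt_add_ofBounded i hG hB (h i), sqrtAbs_add_domain (isSelfAdjoint_liftAt i hG)
      (isSelfAdjoint_of_contr i hB (h i))]
  simp only [formDomain, h1]

theorem hamForm_add_ofBounded {w : Space d → ℝ} {G : L2 (Space d) →ₗ.[ℂ] L2 (Space d)}
    (hG : IsSelfAdjoint G) {B : L2 (Space d) →L[ℂ] L2 (Space d)} (hB : IsSelfAdjoint B)
    {B' : Fin (n + 1) → L2 (Config d (n + 1)) →L[ℂ] L2 (Config d (n + 1))}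
    (h : ∀ i v ψ, contr i v (B' i ψ) = B (contr i v ψ))
    (χ ψ : formDomain (n := n) w (G + ofBounded B))
    (hχ : (χ : L2 (Config d (n + 1))) ∈ formDomain (n := n) w G)
    (hψ : (ψ : L2 (Config d (n + 1))) ∈ formDomain (n := n) w G) :
    hamForm w (G + ofBounded B) χ ψ = hamForm w G ⟨(χ : L2 (Config d (n + 1))), hχ⟩
        ⟨(ψ : L2 (Config d (n + 1))), hψ⟩ +
      ∑ i, ⟪(χ : L2 (Config d (n + 1))), B' i ψ⟫_ℂ := by
  have h1 : ∀ i : Fin (n + 1), opForm (liftAt i (G + ofBounded B))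
      ⟨χ, (Submodule.mem_iInf _).1 χ.2.1.2 i⟩ ⟨ψ, (Submodule.mem_iInf _).1 ψ.2.1.2 i⟩ =
      opForm (liftAt i G) ⟨χ, (Submodule.mem_iInf _).1 hχ.1.2 i⟩
        ⟨ψ, (Submodule.mem_iInf _).1 hψ.1.2 i⟩ + ⟪(χ : L2 (Config d (n + 1))), B' i ψ⟫_ℂ := by
    intro i
    have e := liftAt_add_ofBounded i hG hB (h i)
    have key : ∀ (T : L2 (Config d (n + 1)) →ₗ.[ℂ] L2 (Config d (n + 1)))
        (_ : T = liftAt i G + ofBounded (B' i)) (h1 : (χ : L2 (Config d (n + 1))) ∈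
          (sqrtAbs T).domain) (h2 : (ψ : L2 (Config d (n + 1))) ∈ (sqrtAbs T).domain),
        opForm T ⟨χ, h1⟩ ⟨ψ, h2⟩ = opForm (liftAt i G) ⟨χ, (Submodule.mem_iInf _).1 hχ.1.2 i⟩
        ⟨ψ, (Submodule.mem_iInf _).1 hψ.1.2 i⟩ + ⟪(χ : L2 (Config d (n + 1))), B' i ψ⟫_ℂ := by
      rintro _ rfl h1 h2
      exact opForm_add_ofBounded (isSelfAdjoint_liftAt i hG) (isSelfAdjoint_of_contr i hB (h i))
        _ _ h1 h2
    exact key _ e _ _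
  simp only [hamForm, h1, Finset.sum_add_distrib]
  ring

theorem gradSq_nonneg (u : H1 (Space d)) : 0 ≤ gradSq u :=
  Finset.sum_nonneg fun _ _ => by positivity

theorem add_ofBounded_mem_nonlocalPotentials {G : L2 (Space d) →ₗ.[ℂ] L2 (Space d)}
    (hG : G ∈ nonlocalPotentials d) {B : L2 (Space d) →L[ℂ] L2 (Space d)}
    (hB : IsSelfAdjoint B) : G + ofBounded B ∈ nonlocalPotentials d := by
  obtain ⟨h1, h2, h3⟩ := hG
  obtain ⟨C, hC0, hC⟩ := exists_sqrtAbs_bound_add h1 hB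
  refine ⟨isSelfAdjoint_add_ofBounded h1 hB, (sqrtAbs_add_domain h1 hB).symm ▸ h2, ?_⟩
  intro ε hε
  obtain ⟨c, hc0, hc⟩ := h3 (ε / (C + 1)) (by positivity)
  refine ⟨C * (c + 1), by positivity, fun u => ?_⟩
  obtain ⟨z', hz, hz'⟩ := hC _ _ ((sqrtAbs G).mem_graph ⟨u, h2 u.2⟩)
  rw [sqrtAbs_apply_eq _ hz]
  refine hz'.trans ?_
  have h4 := mul_le_mul_of_nonneg_left (hc u) hC0
  have h5 : C * (ε / (C + 1)) ≤ ε := by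
    rw [mul_div_assoc', div_le_iff₀ (by positivity)]
    nlinarith
  have h6 := mul_le_mul_of_nonneg_right h5 (gradSq_nonneg u)
  simp only
  nlinarith

theorem ofBounded_mem_nonlocalPotentials {B : L2 (Space d) →L[ℂ] L2 (Space d)}
    (hB : IsSelfAdjoint B) : ofBounded B ∈ nonlocalPotentials d := by
  refine ⟨isSelfAdjoint_ofBounded hB, fun x _ => mem_sqrtAbs_domain_ofBounded hB x,
    fun ε hε => ⟨‖B‖, norm_nonneg B, fun u => ?_⟩⟩
  refine (norm_sqrtAbs_sq_le (isSelfAdjoint_ofBounded hB) _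
    ((mem_ofBounded_graph _ _).2 rfl)).trans ?_
  have h1 := B.le_opNorm (u : L2 (Space d))
  have h2 := mul_nonneg hε.le (gradSq_nonneg u)
  simp only
  nlinarith [norm_nonneg (u : L2 (Space d))]

end Perturbation

/-! ### Disjointly supported test functions -/

section Bumps

variable {d : ℕ}

theorem inner_testL2_testL2 (θ η : Test (Space d)) :
    ⟪testL2 θ, testL2 η⟫_ℂ = ((∫ x, θ.1 x * η.1 x : ℝ) : ℂ) := by
  rw [inner_testL2, ← integral_complex_ofReal]
  refine integral_congr_ae ?_
  filter_upwards [testL2_coeFn η] with x hx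
  rw [hx, Complex.real_smul, Complex.ofReal_mul]

/-- In positive dimension there are infinitely many normalized test functions with disjoint
supports. -/
theorem exists_test_disjoint (hd : 1 ≤ d) : ∃ θ : ℕ → Test (Space d),
    (∀ j, ‖testL2 (θ j)‖ = 1) ∧
    ∀ j k, j ≠ k → Disjoint (tsupport (θ j).1) (tsupport (θ k).1) := by
  let a : Fin d := ⟨0, hd⟩
  -- bumps of radius `1` around points at mutual distance at least `3`
  let p : ℕ → Space d := fun j => EuclideanSpace.single a (3 * j : ℝ)
  have hp : ∀ j k, j ≠ k → 3 ≤ dist (p j) (p k) := by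
    intro j k hjk
    have h1 : dist (p j) (p k) = |3 * (j : ℝ) - 3 * k| := by
      simp only [p]
      exact (PiLp.dist_single_same 2 _ a _ _).trans (Real.dist_eq _ _)
    have h2 : (1 : ℝ) ≤ |(j : ℝ) - k| := by
      have : (1 : ℤ) ≤ |(j : ℤ) - k| := Int.one_le_abs (by omega)
      exact_mod_cast this
    rw [h1, ← mul_sub, abs_mul]
    norm_num
    linarith
  let b : ∀ j, ContDiffBump (p j) := fun j => ⟨1 / 2, 1, by norm_num, by norm_num⟩
  let η : ℕ → Test (Space d) := fun j => ⟨b j, (b j).contDiff, (b j).hasCompactSupport⟩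
  have hη : ∀ j, testL2 (η j) ≠ 0 := by
    intro j h
    have h1 := inner_testL2_testL2 (η j) (η j)
    rw [h, inner_zero_left, eq_comm, Complex.ofReal_eq_zero] at h1
    have h2 : 0 < ∫ x, (η j).1 x * (η j).1 x := by
      have hc : Continuous fun x => (η j).1 x * (η j).1 x :=
        (η j).2.1.continuous.mul (η j).2.1.continuous
      refine hc.integral_pos_of_hasCompactSupport_nonneg_nonzero ((η j).2.2.mul_right)
        (fun x => mul_self_nonneg _) (x := p j) ?_
      have : b j (p j) = 1 := (b j).one_of_mem_closedBall (by simp [b])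
      change b j (p j) * b j (p j) ≠ 0
      rw [this]
      norm_num
    exact h2.ne' h1
  refine ⟨fun j => ⟨fun x => ‖testL2 (η j)‖⁻¹ * (η j).1 x, contDiff_const.mul (η j).2.1,
    (η j).2.2.mul_left⟩, fun j => ?_, fun j k hjk => ?_⟩
  · have h1 : testL2 (⟨fun x => ‖testL2 (η j)‖⁻¹ * (η j).1 x, contDiff_const.mul (η j).2.1,
        (η j).2.2.mul_left⟩ : Test (Space d)) = ((‖testL2 (η j)‖⁻¹ : ℝ) : ℂ) • testL2 (η j) := by
      apply Lp.ext
      refine (testL2_coeFn _).trans ?_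
      filter_upwards [testL2_coeFn (η j),
        Lp.coeFn_smul ((‖testL2 (η j)‖⁻¹ : ℝ) : ℂ) (testL2 (η j))] with x h1 h2
      rw [h2, Pi.smul_apply, h1]
      simp
    rw [h1, norm_smul, Complex.norm_real, norm_inv, norm_norm,
      inv_mul_cancel₀ (norm_ne_zero_iff.2 (hη j))]
  · have hs : ∀ j, tsupport (fun x => ‖testL2 (η j)‖⁻¹ * (η j).1 x) ⊆
        Metric.closedBall (p j) 1 := fun j =>
      (closure_mono (Function.support_mul_subset_right _ _)).trans (b j).tsupport_eq.le
    refine Set.disjoint_of_subset (hs j) (hs k) (Metric.closedBall_disjoint_closedBall ?_)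
    linarith [hp j k hjk]

theorem inner_testL2_eq_zero {θ η : Test (Space d)}
    (h : Disjoint (tsupport θ.1) (tsupport η.1)) : ⟪testL2 θ, testL2 η⟫_ℂ = 0 := by
  rw [inner_testL2_testL2, Complex.ofReal_eq_zero]
  refine integral_eq_zero_of_ae (Filter.Eventually.of_forall fun x => ?_)
  by_contra h0
  exact Set.disjoint_left.1 h (subset_tsupport _ (left_ne_zero_of_mul h0))
    (subset_tsupport _ (right_ne_zero_of_mul h0))

theorem tsupport_deriv_subset (m : Space d) (θ : Test (Space d)) :
    tsupport (θ.deriv m).1 ⊆ tsupport θ.1 :=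
  tsupport_fderiv_apply_subset ℝ m

end Bumps

/-! ### Adding a projector orthogonal to the ground state -/

section AddProj

open Filter Topology

variable {d n : ℕ}

theorem isSelfAdjoint_smul_proj (ε : ℝ) (φ : L2 (Space d)) :
    IsSelfAdjoint ((ε : ℂ) • proj φ) :=
  IsSelfAdjoint.smul (Complex.conj_ofReal ε) (isSelfAdjoint_proj φ)

theorem contr_smul_proj (ε : ℝ) (φ : L2 (Space d)) (i : Fin (n + 1)) (v : L2 (Config d n))
    (ψ : L2 (Config d (n + 1))) :
    contr i v (((ε : ℂ) • (tensorL i φ ∘L annih i φ)) ψ) = ((ε : ℂ) • proj φ) (contr i v ψ) := by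
  rw [_root_.smul_apply, _root_.smul_apply, map_smul, contr_rankOne]
  rfl

theorem inner_tensorL_annih (i : Fin (n + 1)) (φ : L2 (Space d)) (χ ψ : L2 (Config d (n + 1))) :
    ⟪χ, (tensorL i φ ∘L annih i φ) ψ⟫_ℂ = ⟪annih i φ χ, annih i φ ψ⟫_ℂ := by
  rw [ContinuousLinearMap.comp_apply, tensorL_apply, ← inner_conj_symm, ← inner_annih,
    inner_conj_symm]

theorem annih_eq_zero_of_wedgeOrthogonal {φ : L2 (Space d)} {ψ : L2 (Config d (n + 1))}
    (hψ : ψ ∈ antisym d (n + 1)) (h : WedgeOrthogonal φ ψ) (i : Fin (n + 1)) :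
    annih i φ ψ = 0 := by
  rw [annih_antisym i φ hψ, (wedgeOrthogonal_iff φ hψ).1 h, smul_zero]

theorem formDomain_add_proj {w : Space d → ℝ} {G : L2 (Space d) →ₗ.[ℂ] L2 (Space d)}
    (hG : IsSelfAdjoint G) (ε : ℝ) (φ : L2 (Space d)) :
    formDomain (n := n) w (G + ofBounded ((ε : ℂ) • proj φ)) = formDomain w G :=
  formDomain_add_ofBounded hG (isSelfAdjoint_smul_proj ε φ) (contr_smul_proj ε φ)

theorem hamForm_add_proj {w : Space d → ℝ} {G : L2 (Space d) →ₗ.[ℂ] L2 (Space d)}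
    (hG : IsSelfAdjoint G) (ε : ℝ) (φ : L2 (Space d))
    (χ ψ : formDomain (n := n) w (G + ofBounded ((ε : ℂ) • proj φ)))
    (hχ : (χ : L2 (Config d (n + 1))) ∈ formDomain (n := n) w G)
    (hψ : (ψ : L2 (Config d (n + 1))) ∈ formDomain (n := n) w G) :
    hamForm w (G + ofBounded ((ε : ℂ) • proj φ)) χ ψ =
      hamForm w G ⟨(χ : L2 (Config d (n + 1))), hχ⟩ ⟨(ψ : L2 (Config d (n + 1))), hψ⟩ +
      ε * ∑ i, ⟪annih i φ (χ : L2 (Config d (n + 1))), annih i φ (ψ : L2 (Config d (n + 1)))⟫_ℂ := by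
  rw [hamForm_add_ofBounded hG (isSelfAdjoint_smul_proj ε φ) (contr_smul_proj ε φ) χ ψ hχ hψ,
    Finset.mul_sum]
  congr 1
  refine Finset.sum_congr rfl fun i _ => ?_
  rw [_root_.smul_apply, inner_smul_right, inner_tensorL_annih]

/-- Adding a nonnegative multiple of a projector does not lower the form. -/
theorem le_re_hamForm_add_proj {w : Space d → ℝ} {G : L2 (Space d) →ₗ.[ℂ] L2 (Space d)}
    (hG : IsSelfAdjoint G) {ε : ℝ} (hε : 0 ≤ ε) (φ : L2 (Space d))
    (χ : formDomain (n := n) w (G + ofBounded ((ε : ℂ) • proj φ)))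
    (hχ : (χ : L2 (Config d (n + 1))) ∈ formDomain (n := n) w G) :
    (hamForm w G ⟨(χ : L2 (Config d (n + 1))), hχ⟩ ⟨(χ : L2 (Config d (n + 1))), hχ⟩).re ≤
      (hamForm w (G + ofBounded ((ε : ℂ) • proj φ)) χ χ).re := by
  rw [hamForm_add_proj hG ε φ χ χ hχ hχ, Complex.add_re, Complex.re_ofReal_mul, Complex.re_sum]
  have h : 0 ≤ ∑ i : Fin (n + 1), (⟪annih i φ (χ : L2 (Config d (n + 1))),
      annih i φ (χ : L2 (Config d (n + 1)))⟫_ℂ).re :=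
    Finset.sum_nonneg fun i _ => inner_self_nonneg (𝕜 := ℂ)
  linarith [mul_nonneg hε h]

/-- The form of the perturbed Hamiltonian agrees with the unperturbed one on functions annihilated
by `φ`. -/
theorem hamForm_add_proj_of_wedgeOrthogonal {w : Space d → ℝ}
    {G : L2 (Space d) →ₗ.[ℂ] L2 (Space d)}
    (hG : IsSelfAdjoint G) (ε : ℝ) {φ : L2 (Space d)}
    (χ ψ : formDomain (n := n) w (G + ofBounded ((ε : ℂ) • proj φ)))
    (hχ : (χ : L2 (Config d (n + 1))) ∈ formDomain (n := n) w G)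
    (hψ : (ψ : L2 (Config d (n + 1))) ∈ formDomain (n := n) w G)
    (h : WedgeOrthogonal φ (ψ : L2 (Config d (n + 1)))) :
    hamForm w (G + ofBounded ((ε : ℂ) • proj φ)) χ ψ =
      hamForm w G ⟨(χ : L2 (Config d (n + 1))), hχ⟩ ⟨(ψ : L2 (Config d (n + 1))), hψ⟩ := by
  rw [hamForm_add_proj hG ε φ χ ψ hχ hψ]
  simp only [annih_eq_zero_of_wedgeOrthogonal ψ.2.1.1.1 h, inner_zero_right,
    Finset.sum_const_zero, mul_zero, add_zero]

theorem IsGroundState.add_proj {w : Space d → ℝ} {G : L2 (Space d) →ₗ.[ℂ] L2 (Space d)}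
    (hG : IsSelfAdjoint G) {ε : ℝ} (hε : 0 ≤ ε) {φ : L2 (Space d)}
    {ψ : L2 (Config d (n + 1))} (hψ : IsGroundState w G ψ) (h : WedgeOrthogonal φ ψ) :
    IsGroundState w (G + ofBounded ((ε : ℂ) • proj φ)) ψ := by
  have hD := formDomain_add_proj (n := n) (w := w) hG ε φ
  refine ⟨hD ▸ hψ.1, hψ.2.1, fun χ hχ => ?_⟩
  have hχ' : (χ : L2 (Config d (n + 1))) ∈ formDomain (n := n) w G := hD ▸ χ.2
  rw [hamForm_add_proj_of_wedgeOrthogonal hG ε _ _ hψ.1 hψ.1 h]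
  exact (hψ.2.2 ⟨χ, hχ'⟩ hχ).trans (le_re_hamForm_add_proj hG hε φ χ hχ')

theorem groundEnergy_add_proj {w : Space d → ℝ} {G : L2 (Space d) →ₗ.[ℂ] L2 (Space d)}
    (hG : IsSelfAdjoint G) {ε : ℝ} (hε : 0 ≤ ε) {φ : L2 (Space d)}
    {ψ : L2 (Config d (n + 1))} (hψ : IsGroundState w G ψ) (h : WedgeOrthogonal φ ψ) :
    groundEnergy n w (G + ofBounded ((ε : ℂ) • proj φ)) = groundEnergy n w G := by
  rw [(hψ.add_proj hG hε h).groundEnergy_eq, hψ.groundEnergy_eq,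
    hamForm_add_proj_of_wedgeOrthogonal hG ε _ _ hψ.1 hψ.1 h]

theorem IsUniqueGroundState.add_proj {w : Space d → ℝ} {G : L2 (Space d) →ₗ.[ℂ] L2 (Space d)}
    (hG : IsSelfAdjoint G) {ε : ℝ} (hε : 0 ≤ ε) {φ : L2 (Space d)}
    {ψ : L2 (Config d (n + 1))} (hψ : IsUniqueGroundState w G ψ) (h : WedgeOrthogonal φ ψ) :
    IsUniqueGroundState w (G + ofBounded ((ε : ℂ) • proj φ)) ψ := by
  have hD := formDomain_add_proj (n := n) (w := w) hG ε φ
  have hψ' := hψ.1.add_proj hG hε h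
  refine ⟨hψ', fun χ hχ => hψ.2 χ ?_⟩
  have hχ' : χ ∈ formDomain (n := n) w G := hD ▸ hχ.1
  refine ⟨hχ', hχ.2.1, fun η hη => ?_⟩
  have h1 := hχ.2.2 ⟨ψ, hψ'.1⟩ hψ.1.2.1
  rw [hamForm_add_proj_of_wedgeOrthogonal hG ε ⟨ψ, hψ'.1⟩ ⟨ψ, hψ'.1⟩ hψ.1.1 hψ.1.1 h] at h1
  exact ((le_re_hamForm_add_proj hG hε φ ⟨χ, hχ.1⟩ hχ').trans h1).trans (hψ.1.2.2 η hη)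

/-- The Euler–Lagrange equation, read as the eigenvalue equation of the Hamiltonian. -/
theorem IsGroundState.mem_hamGraph {w : Space d → ℝ} (hw : AEStronglyMeasurable w)
    {G : L2 (Space d) →ₗ.[ℂ] L2 (Space d)} (hG : IsSelfAdjoint G) {ψ : L2 (Config d (n + 1))}
    (hψ : IsGroundState w G ψ) :
    ((⟨ψ, hψ.1.1.1.1⟩, (groundEnergy n w G : ℂ) • ⟨ψ, hψ.1.1.1.1⟩) :
      antisym d (n + 1) × antisym d (n + 1)) ∈ hamGraph w G := by
  refine ⟨hψ.1, fun χ => ?_⟩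
  rw [hψ.groundEnergy_eq, Submodule.coe_smul, inner_smul_right]
  exact hψ.hamForm_eq hw hG χ

theorem exists_ne_zero_inner_eq_zero (hd : 1 ≤ d) (φ : L2 (Space d)) :
    ∃ x : L2 (Space d), x ≠ 0 ∧ ⟪φ, x⟫_ℂ = 0 := by
  obtain ⟨θ, h1, h2⟩ := exists_test_disjoint hd
  set f : ℕ → L2 (Space d) := fun j => testL2 (θ j)
  have h12 : ⟪f 1, f 0⟫_ℂ = 0 := inner_testL2_eq_zero (h2 1 0 one_ne_zero)
  rcases eq_or_ne ⟪φ, f 0⟫_ℂ 0 with h0 | h0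
  · exact ⟨f 0, fun h => by simpa [f, h] using h1 0, h0⟩
  · refine ⟨⟪φ, f 1⟫_ℂ • f 0 - ⟪φ, f 0⟫_ℂ • f 1, fun h => h0 ?_, ?_⟩
    · have h3 : ⟪f 1, ⟪φ, f 1⟫_ℂ • f 0 - ⟪φ, f 0⟫_ℂ • f 1⟫_ℂ = 0 := by rw [h, inner_zero_right]
      rw [inner_sub_right, inner_smul_right, inner_smul_right, h12,
        inner_self_eq_norm_sq_to_K, h1 1] at h3
      simpa using h3
    · rw [inner_sub_right, inner_smul_right, inner_smul_right]
      ring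

/-- In positive dimension some `f ≠ 0` is orthogonal to `φ`, so that a constant equal to `ε |φ⟩⟨φ|` would be
both `0`, from its action on `f`, and `ε ≠ 0`, from its action on `φ`. -/
theorem add_proj_ne_add_const (hd : 1 ≤ d) {G : L2 (Space d) →ₗ.[ℂ] L2 (Space d)}
    (hG : IsSelfAdjoint G) {ε : ℝ} (hε : ε ≠ 0) {φ : L2 (Space d)} (hφ : ‖φ‖ = 1) (c : ℂ) :
    G + ofBounded ((ε : ℂ) • proj φ) ≠
      G + ofBounded (c • ContinuousLinearMap.id ℂ (L2 (Space d))) := by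
  intro h
  have h1 : ∀ x ∈ G.domain, ((ε : ℂ) • proj φ) x =
      (c • ContinuousLinearMap.id ℂ (L2 (Space d))) x := by
    intro x hx
    have h2 : (x, G ⟨x, hx⟩ + ((ε : ℂ) • proj φ) x) ∈ (G + ofBounded ((ε : ℂ) • proj φ)).graph := by
      rw [mem_add_ofBounded_graph, add_sub_cancel_right]
      exact G.mem_graph ⟨x, hx⟩
    rw [h, mem_add_ofBounded_graph] at h2
    have h3 := graph_unique h2 (G.mem_graph ⟨x, hx⟩)
    rw [add_sub_assoc, add_eq_left, sub_eq_zero] at h3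
    exact h3
  have h2 : ∀ x, ((ε : ℂ) • proj φ) x = (c • ContinuousLinearMap.id ℂ (L2 (Space d))) x := by
    have := Continuous.ext_on hG.dense_domain ((ε : ℂ) • proj φ).continuous
      (c • ContinuousLinearMap.id ℂ (L2 (Space d))).continuous h1
    exact congrFun this
  obtain ⟨x, hx0, hx⟩ := exists_ne_zero_inner_eq_zero hd φ
  have h3 := h2 x
  have h4 := h2 φ
  simp only [_root_.smul_apply, proj, InnerProductSpace.rankOne_apply, hx, zero_smul, smul_zero,
    ContinuousLinearMap.id_apply, inner_self_eq_norm_sq_to_K, hφ] at h3 h4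
  have hc : c = 0 := (smul_eq_zero.1 h3.symm).resolve_right hx0
  have hφ0 : φ ≠ 0 := fun h => by simp [h] at hφ
  rw [hc, zero_smul, smul_eq_zero] at h4
  simp [hφ0, hε] at h4

end AddProj

/-! ### Noninteracting Hamiltonians -/

section Free

open Filter Topology

variable {d n : ℕ} {G : L2 (Space d) →ₗ.[ℂ] L2 (Space d)}

/-- The quadratic form of the one-body operator `-Δ + G` on `H¹(ℝ^d)`. -/
def oneForm (hG : H1 (Space d) ≤ (sqrtAbs G).domain) (f g : H1 (Space d)) : ℂ :=
  ∑ a : Fin d, ⟪derivH1 (EuclideanSpace.single a (1 : ℝ)) f,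
    derivH1 (EuclideanSpace.single a (1 : ℝ)) g⟫_ℂ + opForm G ⟨f, hG f.2⟩ ⟨g, hG g.2⟩

/-- The form domain of `-Δ_i + G_i`, intersected with `H¹`. -/
def bodyDomain (G : L2 (Space d) →ₗ.[ℂ] L2 (Space d)) (i : Fin (n + 1)) :
    Submodule ℂ (L2 (Config d (n + 1))) :=
  H1 (Config d (n + 1)) ⊓ (sqrtAbs (liftAt i G)).domain

/-- The quadratic form of `-Δ_i + G_i`. -/
def bodyForm (G : L2 (Space d) →ₗ.[ℂ] L2 (Space d)) (i : Fin (n + 1))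
    (χ ψ : bodyDomain G i) : ℂ :=
  ∑ a : Fin d, ⟪derivH1 (dir i a) ⟨χ, χ.2.1⟩, derivH1 (dir i a) ⟨ψ, ψ.2.1⟩⟫_ℂ +
    opForm (liftAt i G) ⟨χ, χ.2.2⟩ ⟨ψ, ψ.2.2⟩

theorem formDomain_le_bodyDomain (w : Space d → ℝ) (i : Fin (n + 1)) :
    formDomain w G ≤ bodyDomain G i :=
  fun _ h => ⟨h.1.1.2, (Submodule.mem_iInf _).1 h.1.2 i⟩

theorem hamForm_zero (χ ψ : formDomain (n := n) 0 G) :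
    hamForm 0 G χ ψ = ∑ i, bodyForm G i ⟨(χ : L2 (Config d (n + 1))), formDomain_le_bodyDomain 0 i χ.2⟩
      ⟨(ψ : L2 (Config d (n + 1))), formDomain_le_bodyDomain 0 i ψ.2⟩ := by
  simp only [hamForm, bodyForm, Pi.zero_apply, Complex.ofReal_zero, zero_mul, integral_zero,
    Finset.sum_const_zero, add_zero, Finset.sum_add_distrib]

theorem oneForm_conj (hA : IsSelfAdjoint G) (hG : H1 (Space d) ≤ (sqrtAbs G).domain)
    (f g : H1 (Space d)) : conj (oneForm hG f g) = oneForm hG g f := by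
  simp only [oneForm, map_add, map_sum, inner_conj_symm, opForm_conj hA]

theorem oneForm_smul_right (hG : H1 (Space d) ≤ (sqrtAbs G).domain) (c : ℂ) (f g : H1 (Space d)) :
    oneForm hG f (c • g) = c * oneForm hG f g := by
  have h := opForm_smul_right (A := G) c ⟨f, hG f.2⟩ ⟨g, hG g.2⟩
  simp only [oneForm, derivH1_smul, inner_smul_right, ← Finset.mul_sum, mul_add]
  rw [← h]
  rfl

theorem oneForm_smul_left (hA : IsSelfAdjoint G) (hG : H1 (Space d) ≤ (sqrtAbs G).domain) (c : ℂ)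
    (f g : H1 (Space d)) : oneForm hG (c • f) g = conj c * oneForm hG f g := by
  rw [← oneForm_conj hA, oneForm_smul_right, map_mul, oneForm_conj hA]

/-- The form of `-Δ_i + G_i` as a linear map in its second argument. -/
def bodyFormL (G : L2 (Space d) →ₗ.[ℂ] L2 (Space d)) (i : Fin (n + 1)) (χ : bodyDomain G i) :
    bodyDomain G i →ₗ[ℂ] ℂ where
  toFun := bodyForm G i χ
  map_add' ψ ψ' := by
    have h1 : ∀ a : Fin d, derivH1 (dir i a) ⟨↑(ψ + ψ'), (ψ + ψ').2.1⟩ =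
        derivH1 (dir i a) ⟨ψ, ψ.2.1⟩ + derivH1 (dir i a) ⟨ψ', ψ'.2.1⟩ := fun a =>
      derivH1_add (dir i a) (⟨ψ, ψ.2.1⟩ : H1 (Config d (n + 1)))
        (⟨ψ', ψ'.2.1⟩ : H1 (Config d (n + 1)))
    have h2 := opForm_add_right (A := liftAt i G) ⟨χ, χ.2.2⟩
      ⟨(ψ : L2 (Config d (n + 1))), ψ.2.2⟩ ⟨(ψ' : L2 (Config d (n + 1))), ψ'.2.2⟩
    simp only [bodyForm, h1, inner_add_right, Finset.sum_add_distrib]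
    rw [show opForm (liftAt i G) ⟨χ, χ.2.2⟩ ⟨↑(ψ + ψ'), (ψ + ψ').2.2⟩ = _ from h2]
    ring
  map_smul' c ψ := by
    have h1 : ∀ a : Fin d, derivH1 (dir i a) ⟨↑(c • ψ), (c • ψ).2.1⟩ =
        c • derivH1 (dir i a) ⟨ψ, ψ.2.1⟩ := fun a =>
      derivH1_smul (dir i a) c (⟨ψ, ψ.2.1⟩ : H1 (Config d (n + 1)))
    have h2 := opForm_smul_right (A := liftAt i G) c ⟨χ, χ.2.2⟩
      ⟨(ψ : L2 (Config d (n + 1))), ψ.2.2⟩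
    simp only [bodyForm, h1, inner_smul_right, ← Finset.mul_sum]
    rw [show opForm (liftAt i G) ⟨χ, χ.2.2⟩ ⟨↑(c • ψ), (c • ψ).2.2⟩ = _ from h2]
    simp only [RingHom.id_apply, smul_eq_mul]
    ring

/-- The contraction of an `H¹` function is in `H¹`. -/
def contrH1 (i : Fin (n + 1)) (v : L2 (Config d n)) (ψ : bodyDomain G i) : H1 (Space d) :=
  ⟨contr i v ψ, contr_mem_H1 i ψ.2.1 v⟩

/-- Parseval's identity for the form of `-Δ_i + G_i`. -/
theorem hasSum_bodyForm (hA : IsSelfAdjoint G) (hG : H1 (Space d) ≤ (sqrtAbs G).domain)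
    (i : Fin (n + 1)) {κ : Type} (e : HilbertBasis κ ℂ (L2 (Config d n))) (χ ψ : bodyDomain G i) :
    HasSum (fun k => oneForm hG (contrH1 i (e k) χ) (contrH1 i (e k) ψ)) (bodyForm G i χ ψ) := by
  refine HasSum.add (hasSum_sum fun a _ => ?_)
    (hasSum_opForm_liftAt i hA e ⟨χ, χ.2.2⟩ ⟨ψ, ψ.2.2⟩)
  refine (hasSum_inner_contr i e _ _).congr_fun fun k => ?_
  rw [contrH1, contrH1, derivH1_contr i a ⟨χ, χ.2.1⟩, derivH1_contr i a ⟨ψ, ψ.2.1⟩]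

theorem prodVec_mem_weakDerivGraph {f : Fin (n + 1) → L2 (Space d)} (i : Fin (n + 1)) (a : Fin d)
    (hf : f i ∈ H1 (Space d)) :
    (prodVec f, tensorAt i (derivH1 (EuclideanSpace.single a (1 : ℝ)) ⟨f i, hf⟩)
      (prodVec (i.removeNth f))) ∈ weakDerivGraph (dir i a) := by
  rw [prodVec_eq_tensorAt i f]
  exact tensorAt_mem_weakDerivGraph i a (derivH1_mem _ ⟨f i, hf⟩) _

theorem prodVec_mem_bodyDomain (hA : IsSelfAdjoint G) (hG : H1 (Space d) ≤ (sqrtAbs G).domain)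
    {f : Fin (n + 1) → L2 (Space d)} (hf : ∀ i, f i ∈ H1 (Space d)) (i : Fin (n + 1)) :
    prodVec f ∈ bodyDomain G i := by
  refine ⟨mem_H1_config fun j a => ⟨_, prodVec_mem_weakDerivGraph j a (hf j)⟩, ?_⟩
  rw [prodVec_eq_tensorAt i f]
  exact tensorAt_mem_sqrtAbs_domain i hA (hG (hf i)) _

theorem bodyForm_prodVec (hA : IsSelfAdjoint G) (hG : H1 (Space d) ≤ (sqrtAbs G).domain)
    {f : Fin (n + 1) → L2 (Space d)} (hf : ∀ i, f i ∈ H1 (Space d)) (i : Fin (n + 1))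
    (χ : bodyDomain G i) :
    bodyForm G i χ ⟨_, prodVec_mem_bodyDomain hA hG hf i⟩ =
      oneForm hG (contrH1 i (prodVec (i.removeNth f)) χ) ⟨f i, hf i⟩ := by
  rw [bodyForm, oneForm]
  congr 1
  · refine Finset.sum_congr rfl fun a _ => ?_
    rw [derivH1_eq (f := ⟨prodVec f, (prodVec_mem_bodyDomain hA hG hf i).1⟩)
      (prodVec_mem_weakDerivGraph i a (hf i)), contrH1, derivH1_contr i a ⟨χ, χ.2.1⟩,
      ← inner_conj_symm, ← inner_contr, inner_conj_symm]
  · rw [← opForm_conj (isSelfAdjoint_liftAt i hA)]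
    have key : ∀ (ξ : L2 (Config d (n + 1))) (hξ : ξ ∈ (sqrtAbs (liftAt i G)).domain)
        (_ : ξ = tensorAt i (f i) (prodVec (i.removeNth f))),
        opForm (liftAt i G) ⟨ξ, hξ⟩ ⟨χ, χ.2.2⟩ = opForm G ⟨f i, hG (hf i)⟩
          ⟨contr i (prodVec (i.removeNth f)) χ, hG (contr_mem_H1 i χ.2.1 _)⟩ := by
      rintro _ hξ rfl
      exact opForm_liftAt_tensorAt i hA (hG (hf i)) _ ⟨χ, χ.2.2⟩
    rw [key _ _ (prodVec_eq_tensorAt i f), opForm_conj hA]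
    rfl

theorem slater_mem_bodyDomain (hA : IsSelfAdjoint G) (hG : H1 (Space d) ≤ (sqrtAbs G).domain)
    {f : Fin (n + 1) → L2 (Space d)} (hf : ∀ i, f i ∈ H1 (Space d)) (i : Fin (n + 1)) :
    slater f ∈ bodyDomain G i :=
  Submodule.smul_mem _ _ (Submodule.sum_mem _ fun σ _ => Submodule.smul_mem _ _
    (prodVec_mem_bodyDomain hA hG (fun i => hf (σ i)) i))

theorem mem_formDomain_zero {ψ : L2 (Config d (n + 1))} (h1 : ψ ∈ antisym d (n + 1))
    (h2 : ∀ i, ψ ∈ bodyDomain G i) : ψ ∈ formDomain 0 G := by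
  refine ⟨⟨⟨h1, (h2 0).1⟩, (Submodule.mem_iInf _).2 fun i => (h2 i).2⟩, (Submodule.mem_iInf _).2 fun i => (Submodule.mem_iInf _).2 fun j =>
    (Submodule.mem_iInf _).2 fun _ => ?_⟩
  change MemLp _ 2 volume
  simp

theorem slater_mem_formDomain (hA : IsSelfAdjoint G) (hG : H1 (Space d) ≤ (sqrtAbs G).domain)
    {f : Fin (n + 1) → L2 (Space d)} (hf : ∀ i, f i ∈ H1 (Space d)) :
    slater f ∈ formDomain 0 G :=
  mem_formDomain_zero (slater_mem_antisym f) (slater_mem_bodyDomain hA hG hf)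

theorem bodyForm_slater (hA : IsSelfAdjoint G) (hG : H1 (Space d) ≤ (sqrtAbs G).domain)
    {f : Fin (n + 1) → L2 (Space d)} (hf : ∀ i, f i ∈ H1 (Space d)) (i : Fin (n + 1))
    (χ : bodyDomain G i) :
    bodyForm G i χ ⟨_, slater_mem_bodyDomain hA hG hf i⟩ =
      (√((n + 1).factorial : ℝ) : ℂ)⁻¹ * ∑ σ : Equiv.Perm (Fin (n + 1)), sgn σ *
        oneForm hG (contrH1 i (prodVec (i.removeNth (f ∘ σ))) χ) ⟨f (σ i), hf (σ i)⟩ := by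
  have h : (⟨_, slater_mem_bodyDomain hA hG hf i⟩ : bodyDomain G i) =
      (√((n + 1).factorial : ℝ) : ℂ)⁻¹ • ∑ σ : Equiv.Perm (Fin (n + 1)), sgn σ •
        (⟨_, prodVec_mem_bodyDomain hA hG (f := f ∘ σ) (fun i => hf (σ i)) i⟩ :
          bodyDomain G i) := by
    apply Subtype.ext
    simp [slater]
  rw [h]
  change bodyFormL G i χ _ = _
  rw [map_smul, map_sum, smul_eq_mul]
  congr 1
  refine Finset.sum_congr rfl fun σ _ => ?_
  rw [map_smul, smul_eq_mul]
  congr 1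
  exact bodyForm_prodVec hA hG (f := f ∘ σ) (fun i => hf (σ i)) i χ

theorem contr_slater {f : Fin (n + 1) → L2 (Space d)} (hf : Orthonormal ℂ f) (i : Fin (n + 1))
    (σ : Equiv.Perm (Fin (n + 1))) :
    contr i (prodVec (i.removeNth (f ∘ σ))) (slater f) =
      ((√((n + 1).factorial : ℝ) : ℂ)⁻¹ * sgn σ) • f (σ i) := by
  rw [slater, map_smul, map_sum, Finset.sum_eq_single σ, mul_smul]
  · rw [map_smul, prodVec_eq_tensorAt i (f ∘ σ), contr_tensorAt, inner_prodVec,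
      Finset.prod_eq_one, one_smul, Function.comp_apply]
    exact fun j _ => (orthonormal_iff_ite.1 hf _ _).trans (if_pos rfl)
  · intro τ _ hτ
    rw [map_smul, prodVec_eq_tensorAt i (f ∘ τ), contr_tensorAt, inner_prodVec]
    have : ∃ j, σ (i.succAbove j) ≠ τ (i.succAbove j) := by
      by_contra! h
      have h2 : ∀ k, k ≠ i → σ k = τ k := by
        intro k hk
        obtain ⟨j, rfl⟩ := Fin.exists_succAbove_eq hk
        exact h j
      refine hτ (Equiv.ext fun k => ?_)
      by_cases hk : k = i
      · subst hk
        obtain ⟨l, hl⟩ := τ.surjective (σ k)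
        rcases eq_or_ne l k with rfl | hlk
        · exact hl
        · rw [← h2 l hlk] at hl
          exact absurd (σ.injective hl) hlk
      · exact (h2 k hk).symm
    obtain ⟨j, hj⟩ := this
    rw [Finset.prod_eq_zero (Finset.mem_univ j), zero_smul, smul_zero]
    exact (orthonormal_iff_ite.1 hf _ _).trans (if_neg hj)
  · intro h
    exact absurd (Finset.mem_univ _) h

/-- The energy of a Slater determinant is the sum of the energies of its orbitals. -/
theorem hamForm_slater (hA : IsSelfAdjoint G) (hG : H1 (Space d) ≤ (sqrtAbs G).domain)
    {f : Fin (n + 1) → L2 (Space d)} (hf : ∀ i, f i ∈ H1 (Space d)) (ho : Orthonormal ℂ f) :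
    hamForm 0 G ⟨_, slater_mem_formDomain hA hG hf⟩ ⟨_, slater_mem_formDomain hA hG hf⟩ =
      ∑ i, oneForm hG ⟨f i, hf i⟩ ⟨f i, hf i⟩ := by
  set c : ℂ := (√((n + 1).factorial : ℝ) : ℂ)⁻¹ with hc
  have hcc : c * conj c * ((n + 1).factorial : ℂ) = 1 := by
    have h1 : (√((n + 1).factorial : ℝ) : ℂ) * (√((n + 1).factorial : ℝ) : ℂ) =
        ((n + 1).factorial : ℂ) := by
      rw [← Complex.ofReal_mul, Real.mul_self_sqrt (by positivity), Complex.ofReal_natCast]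
    have h2 : ((n + 1).factorial : ℂ) ≠ 0 := Nat.cast_ne_zero.2 (Nat.factorial_ne_zero _)
    rw [hc, map_inv₀, Complex.conj_ofReal, ← mul_inv, h1, inv_mul_cancel₀ h2]
  have h1 : ∀ i (σ : Equiv.Perm (Fin (n + 1))),
      contrH1 i (prodVec (i.removeNth (f ∘ σ))) ⟨_, slater_mem_bodyDomain hA hG hf i⟩ =
      (c * sgn σ) • (⟨f (σ i), hf (σ i)⟩ : H1 (Space d)) := fun i σ =>
    Subtype.ext (contr_slater ho i σ)
  rw [hamForm_zero, Finset.sum_congr rfl fun i _ => bodyForm_slater hA hG hf i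
    ⟨_, slater_mem_bodyDomain hA hG hf i⟩]
  simp only [h1, oneForm_smul_left hA, map_mul, conj_sgn]
  have h2 : ∀ i (σ : Equiv.Perm (Fin (n + 1))), sgn σ * (conj c * sgn σ *
      oneForm hG ⟨f (σ i), hf (σ i)⟩ ⟨f (σ i), hf (σ i)⟩) =
      conj c * oneForm hG ⟨f (σ i), hf (σ i)⟩ ⟨f (σ i), hf (σ i)⟩ := by
    intro i σ
    linear_combination (conj c * oneForm hG ⟨f (σ i), hf (σ i)⟩ ⟨f (σ i), hf (σ i)⟩) *
      sgn_mul_self σ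
  simp only [h2, ← Finset.mul_sum]
  rw [Finset.sum_comm]
  have h3 : ∀ σ : Equiv.Perm (Fin (n + 1)),
      ∑ i, oneForm hG ⟨f (σ i), hf (σ i)⟩ ⟨f (σ i), hf (σ i)⟩ =
      ∑ i, oneForm hG ⟨f i, hf i⟩ ⟨f i, hf i⟩ := fun σ =>
    Equiv.sum_comp σ fun i => oneForm hG ⟨f i, hf i⟩ ⟨f i, hf i⟩
  rw [Finset.sum_congr rfl fun σ _ => h3 σ, Finset.sum_const, Finset.card_univ, Fintype.card_perm,
    Fintype.card_fin, nsmul_eq_mul]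
  linear_combination (∑ i, oneForm hG ⟨f i, hf i⟩ ⟨f i, hf i⟩) * hcc

end Free

/-! ### Natural orbitals -/

section NaturalOrbitals

open Filter Topology

variable {d n : ℕ}

/-- A compact symmetric operator has a Hilbert basis of eigenvectors. -/
theorem exists_hilbertBasis_eigenvectors {E : Type} [NormedAddCommGroup E]
    [InnerProductSpace ℂ E] [CompleteSpace E] {T : E →L[ℂ] E} (hT : IsCompactOperator T)
    (hs : (T : E →ₗ[ℂ] E).IsSymmetric) :
    ∃ (ι : Type) (u : HilbertBasis ι ℂ E) (μ : ι → ℂ), ∀ k, T (u k) = μ k • u k := by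
  classical
  have hcomp : ∀ μ : ℂ, CompleteSpace (Module.End.eigenspace (T : Module.End ℂ E) μ) := fun μ => by
    have hc : IsClosed (Module.End.eigenspace (T : Module.End ℂ E) μ : Set E) := by
      have : (Module.End.eigenspace (T : Module.End ℂ E) μ : Set E) = {x | T x = μ • x} := by
        ext x
        exact Module.End.mem_eigenspace_iff
      rw [this]
      exact isClosed_eq T.continuous (continuous_const_smul μ)
    exact hc.completeSpace_coe
  choose w b hb using fun μ : ℂ =>
    exists_hilbertBasis ℂ (Module.End.eigenspace (T : Module.End ℂ E) μ)
  let v : (Σ μ, w μ) → E := fun q => b q.1 q.2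
  have hv : Orthonormal ℂ v :=
    hs.orthogonalFamily_eigenspaces.orthonormal_sigma_orthonormal fun μ => (b μ).orthonormal
  have hsp : (Submodule.span ℂ (Set.range v))ᗮ = ⊥ := by
    rw [eq_bot_iff, ← ContinuousLinearMap.orthogonalComplement_iSup_eigenspaces_eq_bot hT hs]
    intro x hx
    rw [Submodule.mem_orthogonal'] at hx ⊢
    intro y hy
    have key : ∀ μ, ∀ y ∈ Module.End.eigenspace (T : Module.End ℂ E) μ, ⟪x, y⟫_ℂ = 0 := by
      intro μ y hy
      set W := Module.End.eigenspace (T : Module.End ℂ E) μ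
      have h0 : W.orthogonalProjectionOnto x = 0 := by
        refine hilbertBasis_eq_zero (b μ) fun k => ?_
        rw [Submodule.inner_orthogonalProjectionOnto_eq_of_mem_left, ← inner_conj_symm,
          hx _ (Submodule.subset_span ⟨⟨μ, k⟩, rfl⟩), map_zero]
      have h1 := Submodule.inner_orthogonalProjectionOnto_eq_of_mem_left (⟨y, hy⟩ : W) x
      rw [h0, inner_zero_right] at h1
      rw [← inner_conj_symm, ← h1, map_zero]
    induction hy using Submodule.iSup_induction' with
    | mem μ y hy => exact key μ y hy
    | zero => exact inner_zero_right _
    | add y z _ _ hy hz => rw [inner_add_right, hy, hz, add_zero]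
  refine ⟨_, HilbertBasis.mkOfOrthogonalEqBot hv hsp, fun q => q.1, fun q => ?_⟩
  rw [HilbertBasis.coe_mkOfOrthogonalEqBot]
  exact Module.End.mem_eigenspace_iff.1 (b q.1 q.2).2

theorem annih_add (i : Fin (n + 1)) (u u' : L2 (Space d)) :
    annih (n := n) i (u + u') = annih i u + annih i u' := by
  have : tensorL (n := n) i (u + u') = tensorL i u + tensorL i u' := by
    ext1 v
    exact tensorAt_add_left i u u' v
  rw [annih, this, map_add]
  rfl

theorem annih_smul (i : Fin (n + 1)) (c : ℂ) (u : L2 (Space d)) :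
    annih (n := n) i (c • u) = conj c • annih i u := by
  have : tensorL (n := n) i (c • u) = c • tensorL i u := by
    ext1 v
    exact tensorAt_smul_left i c u v
  rw [annih, this]
  exact map_smulₛₗ ContinuousLinearMap.adjoint c _

theorem contr_add (i : Fin (n + 1)) (v v' : L2 (Config d n)) :
    contr i (v + v') = contr i v + contr i v' := by
  have : tensorR i (v + v') = tensorR i v + tensorR i v' := by
    ext1 u
    exact tensorAt_add_right i u v v'
  rw [contr, this, map_add]
  rfl

theorem contr_smul (i : Fin (n + 1)) (c : ℂ) (v : L2 (Config d n)) :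
    contr i (c • v) = conj c • contr i v := by
  have : tensorR i (c • v) = c • tensorR i v := by
    ext1 u
    exact tensorAt_smul_right i c u v
  rw [contr, this]
  exact map_smulₛₗ ContinuousLinearMap.adjoint c _

theorem norm_contr_le (i : Fin (n + 1)) (v : L2 (Config d n)) (ψ : L2 (Config d (n + 1))) :
    ‖contr i v ψ‖ ≤ ‖v‖ * ‖ψ‖ := by
  refine ((contr i v).le_opNorm ψ).trans (mul_le_mul_of_nonneg_right ?_ (norm_nonneg ψ))
  rw [contr, LinearIsometryEquiv.norm_map]
  exact ContinuousLinearMap.opNorm_le_bound _ (norm_nonneg v) fun u => by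
    rw [tensorR_apply, norm_tensorAt, mul_comm]

theorem norm_annih_le (i : Fin (n + 1)) (u : L2 (Space d)) (ψ : L2 (Config d (n + 1))) :
    ‖annih i u ψ‖ ≤ ‖u‖ * ‖ψ‖ := by
  refine ((annih i u).le_opNorm ψ).trans (mul_le_mul_of_nonneg_right ?_ (norm_nonneg ψ))
  rw [annih, LinearIsometryEquiv.norm_map]
  exact ContinuousLinearMap.opNorm_le_bound _ (norm_nonneg u) fun v => by
    rw [tensorL_apply, norm_tensorAt]

/-- The operator on the one-body space with kernel `∫ χ(x, z) conj (ψ(y, z)) dz`, as a function of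
`χ` and of its argument. -/
def densityL (ψ : L2 (Config d (n + 1))) :
    L2 (Config d (n + 1)) →L[ℂ] L2 (Space d) →L[ℂ] L2 (Space d) :=
  LinearMap.mkContinuous₂
    (LinearMap.mk₂ ℂ (fun χ u => contr 0 (annih 0 u ψ) χ)
      (fun χ χ' u => map_add _ _ _) (fun c χ u => map_smul _ _ _)
      (fun χ u u' => by rw [annih_add, _root_.add_apply, contr_add, _root_.add_apply])
      (fun c χ u => by
        rw [annih_smul, _root_.smul_apply, contr_smul, _root_.smul_apply, Complex.conj_conj]))
    ‖ψ‖ fun χ u => by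
      rw [LinearMap.mk₂_apply]
      refine (norm_contr_le _ _ _).trans ?_
      have := mul_le_mul_of_nonneg_right (norm_annih_le 0 u ψ) (norm_nonneg χ)
      linarith

theorem densityL_apply (ψ χ : L2 (Config d (n + 1))) (u : L2 (Space d)) :
    densityL ψ χ u = contr 0 (annih 0 u ψ) χ := rfl

/-- Density operators are compact: this is plain for tensor products, where the rank is one, and
passes to their closed span. -/
theorem isCompactOperator_densityL (ψ χ : L2 (Config d (n + 1))) :
    IsCompactOperator (densityL ψ χ) := by
  let S : Submodule ℂ (L2 (Config d (n + 1))) :=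
    { carrier := {χ | IsCompactOperator (densityL ψ χ)}
      add_mem' := fun {χ χ'} h h' => by
        change IsCompactOperator (densityL ψ (χ + χ'))
        rw [map_add]
        exact h.add h'
      zero_mem' := by
        change IsCompactOperator (densityL ψ 0)
        rw [map_zero]
        exact isCompactOperator_zero
      smul_mem' := fun c {χ} h => by
        change IsCompactOperator (densityL ψ (c • χ))
        rw [map_smul]
        exact h.smul c }
  have hS : IsClosed (S : Set (L2 (Config d (n + 1)))) :=
    isClosed_setOfPred_isCompactOperator.preimage (densityL ψ).continuous
  have htop : S = ⊤ := by
    rw [← hS.submodule_topologicalClosure_eq, Submodule.topologicalClosure_eq_top_iff,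
      Submodule.eq_bot_iff]
    intro x hx
    refine eq_zero_of_inner_tensorAt 0 fun u v => ?_
    refine (Submodule.mem_orthogonal S x).1 hx _ ?_
    change IsCompactOperator (densityL ψ (tensorAt 0 u v))
    have h1 : (densityL ψ (tensorAt 0 u v) : L2 (Space d) → L2 (Space d)) =
        (ContinuousLinearMap.toSpanSingleton ℂ u) ∘ (innerSL ℂ (contr 0 v ψ)) := by
      funext u'
      rw [densityL_apply, contr_tensorAt, Function.comp_apply,
        ContinuousLinearMap.toSpanSingleton_apply, innerSL_apply_apply, ← inner_conj_symm,
        inner_annih, ← inner_contr, inner_conj_symm]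
    rw [h1]
    exact (isCompactOperator_id.comp_clm (innerSL ℂ (contr 0 v ψ))).clm_comp _
  have hχ : χ ∈ S := htop ▸ Submodule.mem_top
  exact hχ

theorem inner_densityL (ψ : L2 (Config d (n + 1))) (u u' : L2 (Space d)) :
    ⟪u', densityL ψ ψ u⟫_ℂ = ⟪annih 0 u ψ, annih 0 u' ψ⟫_ℂ := by
  rw [densityL_apply, inner_contr, ← inner_annih]

/-- The natural orbitals of `ψ`: a Hilbert basis `u` such that the functions `annih 0 (u k) ψ` are
mutually orthogonal. -/
theorem exists_naturalOrbitals (ψ : L2 (Config d (n + 1))) :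
    ∃ (ι : Type) (u : HilbertBasis ι ℂ (L2 (Space d))),
      ∀ k l, k ≠ l → ⟪annih 0 (u k) ψ, annih 0 (u l) ψ⟫_ℂ = 0 := by
  obtain ⟨ι, u, μ, h⟩ := exists_hilbertBasis_eigenvectors (isCompactOperator_densityL ψ ψ)
    (fun x y => by
      change ⟪densityL ψ ψ x, y⟫_ℂ = ⟪x, densityL ψ ψ y⟫_ℂ
      rw [← inner_conj_symm, inner_densityL, inner_densityL, inner_conj_symm])
  refine ⟨ι, u, fun k l hkl => ?_⟩
  rw [← inner_densityL, h, inner_smul_right, u.orthonormal.2 hkl.symm, mul_zero]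

end NaturalOrbitals

/-! ### Noninteracting ground states are Slater determinants -/

section FreeGroundState

open Filter Topology

variable {d n : ℕ} {G : L2 (Space d) →ₗ.[ℂ] L2 (Space d)}

open Classical in
/-- The energy of an orbital, and `0` if it is not in `H¹`. -/
def orbitalEnergy (hG : H1 (Space d) ≤ (sqrtAbs G).domain) (u : L2 (Space d)) : ℝ :=
  if h : u ∈ H1 (Space d) then (oneForm hG ⟨u, h⟩ ⟨u, h⟩).re else 0

theorem orbitalEnergy_of_mem (hG : H1 (Space d) ≤ (sqrtAbs G).domain) {u : L2 (Space d)}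
    (h : u ∈ H1 (Space d)) : orbitalEnergy hG u = (oneForm hG ⟨u, h⟩ ⟨u, h⟩).re :=
  dif_pos h

theorem oneForm_smul_self (hA : IsSelfAdjoint G) (hG : H1 (Space d) ≤ (sqrtAbs G).domain) (c : ℂ)
    (f : H1 (Space d)) :
    (oneForm hG (c • f) (c • f)).re = ‖c‖ ^ 2 * (oneForm hG f f).re := by
  have h : oneForm hG (c • f) (c • f) = ((‖c‖ ^ 2 : ℝ) : ℂ) * oneForm hG f f := by
    rw [oneForm_smul_right, oneForm_smul_left hA, ← mul_assoc, Complex.mul_conj,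
      Complex.normSq_eq_norm_sq]
  rw [h, Complex.re_ofReal_mul]

theorem inner_contr_eq (i : Fin (n + 1)) (u : L2 (Space d)) (v : L2 (Config d n))
    (ψ : L2 (Config d (n + 1))) : ⟪u, contr i v ψ⟫_ℂ = ⟪v, annih i u ψ⟫_ℂ := by
  rw [inner_contr, inner_annih]

/-- If `w_k = annih 0 (u k) ψ` are the mutually orthogonal partners of the natural orbitals then the
contraction of `ψ` against `w_k` is a multiple of `u k`. -/
theorem contr_annih_natural {ι : Type} (u : HilbertBasis ι ℂ (L2 (Space d)))
    {ψ : L2 (Config d (n + 1))}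
    (ho : ∀ k l, k ≠ l → ⟪annih 0 (u k) ψ, annih 0 (u l) ψ⟫_ℂ = 0) (k : ι) :
    contr 0 (annih 0 (u k) ψ) ψ = ((‖annih 0 (u k) ψ‖ ^ 2 : ℝ) : ℂ) • u k := by
  rw [← sub_eq_zero]
  refine hilbertBasis_eq_zero u fun l => ?_
  rw [inner_sub_right, inner_contr_eq, inner_smul_right, sub_eq_zero]
  rcases eq_or_ne k l with rfl | hkl
  · rw [inner_self_eq_norm_sq_to_K, inner_self_eq_norm_sq_to_K, u.orthonormal.1 k]
    simp
  · rw [ho k l hkl, u.orthonormal.2 hkl.symm, mul_zero]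

theorem natural_mem_H1 {ι : Type} (u : HilbertBasis ι ℂ (L2 (Space d)))
    {ψ : L2 (Config d (n + 1))} (hψ : ψ ∈ H1 (Config d (n + 1)))
    (ho : ∀ k l, k ≠ l → ⟪annih 0 (u k) ψ, annih 0 (u l) ψ⟫_ℂ = 0) {k : ι}
    (hk : annih 0 (u k) ψ ≠ 0) : u k ∈ H1 (Space d) := by
  have h := contr_annih_natural u ho k
  have hn : ((‖annih 0 (u k) ψ‖ ^ 2 : ℝ) : ℂ) ≠ 0 :=
    Complex.ofReal_ne_zero.2 (pow_ne_zero _ (norm_ne_zero_iff.2 hk))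
  rw [← inv_smul_smul₀ hn (u k), ← h]
  exact Submodule.smul_mem _ _ (contr_mem_H1 0 hψ _)

/-- The form of `-Δ_0 + G_0` is diagonal in the natural orbitals. -/
theorem hasSum_bodyForm_natural (hA : IsSelfAdjoint G) (hG : H1 (Space d) ≤ (sqrtAbs G).domain)
    {ι : Type} (u : HilbertBasis ι ℂ (L2 (Space d))) (ψ : bodyDomain (n := n) G 0)
    (ho : ∀ k l, k ≠ l → ⟪annih 0 (u k) (ψ : L2 (Config d (n + 1))),
      annih 0 (u l) (ψ : L2 (Config d (n + 1)))⟫_ℂ = 0) :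
    HasSum (fun k => ‖annih 0 (u k) (ψ : L2 (Config d (n + 1)))‖ ^ 2 * orbitalEnergy hG (u k))
      (bodyForm G 0 ψ ψ).re := by
  -- the nonzero partners `w k`, normalized and completed to a Hilbert basis `b`, diagonalize the form:
  -- `ψ` contracts to `‖w k‖ u k` against the normalized partner, and to `0` against the rest of `b`
  set w : ι → L2 (Config d n) := fun k => annih 0 (u k) (ψ : L2 (Config d (n + 1))) with hw
  let e : {k // w k ≠ 0} → L2 (Config d n) := fun k => ((‖w k‖⁻¹ : ℝ) : ℂ) • w k
  have he : Orthonormal ℂ e := by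
    refine ⟨fun k => ?_, fun k l hkl => ?_⟩
    · rw [norm_smul, Complex.norm_real, norm_inv, norm_norm,
        inv_mul_cancel₀ (norm_ne_zero_iff.2 k.2)]
    · change ⟪((‖w k‖⁻¹ : ℝ) : ℂ) • w k, ((‖w l‖⁻¹ : ℝ) : ℂ) • w l⟫_ℂ = 0
      rw [inner_smul_left, inner_smul_right, ho k l (Subtype.coe_ne_coe.2 hkl), mul_zero, mul_zero]
  obtain ⟨W, b, hsub, hb⟩ := he.toSubtypeRange.exists_hilbertBasis_extension
  let g : {k // w k ≠ 0} → W := fun k => ⟨e k, hsub ⟨k, rfl⟩⟩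
  have hginj : Function.Injective g := fun k l h => he.linearIndependent.injective
    (congrArg Subtype.val h)
  have hbg : ∀ k, b (g k) = e k := fun k => by rw [hb]
  have hsum := Complex.hasSum_re (hasSum_bodyForm hA hG 0 b ψ ψ)
  rw [← hginj.hasSum_iff] at hsum
  · have hterm : ∀ k : {k // w k ≠ 0},
        (oneForm hG (contrH1 0 (b (g k)) ψ) (contrH1 0 (b (g k)) ψ)).re =
          ‖w k‖ ^ 2 * orbitalEnergy hG (u k) := by
      intro k
      have hk : u k ∈ H1 (Space d) := natural_mem_H1 u ψ.2.1 ho k.2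
      have hn : ‖w k‖ ≠ 0 := norm_ne_zero_iff.2 k.2
      have h1 : contrH1 0 (b (g k)) ψ = ((‖w k‖ : ℝ) : ℂ) • (⟨u k, hk⟩ : H1 (Space d)) := by
        apply Subtype.ext
        change contr 0 (b (g k)) (ψ : L2 (Config d (n + 1))) = ((‖w k‖ : ℝ) : ℂ) • u k
        rw [hbg, contr_smul, _root_.smul_apply, contr_annih_natural u ho, smul_smul,
          Complex.conj_ofReal, ← Complex.ofReal_mul]
        congr 2
        change ‖w k‖⁻¹ * ‖w k‖ ^ 2 = ‖w k‖
        field_simp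
      rw [h1, oneForm_smul_self hA, orbitalEnergy_of_mem hG hk, Complex.norm_real, norm_norm]
    have h2 : HasSum ((fun k => ‖w k‖ ^ 2 * orbitalEnergy hG (u k)) ∘
        (Subtype.val : {k // w k ≠ 0} → ι)) (bodyForm G 0 ψ ψ).re :=
      hsum.congr_fun fun k => (hterm k).symm
    rw [Subtype.val_injective.hasSum_iff] at h2
    · exact h2
    · intro k hk
      have : w k = 0 := by
        by_contra h0
        exact hk ⟨⟨k, h0⟩, rfl⟩
      rw [this, norm_zero, zero_pow two_ne_zero, zero_mul]
  · intro x hx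
    have h0 : contrH1 0 (b x) ψ = (0 : ℂ) • contrH1 0 (b x) ψ := by
      rw [zero_smul]
      refine Subtype.ext (hilbertBasis_eq_zero u fun l => ?_)
      change ⟪u l, contr 0 (b x) (ψ : L2 (Config d (n + 1)))⟫_ℂ = 0
      rw [inner_contr_eq]
      by_cases hl : w l = 0
      · rw [show annih 0 (u l) (ψ : L2 (Config d (n + 1))) = 0 from hl, inner_zero_right]
      · have h1 : ⟪b x, b (g ⟨l, hl⟩)⟫_ℂ = 0 :=
          b.orthonormal.2 fun h => hx ⟨_, h.symm⟩
        rw [hbg, inner_smul_right] at h1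
        exact (mul_eq_zero.1 h1).resolve_left
          (Complex.ofReal_ne_zero.2 (inv_ne_zero (norm_ne_zero_iff.2 hl)))
    rw [h0, oneForm_smul_right, zero_mul, Complex.zero_re]

/-- By antisymmetry all particles have the same energy. -/
theorem bodyForm_antisym (hA : IsSelfAdjoint G) (hG : H1 (Space d) ≤ (sqrtAbs G).domain)
    (i : Fin (n + 1)) {ψ : L2 (Config d (n + 1))} (hψ : ψ ∈ antisym d (n + 1))
    (h0 : ψ ∈ bodyDomain G 0) (hi : ψ ∈ bodyDomain G i) :
    bodyForm G i ⟨ψ, hi⟩ ⟨ψ, hi⟩ = bodyForm G 0 ⟨ψ, h0⟩ ⟨ψ, h0⟩ := by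
  obtain ⟨W, b, -⟩ := exists_hilbertBasis ℂ (L2 (Config d n))
  refine (hasSum_bodyForm hA hG i b ⟨ψ, hi⟩ ⟨ψ, hi⟩).unique
    ((hasSum_bodyForm hA hG 0 b ⟨ψ, h0⟩ ⟨ψ, h0⟩).congr_fun fun k => ?_)
  have h : contrH1 i (b k) ⟨ψ, hi⟩ = (-1 : ℂ) ^ (i : ℕ) • contrH1 0 (b k) ⟨ψ, h0⟩ :=
    Subtype.ext (contr_antisym i (b k) hψ)
  rw [h, oneForm_smul_right, oneForm_smul_left hA, ← mul_assoc, map_pow, map_neg, map_one,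
    ← mul_pow, neg_one_mul, neg_neg, one_pow, one_mul]

theorem norm_annih_antisym (i : Fin (n + 1)) (u : L2 (Space d)) {ψ : L2 (Config d (n + 1))}
    (hψ : ψ ∈ antisym d (n + 1)) : ‖annih i u ψ‖ = ‖annih 0 u ψ‖ := by
  rw [annih_antisym i u hψ, norm_smul, norm_pow, norm_neg, norm_one, one_pow, one_mul]

theorem inner_prodVec_insertNth {ι : Type} (u : ι → L2 (Space d)) (i : Fin (n + 1)) (k : ι)
    (β : Fin n → ι) (ψ : L2 (Config d (n + 1))) :
    ⟪prodVec (u ∘ (i.insertNth k β : Fin (n + 1) → ι)), ψ⟫_ℂ =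
      ⟪prodVec (u ∘ β), annih i (u k) ψ⟫_ℂ := by
  rw [inner_annih, prodVec_eq_tensorAt i]
  have h1 : (u ∘ (i.insertNth k β : Fin (n + 1) → ι)) i = u k := by simp
  have h2 : i.removeNth (u ∘ (i.insertNth k β : Fin (n + 1) → ι)) = u ∘ β := by
    funext j
    simp [Fin.removeNth]
  rw [h1, h2]

/-- One-body weights summed over the variable `x_i` are summed over the coefficients of `ψ` in a
product basis. -/
theorem hasSum_prodVec_coeff {ι : Type} (u : HilbertBasis ι ℂ (L2 (Space d))) (i : Fin (n + 1))
    {ψ : L2 (Config d (n + 1))} {m : ι → ℝ} {S : ℝ}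
    (h : HasSum (fun k => ‖annih i (u k) ψ‖ ^ 2 * m k) S) :
    HasSum (fun α : Fin (n + 1) → ι => ‖⟪prodVec (u ∘ α), ψ⟫_ℂ‖ ^ 2 * m (α i)) S := by
  set f : ι × (Fin n → ι) → ℝ := fun q =>
    ‖⟪prodVec (u ∘ q.2), annih i (u q.1) ψ⟫_ℂ‖ ^ 2 * m q.1 with hf
  have hfib : ∀ k, HasSum (fun β : Fin n → ι => ‖⟪prodVec (u ∘ β), annih i (u k) ψ⟫_ℂ‖ ^ 2)
      (‖annih i (u k) ψ‖ ^ 2) := by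
    intro k
    have := hasSum_norm_sq (prodBasis n u) (annih i (u k) ψ)
    simpa only [prodBasis_apply] using this
  have hsumm : Summable f := by
    rw [← summable_abs_iff, summable_prod_of_nonneg fun q => abs_nonneg (f q)]
    have h2 : ∀ k, HasSum (fun β => |f (k, β)|) (‖annih i (u k) ψ‖ ^ 2 * |m k|) := by
      intro k
      refine ((hfib k).mul_right |m k|).congr_fun fun β => ?_
      rw [hf, abs_mul, abs_of_nonneg (sq_nonneg _)]
    refine ⟨fun k => (h2 k).summable, ?_⟩
    refine h.summable.abs.congr fun k => ?_
    rw [(h2 k).tsum_eq, abs_mul, abs_of_nonneg (sq_nonneg _)]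
  have h3 := hsumm.hasSum.prod_fiberwise fun k => (hfib k).mul_right (m k)
  have h4 : HasSum f S := h.unique h3 ▸ hsumm.hasSum
  rw [← (Fin.insertNthEquiv (fun _ => ι) i).hasSum_iff]
  refine h4.congr_fun fun q => ?_
  change ‖⟪prodVec (u ∘ (i.insertNth q.1 q.2 : Fin (n + 1) → ι)), ψ⟫_ℂ‖ ^ 2 *
    m ((i.insertNth q.1 q.2 : Fin (n + 1) → ι) i) = f q
  rw [inner_prodVec_insertNth, Fin.insertNth_apply_same]

/-- The energy of `ψ` is the average of the energies of the configurations of natural orbitals,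
with weights the squared coefficients of `ψ`. -/
theorem hasSum_hamForm_natural (hA : IsSelfAdjoint G) (hG : H1 (Space d) ≤ (sqrtAbs G).domain)
    {ι : Type} (u : HilbertBasis ι ℂ (L2 (Space d))) (ψ : formDomain (n := n) 0 G)
    (ho : ∀ k l, k ≠ l → ⟪annih 0 (u k) (ψ : L2 (Config d (n + 1))),
      annih 0 (u l) (ψ : L2 (Config d (n + 1)))⟫_ℂ = 0) :
    HasSum (fun α : Fin (n + 1) → ι => ‖⟪prodVec (u ∘ α), (ψ : L2 (Config d (n + 1)))⟫_ℂ‖ ^ 2 *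
      ∑ i, orbitalEnergy hG (u (α i))) (hamForm 0 G ψ ψ).re := by
  have hanti : (ψ : L2 (Config d (n + 1))) ∈ antisym d (n + 1) := ψ.2.1.1.1
  simp only [hamForm_zero, Complex.re_sum, Finset.mul_sum]
  refine hasSum_sum fun i _ => hasSum_prodVec_coeff u i (m := fun k => orbitalEnergy hG (u k)) ?_
  rw [bodyForm_antisym hA hG i hanti (formDomain_le_bodyDomain 0 0 ψ.2)]
  simp only [norm_annih_antisym i _ hanti]
  exact hasSum_bodyForm_natural hA hG u
    ⟨(ψ : L2 (Config d (n + 1))), formDomain_le_bodyDomain 0 0 ψ.2⟩ ho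

/-- A configuration of natural orbitals that contributes to a noninteracting ground state and whose
energy is at most the average yields a Slater determinant which is a ground state. -/
theorem exists_slater_groundState (hA : IsSelfAdjoint G)
    (hG : H1 (Space d) ≤ (sqrtAbs G).domain) {ψ : L2 (Config d (n + 1))}
    (hψ : IsGroundState 0 G ψ) :
    ∃ f : Fin (n + 1) → L2 (Space d), Orthonormal ℂ f ∧ (∀ i, f i ∈ H1 (Space d)) ∧
      IsGroundState 0 G (slater f) := by
  obtain ⟨ι, u, ho⟩ := exists_naturalOrbitals ψ
  have hanti : ψ ∈ antisym d (n + 1) := hψ.1.1.1.1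
  set E := (hamForm 0 G ⟨ψ, hψ.1⟩ ⟨ψ, hψ.1⟩).re
  have h1 := hasSum_hamForm_natural hA hG u ⟨ψ, hψ.1⟩ ho
  have h2 := hasSum_norm_sq (prodBasis (n + 1) u) ψ
  simp only [prodBasis_apply] at h2
  rw [hψ.2.1, one_pow] at h2
  obtain ⟨α, hα, hE⟩ : ∃ α : Fin (n + 1) → ι, ⟪prodVec (u ∘ α), ψ⟫_ℂ ≠ 0 ∧
      ∑ i, orbitalEnergy hG (u (α i)) ≤ E := by
    -- if all contributing configurations had energy above the average `E`, then `ψ` would vanish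
    by_contra! hcon
    have h3 := h1.sub (h2.mul_right E)
    rw [one_mul, sub_self] at h3
    have h4 : ∀ α : Fin (n + 1) → ι, 0 ≤ ‖⟪prodVec (u ∘ α), ψ⟫_ℂ‖ ^ 2 *
        ∑ i, orbitalEnergy hG (u (α i)) - ‖⟪prodVec (u ∘ α), ψ⟫_ℂ‖ ^ 2 * E := by
      intro α
      rw [← mul_sub]
      by_cases h0 : ⟪prodVec (u ∘ α), ψ⟫_ℂ = 0
      · simp [h0]
      · exact mul_nonneg (sq_nonneg _) (sub_nonneg.2 (hcon α h0).le)
    have h5 := (hasSum_zero_iff_of_nonneg h4).1 h3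
    have h6 : ∀ α : Fin (n + 1) → ι, ‖⟪prodVec (u ∘ α), ψ⟫_ℂ‖ ^ 2 = 0 := by
      intro α
      have h7 := congrFun h5 α
      simp only [Pi.zero_apply, ← mul_sub] at h7
      by_cases h0 : ⟪prodVec (u ∘ α), ψ⟫_ℂ = 0
      · simp [h0]
      · exact (mul_eq_zero.1 h7).resolve_right (sub_pos.2 (hcon α h0)).ne'
    simp only [h6] at h2
    exact one_ne_zero (h2.unique hasSum_zero)
  -- by antisymmetry, no orbital occurs twice in the configuration
  have hinj : Function.Injective α := by
    have := not_imp_comm.1 (fun h => inner_prodVec_eq_zero (f := u ∘ α) h hanti) hα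
    exact this.of_comp
  -- orbitals with a nonzero coefficient inherit the regularity of `ψ`
  have hmem : ∀ i, (u ∘ α) i ∈ H1 (Space d) := by
    intro i
    refine natural_mem_H1 u hψ.1.1.1.2 ho fun h0 => hα ?_
    have h3 := inner_prodVec_insertNth u i (α i) (i.removeNth α) ψ
    rw [Fin.insertNth_self_removeNth, annih_antisym i _ hanti, h0, smul_zero,
      inner_zero_right] at h3
    exact h3
  have hon : Orthonormal ℂ (u ∘ α) := u.orthonormal.comp α hinj
  refine ⟨u ∘ α, hon, hmem, slater_mem_formDomain hA hG hmem, norm_slater hon, fun χ hχ => ?_⟩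
  refine le_trans ?_ (hψ.2.2 χ hχ)
  rw [hamForm_slater hA hG hmem hon, Complex.re_sum]
  refine le_trans (le_of_eq (Finset.sum_congr rfl fun i _ => ?_)) hE
  exact (orbitalEnergy_of_mem hG (hmem i)).symm

theorem annih_slater_eq_zero {f : Fin (n + 1) → L2 (Space d)} {φ : L2 (Space d)}
    (h : ∀ i, ⟪φ, f i⟫_ℂ = 0) : annih 0 φ (slater f) = 0 := by
  rw [slater, map_smul, map_sum, Finset.sum_eq_zero, smul_zero]
  intro σ _
  rw [map_smul, prodVec_succ, annih_tensorAt, Function.comp_apply, h, zero_smul, smul_zero]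

/-- In positive dimension, finitely many orbitals leave room for an orthogonal function in `H¹`. -/
theorem exists_H1_orthogonal (hd : 1 ≤ d) {N : ℕ} (f : Fin N → L2 (Space d)) :
    ∃ φ ∈ H1 (Space d), ‖φ‖ = 1 ∧ ∀ i, ⟪φ, f i⟫_ℂ = 0 := by
  obtain ⟨θ, h1, h2⟩ := exists_test_disjoint hd
  have ho : Orthonormal ℂ fun j : Fin (N + 1) => testL2 (θ j) :=
    ⟨fun j => h1 j, fun j k hjk => inner_testL2_eq_zero (h2 j k (Fin.val_ne_of_ne hjk))⟩
  -- `N + 1` independent functions against `N` linear conditions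
  let L : (Fin (N + 1) → ℂ) →ₗ[ℂ] (Fin N → ℂ) :=
    LinearMap.pi fun i => ∑ j : Fin (N + 1), ⟪f i, testL2 (θ j)⟫_ℂ • LinearMap.proj j
  obtain ⟨c, hc, hc0⟩ := (Submodule.ne_bot_iff _).1 (LinearMap.ker_ne_bot_of_finrank_lt (f := L)
    (by simp))
  set x : L2 (Space d) := ∑ j : Fin (N + 1), c j • testL2 (θ j) with hx
  have hx0 : x ≠ 0 := fun h => hc0 (by
    have := Fintype.linearIndependent_iff.1 ho.linearIndependent c h
    exact funext this)
  have hxH : x ∈ H1 (Space d) :=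
    Submodule.sum_mem _ fun j _ => Submodule.smul_mem _ _ (testL2_mem_H1 _)
  have hxf : ∀ i, ⟪f i, x⟫_ℂ = 0 := by
    intro i
    have := congrFun (LinearMap.mem_ker.1 hc) i
    simp only [L, LinearMap.pi_apply, LinearMap.sum_apply, LinearMap.smul_apply,
      LinearMap.proj_apply, Pi.zero_apply, smul_eq_mul] at this
    rw [hx, inner_sum, ← this]
    refine Finset.sum_congr rfl fun j _ => ?_
    rw [inner_smul_right, mul_comm]
  refine ⟨((‖x‖⁻¹ : ℝ) : ℂ) • x, Submodule.smul_mem _ _ hxH, ?_, fun i => ?_⟩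
  · rw [norm_smul, Complex.norm_real, norm_inv, norm_norm,
      inv_mul_cancel₀ (norm_ne_zero_iff.2 hx0)]
  · rw [inner_smul_left, ← inner_conj_symm, hxf, map_zero, mul_zero]

theorem isSlater_smul {f : Fin (n + 1) → L2 (Space d)} (hf : Orthonormal ℂ f) {c : ℂ}
    (hc : ‖c‖ = 1) : IsSlater (c • slater f) := by
  classical
  -- the phase is absorbed in the first orbital
  refine ⟨Function.update f 0 (c • f 0), ⟨fun i => ?_, fun i j hij => ?_⟩, ?_⟩
  · rcases eq_or_ne i 0 with rfl | hi
    · rw [Function.update_self, norm_smul, hc, hf.1, one_mul]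
    · rw [Function.update_of_ne hi, hf.1]
  · rcases eq_or_ne i 0 with rfl | hi
    · rw [Function.update_self, Function.update_of_ne hij.symm, inner_smul_left, hf.2 hij, mul_zero]
    · rw [Function.update_of_ne hi]
      rcases eq_or_ne j 0 with rfl | hj
      · rw [Function.update_self, inner_smul_right, hf.2 hij, mul_zero]
      · rw [Function.update_of_ne hj, hf.2 hij]
  · have h : ∀ᵐ x : Config d (n + 1), ∀ j, (c • f 0) (x j) = c * f 0 (x j) := by
      rw [ae_all_iff]
      intro j
      filter_upwards [(quasi_apply j).ae (Lp.coeFn_smul c (f 0))] with x hx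
      rw [hx, Pi.smul_apply, smul_eq_mul]
    filter_upwards [Lp.coeFn_smul c (slater f), slater_coeFn f, h] with x h1 h2 h3
    rw [h1, Pi.smul_apply, h2, smul_eq_mul, mul_left_comm]
    congr 1
    have h4 : (Matrix.of fun i j => (Function.update f 0 (c • f 0) i) (x j)) =
        (Matrix.of fun i j => f i (x j)).updateRow 0
          (c • (Matrix.of fun i j => f i (x j)) 0) := by
      ext i j
      rcases eq_or_ne i 0 with rfl | hi
      · rw [Matrix.updateRow_self, Matrix.of_apply, Function.update_self, h3]
        rfl
      · rw [Matrix.updateRow_ne hi, Matrix.of_apply, Function.update_of_ne hi, Matrix.of_apply]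
    rw [h4, Matrix.det_updateRow_smul, Matrix.updateRow_eq_self]

/-- Noninteracting nondegenerate ground states are Slater determinants, whose orbitals leave room
for an orthogonal function in `H¹`. -/
theorem IsUniqueGroundState.isSlater (hd : 1 ≤ d) (hA : IsSelfAdjoint G)
    (hG : H1 (Space d) ≤ (sqrtAbs G).domain) {ψ : L2 (Config d (n + 1))}
    (hψ : IsUniqueGroundState 0 G ψ) :
    IsSlater ψ ∧ ∃ φ ∈ H1 (Space d), ‖φ‖ = 1 ∧ WedgeOrthogonal φ ψ := by
  obtain ⟨f, hf, -, hs⟩ := exists_slater_groundState hA hG hψ.1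
  obtain ⟨c, hc⟩ := hψ.2 _ hs
  have hn : ‖c‖ = 1 := by
    have := norm_slater hf
    rwa [hc, norm_smul, hψ.1.2.1, mul_one] at this
  have hc0 : c ≠ 0 := fun h => by simp [h] at hn
  have hψs : ψ = c⁻¹ • slater f := by rw [hc, inv_smul_smul₀ hc0]
  refine ⟨?_, ?_⟩
  · rw [hψs]
    exact isSlater_smul hf (by rw [norm_inv, hn, inv_one])
  · obtain ⟨φ, h1, h2, h3⟩ := exists_H1_orthogonal hd f
    refine ⟨φ, h1, h2, ?_⟩
    rw [wedgeOrthogonal_iff φ hψ.1.1.1.1.1, hψs, map_smul, annih_slater_eq_zero h3, smul_zero]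

end FreeGroundState

/-! ### A finite rank potential with a gapped shell -/

section Shell

open Filter Topology

variable {d n : ℕ}

/-- The function `-Δθ` of a test function, as an element of `L²`. -/
def negLap (θ : Test (Space d)) : L2 (Space d) :=
  -∑ a : Fin d, testL2 ((θ.deriv (EuclideanSpace.single a (1 : ℝ))).deriv
    (EuclideanSpace.single a (1 : ℝ)))

/-- `‖∇θ‖²`. -/
def testGradSq (θ : Test (Space d)) : ℝ :=
  ∑ a : Fin d, ‖testL2 (θ.deriv (EuclideanSpace.single a (1 : ℝ)))‖ ^ 2

theorem sum_inner_derivH1_test (θ : Test (Space d)) (g : H1 (Space d)) :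
    ∑ a : Fin d, ⟪derivH1 (EuclideanSpace.single a (1 : ℝ)) ⟨testL2 θ, testL2_mem_H1 θ⟩,
      derivH1 (EuclideanSpace.single a (1 : ℝ)) g⟫_ℂ = ⟪negLap θ, (g : L2 (Space d))⟫_ℂ := by
  rw [negLap, inner_neg_left, sum_inner, ← Finset.sum_neg_distrib]
  refine Finset.sum_congr rfl fun a _ => ?_
  rw [derivH1_eq (f := ⟨testL2 θ, testL2_mem_H1 θ⟩) (testL2_mem_weakDerivGraph _ θ)]
  rw [(mem_weakDerivGraph_iff _ _).1 (derivH1_mem (EuclideanSpace.single a (1 : ℝ)) g)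
    (θ.deriv (EuclideanSpace.single a (1 : ℝ))), neg_neg]

theorem inner_negLap_test (θ η : Test (Space d)) :
    ⟪negLap θ, testL2 η⟫_ℂ = ∑ a : Fin d, ⟪testL2 (θ.deriv (EuclideanSpace.single a (1 : ℝ))),
      testL2 (η.deriv (EuclideanSpace.single a (1 : ℝ)))⟫_ℂ := by
  have h := sum_inner_derivH1_test θ ⟨testL2 η, testL2_mem_H1 η⟩
  rw [← h]
  refine Finset.sum_congr rfl fun a _ => ?_
  rw [derivH1_eq (f := ⟨testL2 θ, testL2_mem_H1 θ⟩) (testL2_mem_weakDerivGraph _ θ),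
    derivH1_eq (f := ⟨testL2 η, testL2_mem_H1 η⟩) (testL2_mem_weakDerivGraph _ η)]

/-- Normalized test functions with disjoint supports. -/
structure IsShell {N : ℕ} (θ : Fin N → Test (Space d)) : Prop where
  norm_eq_one : ∀ j, ‖testL2 (θ j)‖ = 1
  disjoint : ∀ j k, j ≠ k → Disjoint (tsupport (θ j).1) (tsupport (θ k).1)

theorem IsShell.orthonormal {N : ℕ} {θ : Fin N → Test (Space d)} (h : IsShell θ) :
    Orthonormal ℂ fun j => testL2 (θ j) :=
  ⟨h.norm_eq_one, fun j k hjk => inner_testL2_eq_zero (h.disjoint j k hjk)⟩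

theorem IsShell.inner_negLap {N : ℕ} {θ : Fin N → Test (Space d)} (h : IsShell θ) (j k : Fin N) :
    ⟪negLap (θ j), testL2 (θ k)⟫_ℂ = if j = k then (testGradSq (θ k) : ℂ) else 0 := by
  rw [inner_negLap_test]
  split_ifs with hjk
  · subst hjk
    rw [testGradSq, Complex.ofReal_sum]
    refine Finset.sum_congr rfl fun a _ => ?_
    rw [inner_self_eq_norm_sq_to_K]
    norm_cast
  · exact Finset.sum_eq_zero fun a _ => inner_testL2_eq_zero
      ((h.disjoint j k hjk).mono (tsupport_deriv_subset _ _) (tsupport_deriv_subset _ _))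

/-- The finite rank potential `-(ΠT + TΠ) + ΠTΠ - Π`, with `T = -Δ` and `Π` the projector onto the
span of the `θ j`. For such test functions with disjoint supports `ΠTΠ` is diagonal. Together with
the kinetic energy it decouples the span of the `θ j`, which is turned into the eigenspace of
eigenvalue `-1`, from its orthogonal complement, on which it vanishes. -/
def shellPot {N : ℕ} (θ : Fin N → Test (Space d)) : L2 (Space d) →L[ℂ] L2 (Space d) :=
  ∑ j, (((testGradSq (θ j) - 1 : ℝ) : ℂ) •
      InnerProductSpace.rankOne ℂ (testL2 (θ j)) (testL2 (θ j)) -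
    InnerProductSpace.rankOne ℂ (negLap (θ j)) (testL2 (θ j)) -
    InnerProductSpace.rankOne ℂ (testL2 (θ j)) (negLap (θ j)))

/-- The action of `shellPot` on the variable `x_i`. -/
def shellLift {N : ℕ} (θ : Fin N → Test (Space d)) (i : Fin (n + 1)) :
    L2 (Config d (n + 1)) →L[ℂ] L2 (Config d (n + 1)) :=
  ∑ j, (((testGradSq (θ j) - 1 : ℝ) : ℂ) •
      (tensorL i (testL2 (θ j)) ∘L annih i (testL2 (θ j))) -
    tensorL i (negLap (θ j)) ∘L annih i (testL2 (θ j)) -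
    tensorL i (testL2 (θ j)) ∘L annih i (negLap (θ j)))

theorem contr_shellLift {N : ℕ} (θ : Fin N → Test (Space d)) (i : Fin (n + 1))
    (v : L2 (Config d n)) (ψ : L2 (Config d (n + 1))) :
    contr i v (shellLift θ i ψ) = shellPot θ (contr i v ψ) := by
  simp only [shellLift, shellPot, _root_.sum_apply, _root_.sub_apply, _root_.smul_apply, map_sum,
    map_sub, map_smul, contr_rankOne]

theorem inner_shellPot {N : ℕ} (θ : Fin N → Test (Space d)) (f g : L2 (Space d)) :
    ⟪f, shellPot θ g⟫_ℂ = ∑ j, (((testGradSq (θ j) - 1 : ℝ) : ℂ) *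
      (⟪testL2 (θ j), g⟫_ℂ * ⟪f, testL2 (θ j)⟫_ℂ) -
      ⟪testL2 (θ j), g⟫_ℂ * ⟪f, negLap (θ j)⟫_ℂ -
      ⟪negLap (θ j), g⟫_ℂ * ⟪f, testL2 (θ j)⟫_ℂ) := by
  simp only [shellPot, _root_.sum_apply, _root_.sub_apply, _root_.smul_apply, inner_sum,
    inner_sub_right, inner_smul_right, InnerProductSpace.rankOne_apply]

theorem isSelfAdjoint_shellPot {N : ℕ} (θ : Fin N → Test (Space d)) :
    IsSelfAdjoint (shellPot θ) := by
  rw [ContinuousLinearMap.isSelfAdjoint_iff_isSymmetric]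
  intro f g
  change ⟪shellPot θ f, g⟫_ℂ = ⟪f, shellPot θ g⟫_ℂ
  rw [← inner_conj_symm, inner_shellPot, inner_shellPot, map_sum]
  refine Finset.sum_congr rfl fun j _ => ?_
  simp only [map_sub, map_mul, Complex.conj_ofReal, inner_conj_symm]
  ring

theorem H1_le_shell {N : ℕ} (θ : Fin N → Test (Space d)) :
    H1 (Space d) ≤ (sqrtAbs (ofBounded (shellPot θ))).domain :=
  fun x _ => mem_sqrtAbs_domain_ofBounded (isSelfAdjoint_shellPot θ) x

theorem oneForm_shell {N : ℕ} (θ : Fin N → Test (Space d)) (f g : H1 (Space d)) :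
    oneForm (H1_le_shell θ) f g = ∑ a : Fin d,
      ⟪derivH1 (EuclideanSpace.single a (1 : ℝ)) f, derivH1 (EuclideanSpace.single a (1 : ℝ)) g⟫_ℂ +
      ⟪(f : L2 (Space d)), shellPot θ g⟫_ℂ := by
  rw [oneForm, opForm_ofBounded (isSelfAdjoint_shellPot θ)]

/-- The elements of the shell are eigenvectors of the one-body operator with eigenvalue `-1`. -/
theorem IsShell.oneForm_right {N : ℕ} {θ : Fin N → Test (Space d)} (h : IsShell θ)
    (f : H1 (Space d)) (k : Fin N) :
    oneForm (H1_le_shell θ) f ⟨testL2 (θ k), testL2_mem_H1 (θ k)⟩ =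
      -⟪(f : L2 (Space d)), testL2 (θ k)⟫_ℂ := by
  have h1 : ∑ a : Fin d, ⟪derivH1 (EuclideanSpace.single a (1 : ℝ)) f,
      derivH1 (EuclideanSpace.single a (1 : ℝ)) ⟨testL2 (θ k), testL2_mem_H1 (θ k)⟩⟫_ℂ =
      ⟪(f : L2 (Space d)), negLap (θ k)⟫_ℂ := by
    have := congrArg conj (sum_inner_derivH1_test (θ k) f)
    simpa only [map_sum, inner_conj_symm] using this
  rw [oneForm_shell, h1, inner_shellPot, Finset.sum_eq_single k]
  · rw [h.inner_negLap, if_pos rfl, inner_self_eq_norm_sq_to_K, h.norm_eq_one]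
    push_cast
    ring
  · intro j _ hjk
    rw [h.inner_negLap, if_neg hjk, h.orthonormal.2 hjk]
    ring
  · exact fun hk => absurd (Finset.mem_univ k) hk

theorem oneForm_add_right {G : L2 (Space d) →ₗ.[ℂ] L2 (Space d)}
    (hG : H1 (Space d) ≤ (sqrtAbs G).domain) (f g g' : H1 (Space d)) :
    oneForm hG f (g + g') = oneForm hG f g + oneForm hG f g' := by
  have h := opForm_add_right (A := G) ⟨f, hG f.2⟩ ⟨g, hG g.2⟩ ⟨g', hG g'.2⟩
  simp only [oneForm, derivH1_add, inner_add_right, Finset.sum_add_distrib]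
  rw [show opForm G ⟨f, hG f.2⟩ ⟨↑(g + g'), hG (g + g').2⟩ = _ from h]
  ring

/-- The one-body operator is bounded below by minus the projector onto the shell. -/
theorem IsShell.le_oneForm {N : ℕ} {θ : Fin N → Test (Space d)} (h : IsShell θ)
    (f : H1 (Space d)) :
    -∑ j, ‖⟪testL2 (θ j), (f : L2 (Space d))⟫_ℂ‖ ^ 2 ≤ (oneForm (H1_le_shell θ) f f).re := by
  have hA := isSelfAdjoint_ofBounded (isSelfAdjoint_shellPot θ)
  set c : Fin N → ℂ := fun j => ⟪testL2 (θ j), (f : L2 (Space d))⟫_ℂ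
  -- `p` is the component of `f` in the shell, an eigenvector of the one-body operator; the
  -- potential does not act on the complement `g`, where only the kinetic energy remains
  set p : H1 (Space d) := ∑ j, c j • ⟨testL2 (θ j), testL2_mem_H1 (θ j)⟩ with hp
  set g : H1 (Space d) := f - p with hg
  have hpc : (p : L2 (Space d)) = ∑ j, c j • testL2 (θ j) := by
    rw [hp]
    simp
  have hcg : ∀ k, ⟪testL2 (θ k), (g : L2 (Space d))⟫_ℂ = 0 := by
    intro k
    rw [hg, Submodule.coe_sub, inner_sub_right, hpc, h.orthonormal.inner_right_fintype, sub_self]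
  have hright : ∀ q : H1 (Space d), oneForm (H1_le_shell θ) q p =
      -⟪(q : L2 (Space d)), (p : L2 (Space d))⟫_ℂ := by
    intro q
    have hind : ∀ s : Finset (Fin N), oneForm (H1_le_shell θ) q
        (∑ j ∈ s, c j • ⟨testL2 (θ j), testL2_mem_H1 (θ j)⟩) =
        -∑ j ∈ s, c j * ⟪(q : L2 (Space d)), testL2 (θ j)⟫_ℂ := by
      classical
      intro s
      induction s using Finset.induction_on with
      | empty =>
        have := oneForm_smul_right (H1_le_shell θ) 0 q 0
        rw [zero_smul, zero_mul] at this
        rw [Finset.sum_empty, Finset.sum_empty, neg_zero]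
        exact this
      | insert k s hk ih =>
        rw [Finset.sum_insert hk, Finset.sum_insert hk, oneForm_add_right, ih, oneForm_smul_right,
          h.oneForm_right]
        ring
    rw [hp, hind, ← hp, hpc, inner_sum]
    simp only [inner_smul_right]
  have hgp : ⟪(g : L2 (Space d)), (p : L2 (Space d))⟫_ℂ = 0 := by
    rw [hpc, inner_sum]
    refine Finset.sum_eq_zero fun j _ => ?_
    rw [inner_smul_right, ← inner_conj_symm, hcg, map_zero, mul_zero]
  have hpp : ⟪(p : L2 (Space d)), (p : L2 (Space d))⟫_ℂ = ((∑ j, ‖c j‖ ^ 2 : ℝ) : ℂ) := by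
    rw [hpc, h.orthonormal.inner_sum, Complex.ofReal_sum]
    refine Finset.sum_congr rfl fun j _ => ?_
    rw [← Complex.normSq_eq_conj_mul_self, Complex.normSq_eq_norm_sq]
  have hgg : 0 ≤ (oneForm (H1_le_shell θ) g g).re := by
    rw [oneForm_shell, inner_shellPot]
    have h0 : ∀ j, ⟪(g : L2 (Space d)), testL2 (θ j)⟫_ℂ = 0 := fun j => by
      rw [← inner_conj_symm, hcg, map_zero]
    simp only [hcg, h0, zero_mul, mul_zero, sub_zero, Finset.sum_const_zero, add_zero,
      Complex.re_sum]
    exact Finset.sum_nonneg fun a _ => inner_self_nonneg (𝕜 := ℂ)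
  have hfg : f = g + p := by rw [hg, sub_add_cancel]
  have hexp : oneForm (H1_le_shell θ) f f = oneForm (H1_le_shell θ) g g -
      ((∑ j, ‖c j‖ ^ 2 : ℝ) : ℂ) := by
    have h1 : oneForm (H1_le_shell θ) f p = -((∑ j, ‖c j‖ ^ 2 : ℝ) : ℂ) := by
      rw [hright, hfg, Submodule.coe_add, inner_add_left, hgp, zero_add, hpp]
    have h2 : oneForm (H1_le_shell θ) f g = oneForm (H1_le_shell θ) g g := by
      rw [← oneForm_conj hA, hfg, oneForm_add_right, hright, hgp, neg_zero, add_zero,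
        oneForm_conj hA]
    have h3 : oneForm (H1_le_shell θ) f f = oneForm (H1_le_shell θ) f (g + p) := by rw [← hfg]
    rw [h3, oneForm_add_right, h1, h2]
    ring
  rw [hexp, Complex.sub_re, Complex.ofReal_re]
  linarith

end Shell

/-! ### The filled shell -/

section FilledShell

open Filter Topology

variable {d n : ℕ}

/-- The Slater determinant of the shell. -/
def shellState (θ : Fin (n + 1) → Test (Space d)) : L2 (Config d (n + 1)) :=
  slater fun j => testL2 (θ j)

theorem shellState_mem_formDomain (θ : Fin (n + 1) → Test (Space d)) :
    shellState θ ∈ formDomain (n := n) 0 (ofBounded (shellPot θ)) :=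
  slater_mem_formDomain (isSelfAdjoint_ofBounded (isSelfAdjoint_shellPot θ)) (H1_le_shell θ)
    fun j => testL2_mem_H1 (θ j)

/-- The filled shell is an eigenvector, of eigenvalue minus the number of particles. -/
theorem IsShell.hamForm_shellState {θ : Fin (n + 1) → Test (Space d)} (h : IsShell θ)
    (χ : formDomain (n := n) 0 (ofBounded (shellPot θ))) :
    hamForm 0 (ofBounded (shellPot θ)) χ ⟨_, shellState_mem_formDomain θ⟩ =
      -((n + 1 : ℕ) : ℂ) * ⟪(χ : L2 (Config d (n + 1))), shellState θ⟫_ℂ := by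
  have hA := isSelfAdjoint_ofBounded (isSelfAdjoint_shellPot θ)
  set f : Fin (n + 1) → L2 (Space d) := fun j => testL2 (θ j) with hf
  have hfH : ∀ j, f j ∈ H1 (Space d) := fun j => testL2_mem_H1 (θ j)
  rw [hamForm_zero]
  have h1 : ∀ i, bodyForm (ofBounded (shellPot θ)) i
      ⟨(χ : L2 (Config d (n + 1))), formDomain_le_bodyDomain 0 i χ.2⟩
      ⟨shellState θ, formDomain_le_bodyDomain 0 i (shellState_mem_formDomain θ)⟩ =
      -⟪(χ : L2 (Config d (n + 1))), shellState θ⟫_ℂ := by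
    intro i
    refine (bodyForm_slater hA (H1_le_shell θ) hfH i
      ⟨(χ : L2 (Config d (n + 1))), formDomain_le_bodyDomain 0 i χ.2⟩).trans ?_
    rw [shellState, slater, inner_smul_right, inner_sum, ← mul_neg, ← Finset.sum_neg_distrib]
    congr 1
    refine Finset.sum_congr rfl fun σ _ => ?_
    rw [inner_smul_right, ← mul_neg]
    congr 1
    refine (h.oneForm_right _ (σ i)).trans ?_
    rw [neg_inj, prodVec_eq_tensorAt i (f ∘ σ), ← inner_conj_symm, ← inner_conj_symm (𝕜 := ℂ)
      (χ : L2 (Config d (n + 1))), ← inner_contr]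
    rfl
  rw [Finset.sum_congr rfl fun i _ => h1 i, Finset.sum_const, Finset.card_univ, Fintype.card_fin,
    nsmul_eq_mul]
  ring

/-- The one-body bound `IsShell.le_oneForm`, summed over the particles: the energy is at least minus the
expected number of particles in the shell. -/
theorem IsShell.le_hamForm {θ : Fin (n + 1) → Test (Space d)} (h : IsShell θ)
    (ψ : formDomain (n := n) 0 (ofBounded (shellPot θ))) :
    -∑ i, ∑ j, ‖annih i (testL2 (θ j)) (ψ : L2 (Config d (n + 1)))‖ ^ 2 ≤
      (hamForm 0 (ofBounded (shellPot θ)) ψ ψ).re := by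
  have hA := isSelfAdjoint_ofBounded (isSelfAdjoint_shellPot θ)
  rw [hamForm_zero, Complex.re_sum, ← Finset.sum_neg_distrib]
  refine Finset.sum_le_sum fun i _ => ?_
  obtain ⟨W, e, -⟩ := exists_hilbertBasis ℂ (L2 (Config d n))
  have h1 := Complex.hasSum_re (hasSum_bodyForm hA (H1_le_shell θ) i e
    ⟨(ψ : L2 (Config d (n + 1))), formDomain_le_bodyDomain 0 i ψ.2⟩
    ⟨(ψ : L2 (Config d (n + 1))), formDomain_le_bodyDomain 0 i ψ.2⟩)
  have h2 : HasSum (fun k => -∑ j, ‖⟪e k, annih i (testL2 (θ j))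
      (ψ : L2 (Config d (n + 1)))⟫_ℂ‖ ^ 2)
      (-∑ j, ‖annih i (testL2 (θ j)) (ψ : L2 (Config d (n + 1)))‖ ^ 2) :=
    (hasSum_sum fun j _ => hasSum_norm_sq e _).neg
  refine hasSum_le (fun k => ?_) h2 h1
  refine le_trans (le_of_eq ?_) (h.le_oneForm _)
  congr 1
  refine Finset.sum_congr rfl fun j _ => ?_
  rw [← inner_contr_eq]
  rfl

/-- A function orthogonal to the filled shell has at most `n` of its `n + 1` particles in the
shell. -/
theorem sum_annih_le {φ : Fin (n + 1) → L2 (Space d)} (hφ : Orthonormal ℂ φ)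
    {ψ : L2 (Config d (n + 1))} (hψ : ψ ∈ antisym d (n + 1)) (h0 : ⟪slater φ, ψ⟫_ℂ = 0) :
    ∑ i, ∑ j, ‖annih i (φ j) ψ‖ ^ 2 ≤ n * ‖ψ‖ ^ 2 := by
  classical
  -- the `φ j` are completed to a Hilbert basis `b`; `m` is the indicator function of the shell
  obtain ⟨W, b, hsub, hb⟩ := hφ.toSubtypeRange.exists_hilbertBasis_extension
  let g : Fin (n + 1) → W := fun j => ⟨φ j, hsub ⟨j, rfl⟩⟩
  have hginj : Function.Injective g := fun k l h => hφ.linearIndependent.injective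
    (congrArg Subtype.val h)
  have hbg : ∀ j, b (g j) = φ j := fun j => by rw [hb]
  let m : W → ℝ := fun k => if k ∈ Set.range g then 1 else 0
  have h1 : ∀ i, HasSum (fun k => ‖annih i (b k) ψ‖ ^ 2 * m k) (∑ j, ‖annih i (φ j) ψ‖ ^ 2) := by
    intro i
    rw [← hginj.hasSum_iff]
    · refine (hasSum_fintype _).congr_fun fun j => ?_
      simp only [Function.comp_apply, hbg, m, Set.mem_range_self, if_true, mul_one]
    · intro k hk
      simp only [m, if_neg hk, mul_zero]
  have h2 := hasSum_sum fun i (_ : i ∈ Finset.univ) => hasSum_prodVec_coeff b i (h1 i)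
  have h3 := hasSum_norm_sq (prodBasis (n + 1) b) ψ
  simp only [prodBasis_apply] at h3
  refine hasSum_le (fun α => ?_) h2 (h3.mul_left (n : ℝ))
  rw [← Finset.mul_sum, mul_comm]
  by_cases hc : ⟪prodVec (b ∘ α), ψ⟫_ℂ = 0
  · simp [hc]
  refine mul_le_mul_of_nonneg_right ?_ (sq_nonneg _)
  -- a configuration with all particles in the shell is a permutation of the shell, and its coefficient
  -- is that of the Slater determinant
  have hex : ∃ i, α i ∉ Set.range g := by
    by_contra! hall
    choose σ hσ using hall
    have hinj : Function.Injective α := by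
      have := not_imp_comm.1 (fun h => inner_prodVec_eq_zero (f := b ∘ α) h hψ) hc
      exact this.of_comp
    have hσinj : Function.Injective σ := fun i j hij => hinj (by rw [← hσ i, ← hσ j, hij])
    let τ : Equiv.Perm (Fin (n + 1)) :=
      Equiv.ofBijective σ (Finite.injective_iff_bijective.1 hσinj)
    have he : b ∘ α = φ ∘ τ := by
      funext i
      rw [Function.comp_apply, ← hσ i, hbg]
      rfl
    rw [he, inner_prodVec_comp τ φ hψ] at hc
    rw [inner_slater φ hψ, mul_eq_zero] at h0
    rcases h0 with h0 | h0
    · exact absurd h0 (Complex.ofReal_ne_zero.2 (by positivity))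
    · rw [h0, mul_zero] at hc
      exact hc rfl
  obtain ⟨i, hi⟩ := hex
  have hle : ∀ k, m k ≤ 1 := fun k => by
    simp only [m]
    split_ifs <;> norm_num
  rw [← Finset.add_sum_erase _ _ (Finset.mem_univ i), show m (α i) = 0 from if_neg hi, zero_add]
  refine (Finset.sum_le_card_nsmul _ _ 1 fun k _ => hle _).trans ?_
  rw [Finset.card_erase_of_mem (Finset.mem_univ i), Finset.card_univ, Fintype.card_fin]
  simp

/-- The energy gap above the filled shell. -/
theorem IsShell.le_hamForm_of_orthogonal {θ : Fin (n + 1) → Test (Space d)} (h : IsShell θ)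
    (ψ : formDomain (n := n) 0 (ofBounded (shellPot θ)))
    (h0 : ⟪shellState θ, (ψ : L2 (Config d (n + 1)))⟫_ℂ = 0) :
    -(n * ‖(ψ : L2 (Config d (n + 1)))‖ ^ 2) ≤ (hamForm 0 (ofBounded (shellPot θ)) ψ ψ).re :=
  (neg_le_neg (sum_annih_le h.orthonormal ψ.2.1.1.1 h0)).trans (h.le_hamForm ψ)

theorem norm_shellState {θ : Fin (n + 1) → Test (Space d)} (h : IsShell θ) :
    ‖shellState θ‖ = 1 := norm_slater h.orthonormal

theorem IsShell.hamForm_self {θ : Fin (n + 1) → Test (Space d)} (h : IsShell θ) :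
    (hamForm (n := n) 0 (ofBounded (shellPot θ)) ⟨_, shellState_mem_formDomain θ⟩
      ⟨_, shellState_mem_formDomain θ⟩).re = -(n + 1) := by
  rw [h.hamForm_shellState]
  simp only [inner_self_eq_norm_sq_to_K, norm_shellState h]
  simp

/-- The energy exceeds that of the filled shell by the norm squared of the component orthogonal to it.
Uniqueness of the ground state follows. -/
theorem IsShell.le_hamForm_add {θ : Fin (n + 1) → Test (Space d)} (h : IsShell θ)
    (ψ : formDomain (n := n) 0 (ofBounded (shellPot θ))) :
    -(n + 1) * ‖(ψ : L2 (Config d (n + 1)))‖ ^ 2 +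
      ‖(ψ : L2 (Config d (n + 1))) - ⟪shellState θ, (ψ : L2 (Config d (n + 1)))⟫_ℂ •
        shellState θ‖ ^ 2 ≤ (hamForm 0 (ofBounded (shellPot θ)) ψ ψ).re := by
  have hA := isSelfAdjoint_ofBounded (isSelfAdjoint_shellPot θ)
  have hw : AEStronglyMeasurable (0 : Space d → ℝ) volume := aestronglyMeasurable_zero
  set Φ : formDomain (n := n) 0 (ofBounded (shellPot θ)) :=
    ⟨_, shellState_mem_formDomain θ⟩ with hΦ
  set a : ℂ := ⟪shellState θ, (ψ : L2 (Config d (n + 1)))⟫_ℂ with ha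
  set χ : formDomain (n := n) 0 (ofBounded (shellPot θ)) := ψ - a • Φ with hχ
  have hΦn : ⟪shellState θ, shellState θ⟫_ℂ = 1 := by
    rw [inner_self_eq_norm_sq_to_K, norm_shellState h]
    simp
  have hχ0 : ⟪shellState θ, (χ : L2 (Config d (n + 1)))⟫_ℂ = 0 := by
    change ⟪shellState θ, (ψ : L2 (Config d (n + 1))) - a • shellState θ⟫_ℂ = 0
    rw [inner_sub_right, inner_smul_right, hΦn, mul_one, ← ha, sub_self]
  have hχ0' : ⟪(χ : L2 (Config d (n + 1))), shellState θ⟫_ℂ = 0 := by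
    rw [← inner_conj_symm, hχ0, map_zero]
  have hψ : ψ = a • Φ + χ := by rw [hχ, add_sub_cancel]
  have hψc : (ψ : L2 (Config d (n + 1))) = a • shellState θ + χ := congrArg Subtype.val hψ
  have h1 : hamForm 0 (ofBounded (shellPot θ)) χ Φ = 0 := by
    rw [h.hamForm_shellState, hχ0', mul_zero]
  have h2 : hamForm 0 (ofBounded (shellPot θ)) Φ χ = 0 := by
    rw [← hamForm_conj hA, h1, map_zero]
  have h3 : hamForm 0 (ofBounded (shellPot θ)) ψ χ = hamForm 0 (ofBounded (shellPot θ)) χ χ := by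
    rw [← hamForm_conj hA, hψ, hamForm_add_right hw, hamForm_smul_right, h1, mul_zero, zero_add,
      hamForm_conj hA]
  have h4 : hamForm 0 (ofBounded (shellPot θ)) ψ ψ =
      ((-(n + 1) * ‖a‖ ^ 2 : ℝ) : ℂ) + hamForm 0 (ofBounded (shellPot θ)) χ χ := by
    have e : hamForm 0 (ofBounded (shellPot θ)) ψ ψ =
        hamForm 0 (ofBounded (shellPot θ)) ψ (a • Φ + χ) := by rw [← hψ]
    rw [e, hamForm_add_right hw, h3, hamForm_smul_right, h.hamForm_shellState, ← inner_conj_symm,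
      ← ha]
    congr 1
    have : a * conj a = ((‖a‖ ^ 2 : ℝ) : ℂ) := by
      rw [Complex.mul_conj, Complex.normSq_eq_norm_sq]
    push_cast at this ⊢
    linear_combination (-((n : ℂ) + 1)) * this
  have h5 : ‖(ψ : L2 (Config d (n + 1)))‖ ^ 2 = ‖a‖ ^ 2 + ‖(χ : L2 (Config d (n + 1)))‖ ^ 2 := by
    rw [hψc, sq, norm_add_sq_eq_norm_sq_add_norm_sq_of_inner_eq_zero _ _ (𝕜 := ℂ)
      (by rw [inner_smul_left, hχ0, mul_zero]), norm_smul, norm_shellState h, mul_one]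
    ring
  have h6 := h.le_hamForm_of_orthogonal χ hχ0
  rw [h4, Complex.add_re, Complex.ofReal_re, h5]
  change _ + ‖(χ : L2 (Config d (n + 1)))‖ ^ 2 ≤ _
  linarith

theorem IsShell.isUniqueGroundState {θ : Fin (n + 1) → Test (Space d)} (h : IsShell θ) :
    IsUniqueGroundState 0 (ofBounded (shellPot θ)) (shellState θ) := by
  refine ⟨⟨shellState_mem_formDomain θ, norm_shellState h, fun χ hχ => ?_⟩, fun χ hχ => ?_⟩
  · rw [h.hamForm_self]
    have h1 := h.le_hamForm_add χ
    rw [hχ] at h1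
    nlinarith [sq_nonneg ‖(χ : L2 (Config d (n + 1))) -
      ⟪shellState θ, (χ : L2 (Config d (n + 1)))⟫_ℂ • shellState θ‖]
  · have h1 := h.le_hamForm_add ⟨χ, hχ.1⟩
    have h2 := hχ.2.2 ⟨_, shellState_mem_formDomain θ⟩ (norm_shellState h)
    rw [h.hamForm_self] at h2
    simp only [hχ.2.1] at h1
    refine ⟨⟪shellState θ, χ⟫_ℂ, ?_⟩
    rw [← sub_eq_zero, ← norm_eq_zero, ← sq_eq_zero_iff]
    exact le_antisymm (by linarith) (sq_nonneg _)

theorem IsShell.groundEnergy_eq {θ : Fin (n + 1) → Test (Space d)} (h : IsShell θ) :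
    groundEnergy n 0 (ofBounded (shellPot θ)) = -(n + 1) := by
  rw [h.isUniqueGroundState.1.groundEnergy_eq, h.hamForm_self]

end FilledShell

/-! ### The filled shell is isolated in the spectrum -/

section Isolation

open Filter Topology

variable {d n : ℕ}

/-- The Lax–Milgram theorem for a form `∑ ⟪D_m y, D_m x⟫ + ⟪ι y, (B - z) ι x⟫` on a space whose
norm is the graph norm of `D`: if the form with `z = 0` is bounded below by `c` in the norm of
`K`, and `Re z < c`, then the form with `z` is coercive in the graph norm. -/
theorem exists_bounded_weak_solution {V K I : Type*} [NormedAddCommGroup V]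
    [InnerProductSpace ℂ V] [CompleteSpace V] [NormedAddCommGroup K] [InnerProductSpace ℂ K]
    [CompleteSpace K] [Fintype I] (ι : V →L[ℂ] K) (D : I → V →L[ℂ] K) (B : K →L[ℂ] K)
    (hV : ∀ x, ‖x‖ ^ 2 = ‖ι x‖ ^ 2 + ∑ m, ‖D m x‖ ^ 2) {c : ℝ}
    (hc : ∀ x, c * ‖ι x‖ ^ 2 ≤ ∑ m, ‖D m x‖ ^ 2 + (⟪ι x, B (ι x)⟫_ℂ).re) {z : ℂ}
    (hz : z.re < c) : ∃ S : K →L[ℂ] V, ∀ y η,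
      ∑ m, ⟪D m y, D m (S η)⟫_ℂ + ⟪ι y, B (ι (S η))⟫_ℂ - z * ⟪ι y, ι (S η)⟫_ℂ =
        ⟪ι y, η⟫_ℂ := by
  set A : V →L[ℂ] V := ∑ m, (D m).adjoint ∘L D m +
    ι.adjoint ∘L ((B - z • ContinuousLinearMap.id ℂ K) ∘L ι) with hA
  have hAi : ∀ y x, ⟪y, A x⟫_ℂ =
      ∑ m, ⟪D m y, D m x⟫_ℂ + ⟪ι y, B (ι x)⟫_ℂ - z * ⟪ι y, ι x⟫_ℂ := by
    intro y x
    simp only [hA, _root_.add_apply, _root_.sum_apply, ContinuousLinearMap.comp_apply,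
      _root_.sub_apply, _root_.smul_apply, ContinuousLinearMap.id_apply, inner_add_right,
      inner_sum, ContinuousLinearMap.adjoint_inner_right, inner_sub_right, inner_smul_right]
    ring
  have hunit : IsUnit A := by
    set g : ℝ := c - z.re with hg
    have hg0 : 0 < g := by linarith
    -- interpolation between the lower bound `c` and the graph norm, with weight `t`
    set t : ℝ := g / (1 + ‖B‖ + |c| + g) with ht
    have ht0 : 0 < t := by positivity
    have ht1 : t ≤ 1 := by
      rw [ht, div_le_one (by positivity)]
      linarith [norm_nonneg B, abs_nonneg c]
    have htg : t * (1 + ‖B‖ + |c|) ≤ g := by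
      rw [ht, div_mul_eq_mul_div, div_le_iff₀ (by positivity)]
      nlinarith
    refine ContinuousLinearMap.isUnit_of_forall_le_norm_inner_map _ (c := ⟨t, ht0.le⟩) ht0
      fun x => ?_
    rw [← norm_inner_symm]
    refine le_trans ?_ (Complex.re_le_norm _)
    have h3 : (z * ⟪ι x, ι x⟫_ℂ).re = z.re * ‖ι x‖ ^ 2 := by
      have : ⟪ι x, ι x⟫_ℂ = ((‖ι x‖ ^ 2 : ℝ) : ℂ) := by
        rw [inner_self_eq_norm_sq_to_K]
        push_cast
        rfl
      rw [this, Complex.re_mul_ofReal]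
    have h5 : -(‖B‖ * ‖ι x‖ ^ 2) ≤ (⟪ι x, B (ι x)⟫_ℂ).re := by
      have h6 := (Complex.abs_re_le_norm _).trans (norm_inner_le_norm (𝕜 := ℂ) (ι x) (B (ι x)))
      have h7 := mul_le_mul_of_nonneg_left (B.le_opNorm (ι x)) (norm_nonneg (ι x))
      have h8 := neg_le_of_abs_le (h6.trans h7)
      nlinarith
    have hD : (∑ m, ⟪D m x, D m x⟫_ℂ).re = ∑ m, ‖D m x‖ ^ 2 := by
      rw [Complex.re_sum]
      exact Finset.sum_congr rfl fun m _ => inner_self_eq_norm_sq (𝕜 := ℂ) _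
    rw [hAi, Complex.sub_re, Complex.add_re, h3, hD, hV]
    have h4 := hc x
    set X : ℝ := ‖ι x‖ ^ 2
    set Y : ℝ := ∑ m, ‖D m x‖ ^ 2
    set b : ℝ := (⟪ι x, B (ι x)⟫_ℂ).re
    change (X + Y) * t ≤ Y + b - z.re * X
    have hX0 : 0 ≤ X := sq_nonneg _
    have e1 : t * (Y - ‖B‖ * X) ≤ t * (Y + b) :=
      mul_le_mul_of_nonneg_left (by linarith) ht0.le
    have e2 := mul_le_mul_of_nonneg_left h4 (sub_nonneg.2 ht1)
    have e3 := mul_le_mul_of_nonneg_right htg hX0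
    have e4 : t * X * c ≤ t * X * |c| :=
      mul_le_mul_of_nonneg_left (le_abs_self c) (by positivity)
    have e5 : c * X = g * X + z.re * X := by rw [hg]; ring
    nlinarith
  obtain ⟨U, hU⟩ := hunit
  refine ⟨(↑U⁻¹ : V →L[ℂ] V) ∘L ι.adjoint, fun y η => ?_⟩
  have h1 : (A * ↑U⁻¹) (ι.adjoint η) = ι.adjoint η := by
    rw [← hU, U.mul_inv]
    rfl
  rw [← hAi, ← ContinuousLinearMap.adjoint_inner_right, ← h1]
  rfl

theorem mem_formDomain_shell (θ : Fin (n + 1) → Test (Space d)) {ψ : L2 (Config d (n + 1))}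
    (h1 : ψ ∈ antisym d (n + 1)) (h2 : ψ ∈ H1 (Config d (n + 1))) :
    ψ ∈ formDomain (n := n) 0 (ofBounded (shellPot θ)) := by
  refine mem_formDomain_zero h1 fun i => ⟨h2, ?_⟩
  have hB := isSelfAdjoint_shellPot θ
  rw [liftAt_ofBounded i hB (contr_shellLift θ i)]
  exact mem_sqrtAbs_domain_ofBounded (isSelfAdjoint_of_contr i hB (contr_shellLift θ i)) _

theorem hamForm_shell (θ : Fin (n + 1) → Test (Space d))
    (χ ψ : formDomain (n := n) 0 (ofBounded (shellPot θ))) :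
    hamForm 0 (ofBounded (shellPot θ)) χ ψ =
      ∑ m : Fin (n + 1) × Fin d, ⟪derivH1 (dir m.1 m.2) ⟨χ, χ.2.1.1.2⟩,
        derivH1 (dir m.1 m.2) ⟨ψ, ψ.2.1.1.2⟩⟫_ℂ +
      ⟪(χ : L2 (Config d (n + 1))), (∑ i, shellLift θ i) (ψ : L2 (Config d (n + 1)))⟫_ℂ := by
  have hB := isSelfAdjoint_shellPot θ
  have h1 : ∀ i : Fin (n + 1), opForm (liftAt i (ofBounded (shellPot θ)))
      ⟨χ, (Submodule.mem_iInf _).1 χ.2.1.2 i⟩ ⟨ψ, (Submodule.mem_iInf _).1 ψ.2.1.2 i⟩ =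
      ⟪(χ : L2 (Config d (n + 1))), shellLift θ i (ψ : L2 (Config d (n + 1)))⟫_ℂ := by
    intro i
    have key : ∀ (T : L2 (Config d (n + 1)) →ₗ.[ℂ] L2 (Config d (n + 1)))
        (_ : T = ofBounded (shellLift θ i)) (h1 : (χ : L2 (Config d (n + 1))) ∈
          (sqrtAbs T).domain) (h2 : (ψ : L2 (Config d (n + 1))) ∈ (sqrtAbs T).domain),
        opForm T ⟨χ, h1⟩ ⟨ψ, h2⟩ =
          ⟪(χ : L2 (Config d (n + 1))), shellLift θ i (ψ : L2 (Config d (n + 1)))⟫_ℂ := by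
      rintro _ rfl h1 h2
      exact opForm_ofBounded (isSelfAdjoint_of_contr i hB (contr_shellLift θ i)) _ _
    exact key _ (liftAt_ofBounded i hB (contr_shellLift θ i)) _ _
  simp only [hamForm, h1, Pi.zero_apply, Complex.ofReal_zero, zero_mul, integral_zero,
    Finset.sum_const_zero, add_zero, _root_.sum_apply, inner_sum, Fintype.sum_prod_type]

/-- The Hilbert space of `H¹` functions orthogonal to the filled shell, as the closed space of
tuples `(ψ, ∂ψ)` consisting of a function and its partial derivatives. -/
def gapSpace (θ : Fin (n + 1) → Test (Space d)) :
    Submodule ℂ (PiLp 2 fun _ : Option (Fin (n + 1) × Fin d) => L2 (Config d (n + 1))) :=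
  (antisym d (n + 1)).comap (PiLp.proj 2 (𝕜 := ℂ) _ none).toLinearMap ⊓
    (ℂ ∙ shellState θ)ᗮ.comap (PiLp.proj 2 (𝕜 := ℂ) _ none).toLinearMap ⊓
    ⨅ m : Fin (n + 1) × Fin d, (weakDerivGraph (dir m.1 m.2)).comap
      ((PiLp.proj 2 (𝕜 := ℂ) _ none).prod (PiLp.proj 2 (𝕜 := ℂ) _ (some m))).toLinearMap

theorem mem_gapSpace (θ : Fin (n + 1) → Test (Space d))
    (x : PiLp 2 fun _ : Option (Fin (n + 1) × Fin d) => L2 (Config d (n + 1))) :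
    x ∈ gapSpace θ ↔ (x none ∈ antisym d (n + 1) ∧ ⟪shellState θ, x none⟫_ℂ = 0) ∧
      ∀ m, (x none, x (some m)) ∈ weakDerivGraph (dir m.1 m.2) := by
  rw [gapSpace, Submodule.mem_inf, Submodule.mem_inf, Submodule.mem_iInf]
  simp only [Submodule.mem_comap]
  rw [Submodule.mem_orthogonal_singleton_iff_inner_right]
  rfl

theorem isClosed_gapSpace (θ : Fin (n + 1) → Test (Space d)) :
    IsClosed (gapSpace θ : Set (PiLp 2 fun _ : Option (Fin (n + 1) × Fin d) =>
      L2 (Config d (n + 1)))) := by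
  have h0 : ∀ o, Continuous fun x : PiLp 2 fun _ : Option (Fin (n + 1) × Fin d) =>
      L2 (Config d (n + 1)) => x o := fun o => (PiLp.proj 2 (𝕜 := ℂ) _ o).continuous
  have h : (gapSpace θ : Set (PiLp 2 fun _ : Option (Fin (n + 1) × Fin d) =>
      L2 (Config d (n + 1)))) =
      ((fun x => x none) ⁻¹' (antisym d (n + 1) : Set _) ∩ {x | ⟪shellState θ, x none⟫_ℂ = 0}) ∩
      ⋂ m : Fin (n + 1) × Fin d, (fun x => (x none, x (some m))) ⁻¹'
        (weakDerivGraph (dir m.1 m.2) : Set _) := by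
    ext x
    rw [SetLike.mem_coe, mem_gapSpace]
    simp
  rw [h]
  refine ((isClosed_antisym.preimage (h0 _)).inter
    (isClosed_eq (continuous_const.inner (h0 _)) continuous_const)).inter
    (isClosed_iInter fun m => (isClosed_weakDerivGraph _).preimage ((h0 _).prodMk (h0 _)))

instance (θ : Fin (n + 1) → Test (Space d)) : CompleteSpace (gapSpace θ) :=
  (isClosed_gapSpace θ).completeSpace_coe

/-- The component `ψ` (for `none`) or `∂_m ψ` (for `some m`) of an element of `gapSpace`. -/
def gapProj (θ : Fin (n + 1) → Test (Space d)) (o : Option (Fin (n + 1) × Fin d)) :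
    gapSpace θ →L[ℂ] L2 (Config d (n + 1)) :=
  (PiLp.proj 2 (𝕜 := ℂ) _ o) ∘L (gapSpace θ).subtypeL

theorem gapProj_none_mem (θ : Fin (n + 1) → Test (Space d)) (x : gapSpace θ) :
    gapProj θ none x ∈ formDomain (n := n) 0 (ofBounded (shellPot θ)) := by
  have h := (mem_gapSpace θ _).1 x.2
  exact mem_formDomain_shell θ h.1.1 (mem_H1_config fun i a => ⟨_, h.2 (i, a)⟩)

theorem inner_gapProj_none (θ : Fin (n + 1) → Test (Space d)) (x : gapSpace θ) :
    ⟪shellState θ, gapProj θ none x⟫_ℂ = 0 := ((mem_gapSpace θ _).1 x.2).1.2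

theorem gapProj_some (θ : Fin (n + 1) → Test (Space d)) (x : gapSpace θ)
    (m : Fin (n + 1) × Fin d) : derivH1 (dir m.1 m.2)
      ⟨gapProj θ none x, (gapProj_none_mem θ x).1.1.2⟩ = gapProj θ (some m) x :=
  derivH1_eq (((mem_gapSpace θ _).1 x.2).2 m)

theorem exists_gapProj_eq (θ : Fin (n + 1) → Test (Space d))
    (ψ : formDomain (n := n) 0 (ofBounded (shellPot θ)))
    (h : ⟪shellState θ, (ψ : L2 (Config d (n + 1)))⟫_ℂ = 0) :
    ∃ x : gapSpace θ, gapProj θ none x = ψ := by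
  let y : PiLp 2 fun _ : Option (Fin (n + 1) × Fin d) => L2 (Config d (n + 1)) :=
    WithLp.toLp 2 fun o => o.elim (ψ : L2 (Config d (n + 1)))
      fun m => derivH1 (dir m.1 m.2) ⟨ψ, ψ.2.1.1.2⟩
  exact ⟨⟨y, (mem_gapSpace θ y).2 ⟨⟨ψ.2.1.1.1, h⟩, fun m => derivH1_mem _ ⟨_, ψ.2.1.1.2⟩⟩⟩, rfl⟩

theorem norm_sq_gapSpace (θ : Fin (n + 1) → Test (Space d)) (x : gapSpace θ) :
    ‖x‖ ^ 2 = ‖gapProj θ none x‖ ^ 2 + ∑ m, ‖gapProj θ (some m) x‖ ^ 2 := by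
  have h := PiLp.norm_sq_eq_of_L2 _
    (x : PiLp 2 fun _ : Option (Fin (n + 1) × Fin d) => L2 (Config d (n + 1)))
  rw [Fintype.sum_option] at h
  exact h

theorem hamForm_gapProj (θ : Fin (n + 1) → Test (Space d)) (x y : gapSpace θ) :
    hamForm 0 (ofBounded (shellPot θ)) ⟨_, gapProj_none_mem θ y⟩ ⟨_, gapProj_none_mem θ x⟩ =
      ∑ m, ⟪gapProj θ (some m) y, gapProj θ (some m) x⟫_ℂ +
        ⟪gapProj θ none y, (∑ i, shellLift θ i) (gapProj θ none x)⟫_ℂ := by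
  rw [hamForm_shell]
  simp only [gapProj_some]

/-- Below the gap, the equation `(H - z) x = η` has a weak solution on the complement of the
filled shell that depends continuously on `η`. -/
theorem IsShell.exists_gap_resolvent {θ : Fin (n + 1) → Test (Space d)} (h : IsShell θ) {z : ℂ}
    (hz : z.re < -n) : ∃ S : L2 (Config d (n + 1)) →L[ℂ] gapSpace θ,
      ∀ y η, hamForm 0 (ofBounded (shellPot θ)) ⟨_, gapProj_none_mem θ y⟩
        ⟨_, gapProj_none_mem θ (S η)⟩ - z * ⟪gapProj θ none y, gapProj θ none (S η)⟫_ℂ =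
          ⟪gapProj θ none y, η⟫_ℂ := by
  obtain ⟨S, hS⟩ := exists_bounded_weak_solution (gapProj θ none) (fun m => gapProj θ (some m))
    (∑ i, shellLift θ i) (norm_sq_gapSpace θ) (c := -(n : ℝ)) (fun x => by
      have h1 := h.le_hamForm_of_orthogonal ⟨_, gapProj_none_mem θ x⟩ (inner_gapProj_none θ x)
      rw [hamForm_gapProj, Complex.add_re, Complex.re_sum] at h1
      have h2 : ∀ m, (⟪gapProj θ (some m) x, gapProj θ (some m) x⟫_ℂ).re =
        ‖gapProj θ (some m) x‖ ^ 2 := fun m => inner_self_eq_norm_sq (𝕜 := ℂ) _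
      simp only [h2] at h1
      rw [neg_mul]
      exact h1) hz
  refine ⟨S, fun y η => ?_⟩
  rw [hamForm_gapProj]
  exact hS y η

/-- The resolvent near the ground state energy: it is explicit on the filled shell, and given by
the Lax–Milgram theorem on the complement. -/
theorem IsShell.exists_resolvent {θ : Fin (n + 1) → Test (Space d)} (h : IsShell θ) {z : ℂ}
    (hz : z.re < -n) (hz' : z ≠ -((n + 1 : ℕ) : ℂ)) :
    ∃ (T : L2 (Config d (n + 1)) →L[ℂ] L2 (Config d (n + 1)))
      (hT : ∀ η, T η ∈ formDomain (n := n) 0 (ofBounded (shellPot θ))),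
      ∀ η (χ : formDomain (n := n) 0 (ofBounded (shellPot θ))),
        hamForm 0 (ofBounded (shellPot θ)) χ ⟨T η, hT η⟩ =
          ⟪(χ : L2 (Config d (n + 1))), η + z • T η⟫_ℂ := by
  have hw : AEStronglyMeasurable (0 : Space d → ℝ) volume := aestronglyMeasurable_zero
  have hA := isSelfAdjoint_ofBounded (isSelfAdjoint_shellPot θ)
  obtain ⟨S, hS⟩ := h.exists_gap_resolvent hz
  set Φ : formDomain (n := n) 0 (ofBounded (shellPot θ)) :=
    ⟨_, shellState_mem_formDomain θ⟩ with hΦ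
  set k : ℂ := -((n + 1 : ℕ) : ℂ) - z with hk
  have hk0 : k ≠ 0 := fun h0 => hz' (sub_eq_zero.1 h0).symm
  let T : L2 (Config d (n + 1)) →L[ℂ] L2 (Config d (n + 1)) :=
    k⁻¹ • InnerProductSpace.rankOne ℂ (shellState θ) (shellState θ) + gapProj θ none ∘L S
  have hT : ∀ η, T η = (k⁻¹ * ⟪shellState θ, η⟫_ℂ) • shellState θ + gapProj θ none (S η) := by
    intro η
    simp only [T, _root_.add_apply, _root_.smul_apply, InnerProductSpace.rankOne_apply,
      ContinuousLinearMap.comp_apply, smul_smul]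
  have hTmem : ∀ η, T η ∈ formDomain (n := n) 0 (ofBounded (shellPot θ)) := fun η => by
    rw [hT]
    exact Submodule.add_mem _ (Submodule.smul_mem _ _ Φ.2) (gapProj_none_mem θ _)
  have hΦn : ⟪shellState θ, shellState θ⟫_ℂ = 1 := by
    rw [inner_self_eq_norm_sq_to_K, norm_shellState h]
    simp
  refine ⟨T, hTmem, fun η χ => ?_⟩
  set x := S η with hx
  set a : ℂ := ⟪shellState θ, (χ : L2 (Config d (n + 1)))⟫_ℂ with ha
  set χ' : formDomain (n := n) 0 (ofBounded (shellPot θ)) := χ - a • Φ with hχ'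
  have hχ0 : ⟪shellState θ, (χ' : L2 (Config d (n + 1)))⟫_ℂ = 0 := by
    change ⟪shellState θ, (χ : L2 (Config d (n + 1))) - a • shellState θ⟫_ℂ = 0
    rw [inner_sub_right, inner_smul_right, hΦn, mul_one, ← ha, sub_self]
  have hχ : χ = a • Φ + χ' := by rw [hχ', add_sub_cancel]
  obtain ⟨y, hy⟩ := exists_gapProj_eq θ χ' hχ0
  set X : formDomain (n := n) 0 (ofBounded (shellPot θ)) := ⟨_, gapProj_none_mem θ x⟩ with hX
  have hTX : (⟨T η, hTmem η⟩ : formDomain (n := n) 0 (ofBounded (shellPot θ))) =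
      (k⁻¹ * ⟪shellState θ, η⟫_ℂ) • Φ + X := Subtype.ext (hT η)
  have h1 : hamForm 0 (ofBounded (shellPot θ)) χ' X =
      ⟪(χ' : L2 (Config d (n + 1))), η⟫_ℂ +
        z * ⟪(χ' : L2 (Config d (n + 1))), gapProj θ none x⟫_ℂ := by
    have h2 := hS y η
    have h3 : (⟨_, gapProj_none_mem θ y⟩ : formDomain (n := n) 0 (ofBounded (shellPot θ))) = χ' :=
      Subtype.ext hy
    rw [h3, hy] at h2
    rw [← h2]
    ring
  have h4 : hamForm 0 (ofBounded (shellPot θ)) X Φ = 0 := by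
    rw [h.hamForm_shellState, ← inner_conj_symm, inner_gapProj_none, map_zero, mul_zero]
  have h5 : hamForm 0 (ofBounded (shellPot θ)) χ X =
      hamForm 0 (ofBounded (shellPot θ)) χ' X := by
    rw [← hamForm_conj hA, hχ, hamForm_add_right hw, hamForm_smul_right, h4, mul_zero, zero_add,
      hamForm_conj hA]
  have hχc : (χ : L2 (Config d (n + 1))) = a • shellState θ + χ' := congrArg Subtype.val hχ
  have h6 : ⟪(χ' : L2 (Config d (n + 1))), shellState θ⟫_ℂ = 0 := by
    rw [← inner_conj_symm, hχ0, map_zero]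
  rw [hTX, hamForm_add_right hw, hamForm_smul_right, h5, h1, h.hamForm_shellState, hT η, hχc]
  simp only [inner_add_left, inner_add_right, inner_smul_left, inner_smul_right, h6, hΦn,
    inner_gapProj_none]
  have hkk : k⁻¹ * (-((n + 1 : ℕ) : ℂ) - z) = 1 := inv_mul_cancel₀ hk0
  linear_combination (⟪shellState θ, η⟫_ℂ * conj a) * hkk

/-- The ground state energy `-(n + 1)` is the only point of the spectrum with real part below `-n`. -/
theorem IsShell.not_mem_hamSpectrum {θ : Fin (n + 1) → Test (Space d)} (h : IsShell θ) {z : ℂ}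
    (hz : z.re < -n) (hz' : z ≠ -((n + 1 : ℕ) : ℂ)) :
    z ∉ hamSpectrum n 0 (ofBounded (shellPot θ)) := by
  have hw : AEStronglyMeasurable (0 : Space d → ℝ) volume := aestronglyMeasurable_zero
  have hA := isSelfAdjoint_ofBounded (isSelfAdjoint_shellPot θ)
  obtain ⟨T, hTmem, hsol⟩ := h.exists_resolvent hz hz'
  rw [hamSpectrum, Set.mem_ofPred_eq, not_not]
  set k : ℂ := -((n + 1 : ℕ) : ℂ) - z with hk
  have hk0 : k ≠ 0 := fun h0 => hz' (sub_eq_zero.1 h0).symm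
  set Φ : formDomain (n := n) 0 (ofBounded (shellPot θ)) :=
    ⟨_, shellState_mem_formDomain θ⟩ with hΦ
  refine ⟨(T ∘L (antisym d (n + 1)).subtypeL).codRestrict (antisym d (n + 1))
    fun η => (hTmem η).1.1.1, fun ψ η => ⟨?_, ?_⟩⟩
  · rintro ⟨hψ, hψ'⟩
    -- uniqueness: the difference of two solutions is an eigenvector with eigenvalue `z`
    set ξ : formDomain (n := n) 0 (ofBounded (shellPot θ)) :=
      ⟨(ψ : L2 (Config d (n + 1))), hψ⟩ + (-1 : ℂ) • ⟨T η, hTmem η⟩ with hξ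
    have hξc : (ξ : L2 (Config d (n + 1))) = ψ - T η := by
      rw [hξ, Submodule.coe_add, Submodule.coe_smul, neg_one_smul, sub_eq_add_neg]
    have h1 : ∀ χ : formDomain (n := n) 0 (ofBounded (shellPot θ)),
        hamForm 0 (ofBounded (shellPot θ)) χ ξ =
          z * ⟪(χ : L2 (Config d (n + 1))), (ξ : L2 (Config d (n + 1)))⟫_ℂ := by
      intro χ
      rw [hξc, hξ, hamForm_add_right hw, hamForm_smul_right, hψ' χ, hsol]
      simp only [Submodule.coe_add, Submodule.coe_smul, inner_add_right, inner_smul_right,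
        inner_sub_right]
      ring
    have h2 : ⟪shellState θ, (ξ : L2 (Config d (n + 1)))⟫_ℂ = 0 := by
      have h3 := h1 Φ
      rw [← hamForm_conj hA, h.hamForm_shellState, map_mul, inner_conj_symm, map_neg,
        Complex.conj_natCast] at h3
      have h4 : k * ⟪shellState θ, (ξ : L2 (Config d (n + 1)))⟫_ℂ = 0 := by
        rw [hk, sub_mul, h3, sub_self]
      exact (mul_eq_zero.1 h4).resolve_left hk0
    have h3 := h.le_hamForm_of_orthogonal ξ h2
    have h4 : (z * ⟪(ξ : L2 (Config d (n + 1))), (ξ : L2 (Config d (n + 1)))⟫_ℂ).re =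
        z.re * ‖(ξ : L2 (Config d (n + 1)))‖ ^ 2 := by
      rw [inner_self_eq_norm_sq_to_K]
      have : ((‖(ξ : L2 (Config d (n + 1)))‖ : ℂ)) ^ 2 =
        ((‖(ξ : L2 (Config d (n + 1)))‖ ^ 2 : ℝ) : ℂ) := by push_cast; rfl
      rw [show ((RCLike.ofReal ‖(ξ : L2 (Config d (n + 1)))‖ : ℂ)) ^ 2 = _ from this,
        Complex.re_mul_ofReal]
    rw [h1, h4] at h3
    have h5 : ‖(ξ : L2 (Config d (n + 1)))‖ ^ 2 = 0 :=
      le_antisymm (by nlinarith [sq_nonneg ‖(ξ : L2 (Config d (n + 1)))‖]) (sq_nonneg _)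
    have h6 : (ξ : L2 (Config d (n + 1))) = 0 := norm_eq_zero.1 (pow_eq_zero_iff two_ne_zero |>.1 h5)
    rw [hξc, sub_eq_zero] at h6
    exact Subtype.ext h6.symm
  · intro hψ
    have hψc : T η = ψ := congrArg Subtype.val hψ
    refine ⟨hψc ▸ hTmem η, fun χ => ?_⟩
    have := hsol η χ
    simp only [hψc] at this
    exact this

theorem IsShell.groundEnergyIsolated {θ : Fin (n + 1) → Test (Space d)} (h : IsShell θ) :
    GroundEnergyIsolated n 0 (ofBounded (shellPot θ)) := by
  refine ⟨1, one_pos, fun z hz hne => ?_⟩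
  rw [h.groundEnergy_eq] at hne ⊢
  by_contra! hlt
  refine h.not_mem_hamSpectrum (z := z) ?_ ?_ hz
  · have h1 := (Complex.re_le_norm (z - ((-(n + 1) : ℝ) : ℂ))).trans_lt hlt
    rw [Complex.sub_re, Complex.ofReal_re] at h1
    linarith
  · intro h1
    refine hne (h1.trans ?_)
    push_cast
    ring

end Isolation

end MatrixDFT

end

theorem mainTheorem7 (d n : ℕ) (hd : 1 ≤ d) :
    -- a class of pairs of potentials with the same ground state
    (∀ w ∈ interactions d, ∀ G₁ ∈ nonlocalPotentials d, ∀ ψ₁ : L2 (Config d (n + 1)),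
      IsUniqueGroundState w G₁ ψ₁ → GroundEnergyIsolated n w G₁ →
      ∀ φ ∈ H1 (Space d), ‖φ‖ = 1 → WedgeOrthogonal φ ψ₁ →
      ∀ ε : ℝ, 0 < ε →
      ofBounded (proj φ) ∈ nonlocalPotentials d ∧
      G₁ + ofBounded ((ε : ℂ) • proj φ) ∈ nonlocalPotentials d ∧
      (∀ c : ℂ, G₁ + ofBounded ((ε : ℂ) • proj φ) ≠
        G₁ + ofBounded (c • ContinuousLinearMap.id ℂ (L2 (Space d)))) ∧
      groundEnergy n w (G₁ + ofBounded ((ε : ℂ) • proj φ)) = groundEnergy n w G₁ ∧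
      (∃ h : ψ₁ ∈ antisym d (n + 1),
        ((⟨ψ₁, h⟩, (groundEnergy n w G₁ : ℂ) • ⟨ψ₁, h⟩) :
          antisym d (n + 1) × antisym d (n + 1)) ∈
            hamGraph w (G₁ + ofBounded ((ε : ℂ) • proj φ))) ∧
      IsUniqueGroundState w (G₁ + ofBounded ((ε : ℂ) • proj φ)) ψ₁) ∧
    -- without interaction, the ground state is a Slater determinant and a suitable `φ` exists
    (∀ G₁ ∈ nonlocalPotentials d, ∀ ψ₁ : L2 (Config d (n + 1)),
      IsUniqueGroundState 0 G₁ ψ₁ → GroundEnergyIsolated n 0 G₁ →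
      IsSlater ψ₁ ∧ ∃ φ ∈ H1 (Space d), ‖φ‖ = 1 ∧ WedgeOrthogonal φ ψ₁) ∧
    -- the map `G ↦ γ` is not injective, even modulo additive constants
    (∃ G₁ ∈ nonlocalPotentials d, ∃ G₂ ∈ nonlocalPotentials d,
      ∃ ψ₁ ψ₂ : L2 (Config d (n + 1)),
      IsUniqueGroundState 0 G₁ ψ₁ ∧ GroundEnergyIsolated n 0 G₁ ∧
      IsUniqueGroundState 0 G₂ ψ₂ ∧
      rdm ψ₁ =ᵐ[volume] rdm ψ₂ ∧
      ∀ c : ℂ, G₂ ≠ G₁ + ofBounded (c • ContinuousLinearMap.id ℂ (L2 (Space d)))) := by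
  refine ⟨fun w hw G₁ hG₁ ψ₁ hψ₁ _ φ hφ hφn hort ε hε => ?_, fun G₁ hG₁ ψ₁ hψ₁ _ => ?_, ?_⟩
  · have h₂ := add_ofBounded_mem_nonlocalPotentials hG₁ (isSelfAdjoint_smul_proj ε φ)
    have hU := hψ₁.add_proj hG₁.1 hε.le hort
    refine ⟨ofBounded_mem_nonlocalPotentials (isSelfAdjoint_proj φ), h₂,
      fun c => add_proj_ne_add_const hd hG₁.1 hε.ne' hφn c,
      groundEnergy_add_proj hG₁.1 hε.le hψ₁.1 hort, ⟨hψ₁.1.1.1.1.1, ?_⟩, hU⟩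
    have h := hU.1.mem_hamGraph hw.1 h₂.1
    rwa [groundEnergy_add_proj hG₁.1 hε.le hψ₁.1 hort] at h
  · obtain ⟨hA, hH, _⟩ := hG₁
    exact hψ₁.isSlater hd hA hH
  · obtain ⟨θ, hθ1, hθ2⟩ := exists_test_disjoint hd
    have hS : IsShell fun i : Fin (n + 1) => θ i :=
      ⟨fun i => hθ1 i, fun i j hij => hθ2 i j (Fin.val_injective.ne hij)⟩
    have hU := hS.isUniqueGroundState
    have hB := isSelfAdjoint_shellPot fun i : Fin (n + 1) => θ i
    have hG := ofBounded_mem_nonlocalPotentials hB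
    obtain ⟨-, φ, hφ, hφn, hort⟩ := hU.isSlater hd (isSelfAdjoint_ofBounded hB) hG.2.1
    exact ⟨_, hG, _, add_ofBounded_mem_nonlocalPotentials hG (isSelfAdjoint_smul_proj 1 φ), _, _,
      hU, hS.groundEnergyIsolated, hU.add_proj hG.1 zero_le_one hort, Filter.EventuallyEq.rfl,
      fun c => add_proj_ne_add_const hd hG.1 one_ne_zero hφn c⟩
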